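/- Let $M$ be a compact connected $C^\infty$-manifold (Hausdorff, without boundary) of dimension $n\ge 2$, let $g$ be a smooth Riemannian metric on $M$ and $\mathfrak m$ a positive $C^\infty$-measure on $M$ (a positive smooth density times Lebesgue measure in every chart). Let $\mathbf L:TM\to[0,\infty)$ be a Lagrangian: $\mathbf L\in C^1(TM)\cap C^\infty(TM\setminus 0_{TM})$; $\mathbf L=0$ on the zero section $0_{TM}$; $\mathbf L(v)\ge |v|_{g'}-C$ for some Riemannian metric $g'$ and some $C>0$; and, for each $x\in M$, the Hessian of $\mathbf L|_{T_xM}$ is positive definite at every $v\ne 0$. Assume that the Hamiltonian $$\mathbf H(\alpha)=\sup_{v\in T_xM}\{\alpha(v)-\mathbf L(v)\},\qquad \alpha\in T_x^*M,$$ is finite everywhere on $T^*M$, and let $\boldsymbol\tau^*(\alpha)\in T_xM$ be the unique vector $v$ with $\mathbf H(\alpha)=\alpha(v)-\mathbf L(v)$ (the Legendre transform of $\alpha$). Assume (A) for each $\varepsilon>0$ there is $C_\varepsilon>0$ such that $|\boldsymbol\tau^*(\alpha)-\boldsymbol\tau^*(\beta)|_g\le C_\varepsilon|\alpha-\beta|_g$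 for all $x\in M$ and $\alpha,\beta\in T_x^*M$ with $|\boldsymbol\tau^*(\alpha)-\boldsymbol\tau^*(\beta)|_g\ge\varepsilon$. For a weakly differentiable function $u$ on $M$ put $\boldsymbol\nabla u=\boldsymbol\tau^*(du)$. Let $H^1(M;\mathbf H)$, respectively $H^1(M;\mathbf L)$, be the set of weakly differentiable $u\in L^2(M;\mathfrak m)$ with $\mathbf H(du)\in L^1(M;\mathfrak m)$, respectively $\mathbf L(\boldsymbol\nabla u)\in L^1(M;\mathfrak m)$. For $u\in L^2(M;\mathfrak m)$ let $\mathcal E(u)=\int_M\mathbf H(du)\,d\mathfrak m\in[0,\infty]$ if $u$ is weakly differentiable, and $\mathcal E(u)=\infty$ otherwise. For $u\in H^1(M;\mathbf H)$ define the slope $$|\nabla(-\mathcal E)|(u)=\max\Big\{\limsup_{\bar u\to u}\frac{\mathcal E(u)-\mathcal E(\bar u)}{\|\bar u-u\|_{L^2}},\,0\Big\},$$ where $\bar u\in H^1(M;\mathbf H)\setminus\{u\}$ tends to $u$ in $L^2$. The gradient vector $\nabla(-\mathcal E)(u)$ is $0$ if the slope is $0$; if the slope is positive and finite, it is the unique $w\in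 L^2(M;\mathfrak m)$ with $\|w\|_{L^2}=|\nabla(-\mathcal E)|(u)$ and $$\limsup_{\bar w\to w}\,\lim_{s\downarrow 0}\frac{\mathcal E(u)-\mathcal E(u+s\bar w)}{s\|\bar w\|_{L^2}}=|\nabla(-\mathcal E)|(u)\qquad(\bar w\to w\text{ in }L^2).$$ Given $u_0\in H^1(M;\mathbf H)$, a *gradient curve* from $u_0$ is a curve $(u_t)_{t\ge0}$ in $L^2(M;\mathfrak m)$ starting at $u_0$ such that $u_t\to u_0$ in $L^2$ as $t\downarrow0$ and, for each $t>0$, $u_t=\lim_{k\to\infty}(\mathsf U_{t/k})^k(u_0)$ in $L^2$, where $\mathsf U_\delta(v)$ is the minimizer of $u\mapsto\mathcal E(u)+\|u-v\|_{L^2}^2/(2\delta)$ over $H^1(M;\mathbf H)$. **Theorem.** For every $u_0\in H^1(M;\mathbf H)$ a gradient curve from $u_0$ exists, and every gradient curve $(u_t)_{t\ge0}$ from $u_0$ satisfies the following. 1. $u_t\in H^1(M;\mathbf H)$ for all $t\ge0$, and $(u_t)$ solves $\partial_t u=\boldsymbol\Delta^{\mathbf H}_{\mathfrak m}u$ weakly: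 for all $\phi\in C_c^\infty((0,\infty)\times M)$, with $\phi_t=\phi(t,\cdot)$, $$\int_0^\infty\!\!\int_M\partial_t\phi\; u_t\,d\mathfrak m\,dt=\int_0^\infty\!\!\int_M d\phi_t(\boldsymbol\nabla u_t)\,d\mathfrak m\,dt,$$ all the (iterated) integrals being absolutely convergent. 2. For all $t>0$, the slope $|\nabla(-\mathcal E)|(u_t)$ is finite, the gradient vector $\nabla(-\mathcal E)(u_t)$ exists and is unique, $u_t\in H^1(M;\mathbf L)$, and the distributional Laplacian $\boldsymbol\Delta^{\mathbf H}_{\mathfrak m}u_t$, defined by $\int_M\phi\,\boldsymbol\Delta^{\mathbf H}_{\mathfrak m}u_t\,d\mathfrak m=-\int_M d\phi(\boldsymbol\nabla u_t)\,d\mathfrak m$ for $\phi\in C^\infty(M)$, is absolutely continuous with respect to $\mathfrak m$ with density $\nabla(-\mathcal E)(u_t)\in L^2(M;\mathfrak m)$. In particular $$\|\boldsymbol\Delta^{\mathbf H}_{\mathfrak m}u_t\|_{L^2}=\|\nabla(-\mathcal E)(u_t)\|_{L^2}=|\nabla(-\mathcal E)|(u_t).$$ -/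

import Mathlib

open MeasureTheory Filter Set
open scoped Manifold ContDiff Topology ENNReal

namespace HamHeat

noncomputable section

/-- Vectors of `ℝⁿ`, the model space of the manifolds below. -/
abbrev Vec (n : ℕ) : Type := EuclideanSpace ℝ (Fin n)

variable {n : ℕ} {M : Type*} [TopologicalSpace M] [ChartedSpace (Vec n) M]

/-- The cotangent space `T_x^*M`. -/
abbrev Cotangent (n : ℕ) {M : Type*} [TopologicalSpace M] [ChartedSpace (Vec n) M] (x : M) :
    Type := TangentSpace (𝓡 n) x →L[ℝ] ℝ

/-- The differential `dφ_x` of a differentiable function `φ : M → ℝ`. -/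
def diff (n : ℕ) {M : Type*} [TopologicalSpace M] [ChartedSpace (Vec n) M]
    (φ : M → ℝ) (x : M) : Cotangent n x :=
  mfderiv (𝓡 n) 𝓘(ℝ, ℝ) φ x

/-- A smooth Riemannian metric on `M`. -/
abbrev RiemMetric (n : ℕ) (M : Type*) [TopologicalSpace M] [ChartedSpace (Vec n) M]
    [IsManifold (𝓡 n) ∞ M] :=
  Bundle.ContMDiffRiemannianMetric (𝓡 n) ∞ (Vec n) (fun x : M => TangentSpace (𝓡 n) x)

/-- The norm `|v|_g` of a tangent vector. -/
def tangentNorm [IsManifold (𝓡 n) ∞ M] (g : RiemMetric n M) {x : M}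
    (v : TangentSpace (𝓡 n) x) : ℝ :=
  Real.sqrt (g.inner x v v)

/-- The (dual) norm `|α|_g` of a cotangent vector. -/
def cotangentNorm [IsManifold (𝓡 n) ∞ M] (g : RiemMetric n M) {x : M}
    (α : Cotangent n x) : ℝ :=
  ⨆ v : {v : TangentSpace (𝓡 n) x // tangentNorm g v ≤ 1}, α v

/-- Lagrangians on a compact manifold. (On a compact manifold every Riemannian metric is complete,
so completeness of the metric in `superlinear` need not be mentioned.) -/
structure IsLagrangian [CompactSpace M] [IsManifold (𝓡 n) ∞ M]
    (L : TangentBundle (𝓡 n) M → ℝ) : Prop where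
  nonneg : ∀ p, 0 ≤ L p
  contMDiff_one : ContMDiff (𝓡 n).tangent 𝓘(ℝ, ℝ) 1 L
  contMDiffOn_top : ContMDiffOn (𝓡 n).tangent 𝓘(ℝ, ℝ) ∞ L {p | p.2 ≠ 0}
  zero : ∀ x : M, L ⟨x, 0⟩ = 0
  superlinear : ∃ (g : RiemMetric n M) (C : ℝ), 0 < C ∧
    ∀ (x : M) (v : TangentSpace (𝓡 n) x), tangentNorm g v - C ≤ L ⟨x, v⟩
  /-- The Hessian of `L` restricted to `T_xM`, at `v ≠ 0`, is positive definite: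
  its value at `(w, w)` is the second derivative of `s ↦ L (v + s w)` at `s = 0`. -/
  strongly_convex : ∀ (x : M) (v : TangentSpace (𝓡 n) x), v ≠ 0 →
    ∀ w : TangentSpace (𝓡 n) x, w ≠ 0 →
      0 < iteratedDeriv 2 (fun s : ℝ => L ⟨x, v + s • w⟩) 0

/-- The Hamiltonian is finite: the supremum that defines it is a real number, everywhere. -/
def HamiltonianFinite (L : TangentBundle (𝓡 n) M → ℝ) : Prop :=
  ∀ (x : M) (α : Cotangent n x),
    BddAbove (range fun v : TangentSpace (𝓡 n) x => α v - L ⟨x, v⟩)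

/-- The Hamiltonian `H(α) = sup_{v ∈ T_xM} (α(v) - L(v))`. -/
def hamiltonian (L : TangentBundle (𝓡 n) M → ℝ) {x : M} (α : Cotangent n x) : ℝ :=
  ⨆ v : TangentSpace (𝓡 n) x, (α v - L ⟨x, v⟩)

open Classical in
/-- The Legendre transform `τ^*(α)`: the vector `v ∈ T_xM` with `H(α) = α(v) - L(v)`. -/
def legendre (L : TangentBundle (𝓡 n) M → ℝ) {x : M} (α : Cotangent n x) :
    TangentSpace (𝓡 n) x :=
  if h : ∃ v : TangentSpace (𝓡 n) x, hamiltonian L α = α v - L ⟨x, v⟩ then h.choose else 0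

/-- Condition (A): for every `ε > 0` there is `C_ε > 0` with
`|τ^*(α) - τ^*(β)|_g ≤ C_ε |α - β|_g` whenever `|τ^*(α) - τ^*(β)|_g ≥ ε`. -/
def ConditionA [IsManifold (𝓡 n) ∞ M] (g : RiemMetric n M)
    (L : TangentBundle (𝓡 n) M → ℝ) : Prop :=
  ∀ ε : ℝ, 0 < ε → ∃ C : ℝ, 0 < C ∧ ∀ (x : M) (α β : Cotangent n x),
    ε ≤ tangentNorm g (legendre L α - legendre L β) →
      tangentNorm g (legendre L α - legendre L β) ≤ C * cotangentNorm g (α - β)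

/-- Positive smooth measures: in each chart, `m` is Lebesgue measure times a positive smooth
density. -/
def IsPositiveSmoothMeasure (n : ℕ) {M : Type*} [TopologicalSpace M] [ChartedSpace (Vec n) M]
    [MeasurableSpace M] (m : Measure M) : Prop :=
  ∀ e ∈ atlas (Vec n) M, ∃ ρ : Vec n → ℝ,
    ContDiffOn ℝ ∞ ρ e.target ∧ (∀ y ∈ e.target, 0 < ρ y) ∧
      (m.restrict e.source).map e =
        (volume.restrict e.target).withDensity fun y => ENNReal.ofReal (ρ y)

/-- The section `θ` of `T^*M` is the weak differential of `u`: in each chart `e`, in which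
`θ(∂_w)` is the component of `θ` along the constant vector `w ∈ ℝⁿ`, both `u` and `θ(∂_w)` are
locally integrable and `∫ u ∂_w ψ dy = - ∫ θ(∂_w) ψ dy` for all test functions `ψ`. -/
def IsWeakDifferential (u : M → ℝ) (θ : ∀ x : M, Cotangent n x) : Prop :=
  ∀ e ∈ atlas (Vec n) M,
    LocallyIntegrableOn (fun y => u (e.symm y)) e.target volume ∧
    ∀ w : Vec n,
      LocallyIntegrableOn
        (fun y => θ (e.symm y) (mfderiv 𝓘(ℝ, Vec n) (𝓡 n) e.symm y w)) e.target volume ∧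
      ∀ ψ : Vec n → ℝ, ContDiff ℝ ∞ ψ → HasCompactSupport ψ → tsupport ψ ⊆ e.target →
        ∫ y in e.target, u (e.symm y) * fderiv ℝ ψ y w =
          - ∫ y in e.target, θ (e.symm y) (mfderiv 𝓘(ℝ, Vec n) (𝓡 n) e.symm y w) * ψ y

/-- Weak differentiability. -/
def WeaklyDifferentiable (n : ℕ) {M : Type*} [TopologicalSpace M] [ChartedSpace (Vec n) M]
    (u : M → ℝ) : Prop :=
  ∃ θ : ∀ x : M, Cotangent n x, IsWeakDifferential u θ

open Classical in
/-- The weak differential `du` (unique up to null sets). -/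
def weakDiff (n : ℕ) {M : Type*} [TopologicalSpace M] [ChartedSpace (Vec n) M]
    (u : M → ℝ) : ∀ x : M, Cotangent n x :=
  if h : WeaklyDifferentiable n u then h.choose else 0

/-- The gradient vector `∇u(x) = τ^*(du_x)`. -/
def grad (L : TangentBundle (𝓡 n) M → ℝ) (u : M → ℝ) (x : M) : TangentSpace (𝓡 n) x :=
  legendre L (weakDiff n u x)

variable [MeasurableSpace M]

/-- The Sobolev space `H¹(M; H)`. -/
def sobolevH (L : TangentBundle (𝓡 n) M → ℝ) (m : Measure M) : Set (Lp ℝ 2 m) :=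
  {u | WeaklyDifferentiable n (u : M → ℝ) ∧
    Integrable (fun x => hamiltonian L (weakDiff n (u : M → ℝ) x)) m}

/-- The Sobolev space `H¹(M; L)`. -/
def sobolevL (L : TangentBundle (𝓡 n) M → ℝ) (m : Measure M) : Set (Lp ℝ 2 m) :=
  {u | WeaklyDifferentiable n (u : M → ℝ) ∧
    Integrable (fun x => L ⟨x, grad L (u : M → ℝ) x⟩) m}

open Classical in
/-- The energy `E(u) = ∫ H(du) dm ∈ [0, ∞]`, with value `∞` if `u` is not weakly
differentiable. -/
def energy (L : TangentBundle (𝓡 n) M → ℝ) (m : Measure M) (u : Lp ℝ 2 m) : ℝ≥0∞ :=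
  if WeaklyDifferentiable n (u : M → ℝ) then
    ∫⁻ x, ENNReal.ofReal (hamiltonian L (weakDiff n (u : M → ℝ) x)) ∂m
  else ⊤

/-- The slope `|∇(-E)|(u) = max {limsup_{v → u} (E(u) - E(v)) / ‖v - u‖, 0}`, where
`v ∈ H¹(M; H)` tends to `u` in `L²`, `v ≠ u`. -/
def slope (L : TangentBundle (𝓡 n) M → ℝ) (m : Measure M) (u : Lp ℝ 2 m) : EReal :=
  max (limsup (fun v : Lp ℝ 2 m =>
      ((energy L m u : EReal) - (energy L m v : EReal)) / ((‖v - u‖ : ℝ) : EReal))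
    (𝓝[sobolevH L m \ {u}] u)) 0

/-- `r` is the rate of descent `lim_{s ↓ 0} (E(u) - E(u + s v)) / (s ‖v‖)` of the energy at `u` in
the direction `v`. -/
def IsDescentRate (L : TangentBundle (𝓡 n) M → ℝ) (m : Measure M) (u v : Lp ℝ 2 m)
    (r : EReal) : Prop :=
  Tendsto (fun s : ℝ =>
      ((energy L m u : EReal) - (energy L m (u + s • v) : EReal)) / ((s * ‖v‖ : ℝ) : EReal))
    (𝓝[>] 0) (𝓝 r)

/-- `w` is the gradient vector `∇(-E)(u)`: it is `0` where the slope vanishes, and where the slope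
is positive and finite, `‖w‖` is the slope and the upper limit of the rates of descent in
directions `v → w` is the slope. -/
def IsGradientVector (L : TangentBundle (𝓡 n) M → ℝ) (m : Measure M) (u w : Lp ℝ 2 m) : Prop :=
  u ∈ sobolevH L m ∧
    ((slope L m u = 0 ∧ w = 0) ∨
      (0 < slope L m u ∧ slope L m u < ⊤ ∧ ((‖w‖ : ℝ) : EReal) = slope L m u ∧
        ∃ D : Lp ℝ 2 m → EReal, (∀ v, v ≠ 0 → IsDescentRate L m u v (D v)) ∧
          limsup D (𝓝 w) = slope L m u))

/-- `v = U_δ(u)`: `v` minimizes `E(v) + ‖v - u‖² / (2 δ)` over `H¹(M; H)`. -/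
def IsImplicitStep (L : TangentBundle (𝓡 n) M → ℝ) (m : Measure M) (δ : ℝ)
    (u v : Lp ℝ 2 m) : Prop :=
  v ∈ sobolevH L m ∧ ∀ v' ∈ sobolevH L m,
    energy L m v + ENNReal.ofReal (‖v - u‖ ^ 2 / (2 * δ)) ≤
      energy L m v' + ENNReal.ofReal (‖v' - u‖ ^ 2 / (2 * δ))

/-- `(u_t)_{t ≥ 0}` is the gradient curve of `E` from `u₀` built by the implicit Euler scheme:
`u_t = lim_k (U_{t/k})^k(u₀)` in `L²` for `t > 0`, and `u_t → u₀` as `t ↓ 0`.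
(Values of `u` at negative times are irrelevant.) -/
structure IsGradientCurve (L : TangentBundle (𝓡 n) M → ℝ) (m : Measure M) (u₀ : Lp ℝ 2 m)
    (u : ℝ → Lp ℝ 2 m) : Prop where
  initial : u 0 = u₀
  tendsto_initial : Tendsto u (𝓝[>] 0) (𝓝 u₀)
  scheme : ∀ t : ℝ, 0 < t → ∃ σ : ℕ → ℕ → Lp ℝ 2 m,
    (∀ k : ℕ, 1 ≤ k → σ k 0 = u₀ ∧
      ∀ j < k, IsImplicitStep L m (t / k) (σ k j) (σ k (j + 1))) ∧
    Tendsto (fun k => σ k k) atTop (𝓝 (u t))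

/-- The distributional Laplacian of `u`, that is the functional `φ ↦ - ∫ dφ(∇u) dm` on `C^∞(M)`, is
well defined and is given by the density `f` with respect to `m`. (For compact `M`.) -/
def HasLaplacianDensity (L : TangentBundle (𝓡 n) M → ℝ) (m : Measure M) (u f : Lp ℝ 2 m) : Prop :=
  ∀ φ : M → ℝ, ContMDiff (𝓡 n) 𝓘(ℝ, ℝ) ∞ φ →
    Integrable (fun x => diff n φ x (grad L (u : M → ℝ) x)) m ∧
    Integrable (fun x => φ x * f x) m ∧
    ∫ x, φ x * f x ∂m = - ∫ x, diff n φ x (grad L (u : M → ℝ) x) ∂m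

/-- `(u_t)` solves `∂_t u = Δu` in the weak sense: for all `φ ∈ C_c^∞((0,∞) × M)`,
`∫_0^∞ ∫_M ∂_t φ u_t dm dt = ∫_0^∞ ∫_M dφ_t(∇u_t) dm dt`, all integrals being convergent. -/
def IsWeakHeatSolution (L : TangentBundle (𝓡 n) M → ℝ) (m : Measure M)
    (u : ℝ → Lp ℝ 2 m) : Prop :=
  ∀ φ : ℝ × M → ℝ, ContMDiff (𝓘(ℝ, ℝ).prod (𝓡 n)) 𝓘(ℝ, ℝ) ∞ φ → HasCompactSupport φ →
    tsupport φ ⊆ Ioi (0 : ℝ) ×ˢ (univ : Set M) →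
    (∀ t : ℝ, 0 < t → Integrable (fun x => deriv (fun s => φ (s, x)) t * u t x) m ∧
      Integrable (fun x => diff n (fun y => φ (t, y)) x (grad L (u t : M → ℝ) x)) m) ∧
    IntegrableOn (fun t => ∫ x, deriv (fun s => φ (s, x)) t * u t x ∂m) (Ioi 0) ∧
    IntegrableOn
      (fun t => ∫ x, diff n (fun y => φ (t, y)) x (grad L (u t : M → ℝ) x) ∂m) (Ioi 0) ∧
    ∫ t in Ioi (0 : ℝ), ∫ x, deriv (fun s => φ (s, x)) t * u t x ∂m =
      ∫ t in Ioi (0 : ℝ), ∫ x, diff n (fun y => φ (t, y)) x (grad L (u t : M → ℝ) x) ∂m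

end

end HamHeat

/-! The energy `E` is convex and lower semicontinuous on the Hilbert space `L²(M; m)`, so the
implicit Euler scheme converges to its gradient flow. The special feature is that wherever `E` has a
subgradient `ξ` at `u`, that subgradient is unique and `-ξ` is the Laplacian of `u`.

Convexity holds fibre by fibre. For lower semicontinuity (`isClosed_energy_le`): `L` is bounded on
bounded sets of vectors, so `H` is superlinear; an energy bound makes differentials uniformly
integrable, hence weakly compact in `L¹`, and Fenchel's inequality passes to weak limits.

Condition (A) with `β = 0` makes the Legendre transform grow at most linearly. Hence adding a smooth
`φ` keeps the energy finite, and `E` has the derivative `∫ dφ(∇u)` at `u` in the direction `φ`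
(`tendsto_slope_energy`). The subgradient inequality for `φ` and `-φ` becomes `⟨ξ, φ⟩ = ∫ dφ(∇u)`
(`inner_subgradient`). Smooth functions are dense in `L²`, so `ξ` is unique, the slope is `‖ξ‖` and
the gradient vector is `-ξ` (`max_limsup_eq_norm`, `isGradient_iff`). Testing with `(1 - s) u` gives
integrability of `du(∇u)`, hence of `L(∇u) = du(∇u) - H(du)`.

For the flow, monotonicity of subgradients compares schemes with different steps (`scheme_dist_le`),
which gives convergence. The discrete speeds decrease, so at time `t` they are at most `√(E(u₀)/t)`,
and their weak limits are subgradients at `u_t`. Uniqueness makes all discrete speeds near time `s`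
converge weakly to `ξ_s`; therefore `t ↦ ⟨u_t, ψ⟩` has the derivative `-⟨ξ_t, ψ⟩` at every `t > 0`,
without exceptional times (`flow_hasDerivAt`). Integration by parts in time is the heat equation.

For measure theory, a finite cover by compact pieces of charts trivializes `TM` measurably
(`ChartCover`). Differentials become `ℝⁿ`-valued functions, and the analysis on fibres is carried
out for `FibreLagrangian`. -/

set_option linter.unusedSectionVars false

/-! ### Convex functions on a Hilbert space: weak limits, subgradients, proximal steps. -/

namespace GradientFlow

section Weak

variable {H : Type*} [NormedAddCommGroup H] [InnerProductSpace ℝ H]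

/-- Bounded families in a Hilbert space converge weakly along ultrafilters. -/
theorem exists_weak_limit [CompleteSpace H] {ι : Type*} (f : Ultrafilter ι) {ξ : ι → H} {C : ℝ}
    (h : ∀ᶠ i in (f : Filter ι), ‖ξ i‖ ≤ C) :
    ∃ z : H, ‖z‖ ≤ C ∧
      ∀ ψ : H, Tendsto (fun i => inner ℝ (ξ i) ψ) f (𝓝 (inner ℝ z ψ)) := by
  -- Banach–Alaoglu, carried over to `H` by the Riesz isometry.
  have hK := WeakDual.isCompact_closedBall (𝕜 := ℝ) (E := H) 0 C
  set Φ : ι → WeakDual ℝ H := fun i => StrongDual.toWeakDual (InnerProductSpace.toDual ℝ H (ξ i))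
    with hΦ
  have hle : (f.map Φ : Filter (WeakDual ℝ H)) ≤
      𝓟 (WeakDual.toStrongDual ⁻¹' Metric.closedBall (0 : StrongDual ℝ H) C) := by
    rw [le_principal_iff]
    change ∀ᶠ i in (f : Filter ι), _
    filter_upwards [h] with i hi
    change InnerProductSpace.toDual ℝ H (ξ i) ∈ Metric.closedBall (0 : StrongDual ℝ H) C
    rw [mem_closedBall_zero_iff, LinearIsometryEquiv.norm_map]
    exact hi
  obtain ⟨l, hl, hfl⟩ := hK.ultrafilter_le_nhds _ hle
  refine ⟨(InnerProductSpace.toDual ℝ H).symm (WeakDual.toStrongDual l), ?_, fun ψ => ?_⟩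
  · rw [LinearIsometryEquiv.norm_map]
    exact mem_closedBall_zero_iff.1 hl
  · rw [InnerProductSpace.toDual_symm_apply]
    have h1 : Tendsto Φ f (𝓝 l) := hfl
    have h2 := ((WeakDual.eval_continuous (𝕜 := ℝ) ψ).tendsto l).comp h1
    exact h2

theorem tendsto_inner_of_weak_of_strong {ι : Type*} {l : Filter ι} {ξ x : ι → H} {z u : H} {C : ℝ}
    (hC : ∀ᶠ i in l, ‖ξ i‖ ≤ C)
    (hξ : ∀ ψ : H, Tendsto (fun i => inner ℝ (ξ i) ψ) l (𝓝 (inner ℝ z ψ)))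
    (hx : Tendsto x l (𝓝 u)) :
    Tendsto (fun i => inner ℝ (ξ i) (x i)) l (𝓝 (inner ℝ z u)) := by
  have h1 : Tendsto (fun i => inner ℝ (ξ i) (x i - u)) l (𝓝 0) := by
    have h2 : Tendsto (fun i => C * ‖x i - u‖) l (𝓝 0) := by
      have := (tendsto_iff_norm_sub_tendsto_zero.1 hx).const_mul C
      simpa using this
    refine squeeze_zero_norm' ?_ h2
    filter_upwards [hC] with i hi
    exact (norm_inner_le_norm _ _).trans (mul_le_mul_of_nonneg_right hi (norm_nonneg _))
  have h3 := h1.add (hξ u)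
  simp only [zero_add, ← inner_add_right, sub_add_cancel] at h3
  exact h3

end Weak

variable {H : Type*} [NormedAddCommGroup H] [InnerProductSpace ℝ H]

/-- `ξ` is a subgradient at `x` of the function `F` with domain `D`. -/
def IsSubgradient (D : Set H) (F : H → ℝ) (x ξ : H) : Prop :=
  x ∈ D ∧ ∀ v ∈ D, F x + inner ℝ ξ (v - x) ≤ F v

/-- `y` minimizes `F + ‖· - x‖² / (2δ)` over `D`. -/
def IsStep (D : Set H) (F : H → ℝ) (δ : ℝ) (x y : H) : Prop :=
  y ∈ D ∧ ∀ v ∈ D, F y + ‖y - x‖ ^ 2 / (2 * δ) ≤ F v + ‖v - x‖ ^ 2 / (2 * δ)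

variable {D : Set H} {F : H → ℝ}

theorem IsSubgradient.inner_nonneg {x y ξ ζ : H} (hx : IsSubgradient D F x ξ)
    (hy : IsSubgradient D F y ζ) : 0 ≤ inner ℝ (ξ - ζ) (x - y) := by
  have h1 := hx.2 y hy.1
  have h2 := hy.2 x hx.1
  have h3 : inner ℝ ξ (y - x) = - inner ℝ ξ (x - y) := by
    rw [← inner_neg_right, neg_sub]
  rw [inner_sub_left]
  linarith

/-- Subgradients are closed under strong convergence of the points and weak convergence along a
filter. -/
theorem isSubgradient_of_tendsto (hcl : ∀ c, IsClosed {u | u ∈ D ∧ F u ≤ c}) {ι : Type*}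
    {l : Filter ι} [l.NeBot] {x ξ : ι → H} {u z : H} {C : ℝ} (hx : Tendsto x l (𝓝 u))
    (hs : ∀ᶠ i in l, IsSubgradient D F (x i) (ξ i)) (hC : ∀ᶠ i in l, ‖ξ i‖ ≤ C)
    (hξ : ∀ ψ : H, Tendsto (fun i => inner ℝ (ξ i) ψ) l (𝓝 (inner ℝ z ψ))) :
    IsSubgradient D F u z := by
  -- Lower semicontinuity is available only as closedness of sublevels. The slack `ε` puts almost
  -- all `x i` into one fixed sublevel, which then contains `u`.
  have key : ∀ v ∈ D, ∀ ε > 0, u ∈ D ∧ F u ≤ F v - inner ℝ z (v - u) + ε := by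
    intro v hv ε hε
    have h1 : Tendsto (fun i => F v - inner ℝ (ξ i) (v - x i)) l
        (𝓝 (F v - inner ℝ z (v - u))) :=
      tendsto_const_nhds.sub
        (tendsto_inner_of_weak_of_strong hC hξ (tendsto_const_nhds.sub hx))
    have h3 : ∀ᶠ i in l, x i ∈ {w | w ∈ D ∧ F w ≤ F v - inner ℝ z (v - u) + ε} := by
      filter_upwards [h1.eventually_lt_const (lt_add_of_pos_right _ hε), hs] with i hi hi2
      exact ⟨hi2.1, by have := hi2.2 v hv; linarith⟩
    exact (hcl _).mem_of_tendsto hx h3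
  obtain ⟨i, hi⟩ := hs.exists
  refine ⟨(key _ hi.1 1 one_pos).1, fun v hv => ?_⟩
  have : F u ≤ F v - inner ℝ z (v - u) :=
    le_of_forall_pos_le_add fun ε hε => (key v hv ε hε).2
  linarith

theorem exists_subgradient_of_tendsto [CompleteSpace H]
    (hcl : ∀ c, IsClosed {u | u ∈ D ∧ F u ≤ c}) {ι : Type*}
    {l : Filter ι} [l.NeBot] {x ξ : ι → H} {u : H} {C : ℝ} (hx : Tendsto x l (𝓝 u))
    (hs : ∀ᶠ i in l, IsSubgradient D F (x i) (ξ i)) (hC : ∀ᶠ i in l, ‖ξ i‖ ≤ C) :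
    ∃ z, IsSubgradient D F u z ∧ ‖z‖ ≤ C := by
  have hle : (Ultrafilter.of l : Filter ι) ≤ l := Ultrafilter.of_le l
  obtain ⟨z, hz, hzt⟩ := exists_weak_limit (Ultrafilter.of l) (hC.filter_mono hle)
  exact ⟨z, isSubgradient_of_tendsto hcl (hx.mono_left hle) (hs.filter_mono hle)
    (hC.filter_mono hle) hzt, hz⟩

/-- Along every ultrafilter the `ξ i` have a weak limit, which is a subgradient at `u`. If there is
only one, all these limits agree, so the whole family converges weakly. This is the source of weak
continuity in time. -/
theorem tendsto_inner_subgradient [CompleteSpace H]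
    (hcl : ∀ c, IsClosed {u | u ∈ D ∧ F u ≤ c}) {ι : Type*}
    {l : Filter ι} {x ξ : ι → H} {u z : H} {C : ℝ} (hx : Tendsto x l (𝓝 u))
    (hs : ∀ᶠ i in l, IsSubgradient D F (x i) (ξ i)) (hC : ∀ᶠ i in l, ‖ξ i‖ ≤ C)
    (hu : ∀ z', IsSubgradient D F u z' → z' = z) (ψ : H) :
    Tendsto (fun i => inner ℝ (ξ i) ψ) l (𝓝 (inner ℝ z ψ)) := by
  rw [tendsto_iff_ultrafilter]
  intro f hf
  obtain ⟨z', -, hzt⟩ := exists_weak_limit f (hC.filter_mono hf)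
  have := isSubgradient_of_tendsto hcl (hx.mono_left hf) (hs.filter_mono hf)
    (hC.filter_mono hf) hzt
  rw [← hu z' this]
  exact hzt ψ

/-- Compare the minimizer `y` with the points `y + s (v - y)`, divide by `s` and let `s ↓ 0`: the
Euler–Lagrange inequality of the step. -/
theorem IsStep.isSubgradient (hF : ConvexOn ℝ D F) {δ : ℝ} (hδ : 0 < δ) {x y : H}
    (h : IsStep D F δ x y) : IsSubgradient D F y (δ⁻¹ • (x - y)) := by
  refine ⟨h.1, fun v hv => ?_⟩
  have key : ∀ s : ℝ, 0 < s → s ≤ 1 →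
      0 ≤ (F v - F y) + inner ℝ (y - x) (v - y) / δ + s * (‖v - y‖ ^ 2 / (2 * δ)) := by
    intro s hs hs1
    have hmem : (1 - s) • y + s • v ∈ D :=
      hF.1 h.1 hv (by linarith) hs.le (by ring)
    have h1 := hF.2 h.1 hv (by linarith : 0 ≤ 1 - s) hs.le (by ring)
    have h2 := h.2 _ hmem
    have h3 : (1 - s) • y + s • v - x = (y - x) + s • (v - y) := by module
    have h4 : ‖(1 - s) • y + s • v - x‖ ^ 2 =
        ‖y - x‖ ^ 2 + 2 * s * inner ℝ (y - x) (v - y) + s ^ 2 * ‖v - y‖ ^ 2 := by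
      rw [h3, norm_add_sq_real, inner_smul_right, norm_smul, mul_pow, Real.norm_eq_abs, sq_abs]
      ring
    rw [h4] at h2
    simp only [smul_eq_mul] at h1
    have h5 : 0 ≤ s * ((F v - F y) + inner ℝ (y - x) (v - y) / δ +
        s * (‖v - y‖ ^ 2 / (2 * δ))) := by
      have h6 : (‖y - x‖ ^ 2 + 2 * s * inner ℝ (y - x) (v - y) + s ^ 2 * ‖v - y‖ ^ 2) / (2 * δ) =
          ‖y - x‖ ^ 2 / (2 * δ) + s * (inner ℝ (y - x) (v - y) / δ) +
            s * (s * (‖v - y‖ ^ 2 / (2 * δ))) := by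
        field_simp
      rw [h6] at h2
      nlinarith
    exact nonneg_of_mul_nonneg_right h5 hs
  have hlim : Tendsto (fun s : ℝ => (F v - F y) + inner ℝ (y - x) (v - y) / δ +
      s * (‖v - y‖ ^ 2 / (2 * δ))) (𝓝[>] 0)
      (𝓝 ((F v - F y) + inner ℝ (y - x) (v - y) / δ + 0 * (‖v - y‖ ^ 2 / (2 * δ)))) :=
    ((continuous_const.add (continuous_id.mul continuous_const)).tendsto 0).mono_left
      nhdsWithin_le_nhds
  have h7 := ge_of_tendsto hlim (by
    filter_upwards [Ioc_mem_nhdsGT (zero_lt_one' ℝ)] with s hs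
    exact key s hs.1 hs.2)
  have h8 : inner ℝ (δ⁻¹ • (x - y)) (v - y) = - (inner ℝ (y - x) (v - y) / δ) := by
    rw [inner_smul_left, ← neg_sub y x, inner_neg_left]
    simp
    field_simp
  rw [h8]
  linarith

theorem IsStep.unique (hF : ConvexOn ℝ D F) {δ : ℝ} (hδ : 0 < δ) {x y y' : H}
    (h : IsStep D F δ x y) (h' : IsStep D F δ x y') : y = y' := by
  have h1 := (h.isSubgradient hF hδ).inner_nonneg (h'.isSubgradient hF hδ)
  have h2 : δ⁻¹ • (x - y) - δ⁻¹ • (x - y') = -(δ⁻¹ • (y - y')) := by module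
  rw [h2, inner_neg_left, inner_smul_left, real_inner_self_eq_norm_sq] at h1
  simp only [conj_trivial] at h1
  have h3 : ‖y - y'‖ ^ 2 ≤ 0 := by
    by_contra! hc
    have := mul_pos (inv_pos.2 hδ) hc
    linarith
  have h4 : ‖y - y'‖ = 0 := by nlinarith [norm_nonneg (y - y')]
  exact sub_eq_zero.1 (norm_eq_zero.1 h4)

/-- The quadratic term is uniformly convex, so a minimizing sequence is Cauchy; no weak compactness
is needed. -/
theorem exists_isStep [CompleteSpace H] (hF : ConvexOn ℝ D F) (hF0 : ∀ u ∈ D, 0 ≤ F u)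
    (hcl : ∀ c, IsClosed {u | u ∈ D ∧ F u ≤ c}) (hne : D.Nonempty) {δ : ℝ} (hδ : 0 < δ) (x : H) :
    ∃ y, IsStep D F δ x y := by
  set G : H → ℝ := fun v => F v + ‖v - x‖ ^ 2 / (2 * δ) with hG
  have hG0 : ∀ v ∈ D, 0 ≤ G v := fun v hv => add_nonneg (hF0 v hv) (by positivity)
  have hbdd : BddBelow (G '' D) := ⟨0, by rintro _ ⟨v, hv, rfl⟩; exact hG0 v hv⟩
  set m := sInf (G '' D) with hm
  have hmle : ∀ v ∈ D, m ≤ G v := fun v hv => csInf_le hbdd (mem_image_of_mem _ hv)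
  have hex : ∀ k : ℕ, ∃ v ∈ D, G v < m + 1 / ((k : ℝ) + 1) := by
    intro k
    obtain ⟨_, ⟨v, hv, rfl⟩, h⟩ := exists_lt_of_csInf_lt (hne.image G)
      (lt_add_of_pos_right m (by positivity : (0 : ℝ) < 1 / ((k : ℝ) + 1)))
    exact ⟨v, hv, h⟩
  choose v hvD hv using hex
  -- By convexity of `F` and the parallelogram law, the value of `G` at the midpoint lies below the
  -- mean of `G a` and `G b` by at least `‖a - b‖² / (8δ)`, and it is at least `m`.
  have hpar : ∀ a ∈ D, ∀ b ∈ D, ‖a - b‖ ^ 2 ≤ 8 * δ * ((G a + G b) / 2 - m) := by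
    intro a ha b hb
    have hz : (1 / 2 : ℝ) • a + (1 / 2 : ℝ) • b ∈ D :=
      hF.1 ha hb (by norm_num) (by norm_num) (by norm_num)
    have h1 := hF.2 ha hb (by norm_num : (0 : ℝ) ≤ 1 / 2) (by norm_num : (0 : ℝ) ≤ 1 / 2)
      (by norm_num)
    have h2 := hmle _ hz
    have h3 : (1 / 2 : ℝ) • a + (1 / 2 : ℝ) • b - x = (1 / 2 : ℝ) • ((a - x) + (b - x)) := by
      module
    have h4 : a - b = (a - x) - (b - x) := by abel
    have h5 := parallelogram_law_with_norm ℝ (a - x) (b - x)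
    simp only [hG, h3, norm_smul, mul_pow, smul_eq_mul] at h1 h2 ⊢
    rw [h4]
    norm_num at h1 h2 ⊢
    have h7 : ‖a - x - (b - x)‖ ^ 2 / (8 * δ) ≤
        ((F a + ‖a - x‖ ^ 2 / (2 * δ) + (F b + ‖b - x‖ ^ 2 / (2 * δ))) / 2 - m) := by
      have h8 : (F a + F b) / 2 + (2 * (‖a - x‖ ^ 2 + ‖b - x‖ ^ 2)
        - ‖a - x - (b - x)‖ ^ 2) / (8 * δ) =
        (F a + ‖a - x‖ ^ 2 / (2 * δ) + (F b + ‖b - x‖ ^ 2 / (2 * δ))) / 2 -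
          ‖a - x - (b - x)‖ ^ 2 / (8 * δ) := by field_simp; ring
      rw [← h5, add_sub_cancel_right] at h8
      have : 1 / 4 * ‖a - x + (b - x)‖ ^ 2 / (2 * δ) =
        ‖a - x + (b - x)‖ ^ 2 / (8 * δ) := by field_simp; ring
      linarith
    rw [div_le_iff₀ (by positivity)] at h7
    simp only [sub_sub_sub_cancel_right] at h7
    linarith
  have hcau : CauchySeq v := by
    refine cauchySeq_of_le_tendsto_0 (fun N : ℕ => Real.sqrt (8 * δ * (1 / ((N : ℝ) + 1)))) ?_ ?_
    · intro k l N hk hl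
      rw [dist_eq_norm]
      refine Real.le_sqrt_of_sq_le ((hpar _ (hvD k) _ (hvD l)).trans ?_)
      have h1 : (1 : ℝ) / ((k : ℝ) + 1) ≤ 1 / ((N : ℝ) + 1) := by gcongr
      have h2 : (1 : ℝ) / ((l : ℝ) + 1) ≤ 1 / ((N : ℝ) + 1) := by gcongr
      have h3 := hv k
      have h4 := hv l
      gcongr
      linarith
    · have h1 := (tendsto_one_div_add_atTop_nhds_zero_nat (𝕜 := ℝ)).const_mul (8 * δ)
      have h2 := (Real.continuous_sqrt.tendsto _).comp h1
      simpa [Function.comp_def] using h2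
  obtain ⟨y, hy⟩ := cauchySeq_tendsto_of_complete hcau
  have hlim : Tendsto (fun k : ℕ => m + 1 / ((k : ℝ) + 1) - ‖v k - x‖ ^ 2 / (2 * δ)) atTop
      (𝓝 (m + 0 - ‖y - x‖ ^ 2 / (2 * δ))) :=
    (tendsto_const_nhds.add tendsto_one_div_add_atTop_nhds_zero_nat).sub
      (((hy.sub_const x).norm.pow 2).div_const _)
  have hlev : ∀ ε > 0, y ∈ D ∧ F y ≤ m + 0 - ‖y - x‖ ^ 2 / (2 * δ) + ε := by
    intro ε hε
    refine (hcl (m + 0 - ‖y - x‖ ^ 2 / (2 * δ) + ε)).mem_of_tendsto hy ?_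
    filter_upwards [hlim.eventually_lt_const (lt_add_of_pos_right _ hε)] with k hk
    refine ⟨hvD k, ?_⟩
    have := hv k
    simp only [hG] at this
    linarith
  refine ⟨y, (hlev 1 one_pos).1, fun w hw => ?_⟩
  have h1 : F y ≤ m + 0 - ‖y - x‖ ^ 2 / (2 * δ) :=
    le_of_forall_pos_le_add fun ε hε => (hlev ε hε).2
  have h2 := hmle w hw
  simp only [hG] at h2
  linarith

end GradientFlow

/-! ### The implicit Euler scheme and its limit. -/

namespace GradientFlow

variable {H : Type*} [NormedAddCommGroup H] [InnerProductSpace ℝ H] {D : Set H} {F : H → ℝ}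

section Scheme

variable {δ : ℝ} {x : ℕ → H} (hF : ConvexOn ℝ D F) (hδ : 0 < δ)
  (hx : ∀ i, IsStep D F δ (x i) (x (i + 1)))

include hF hδ hx

/-- The subgradient inequality at `x (i + 1)`, tested with `x i`, gives the dissipation with the
factor `1/δ`, twice what minimality alone yields. -/
theorem scheme_energy_step (h0 : x 0 ∈ D) (i : ℕ) :
    F (x (i + 1)) + ‖x i - x (i + 1)‖ ^ 2 / δ ≤ F (x i) := by
  have hi : x i ∈ D := by
    cases i with
    | zero => exact h0
    | succ j => exact (hx j).1
  have h := ((hx i).isSubgradient hF hδ).2 _ hi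
  rw [inner_smul_left, real_inner_self_eq_norm_sq] at h
  simp only [conj_trivial] at h
  rwa [div_eq_inv_mul]

theorem scheme_energy_sum (h0 : x 0 ∈ D) (i : ℕ) :
    F (x i) + (∑ j ∈ Finset.range i, ‖x j - x (j + 1)‖ ^ 2) / δ ≤ F (x 0) := by
  induction i with
  | zero => simp
  | succ i ih =>
    have := scheme_energy_step hF hδ hx h0 i
    rw [Finset.sum_range_succ, add_div]
    linarith

/-- Monotonicity of the subgradients at two successive points, followed by Cauchy–Schwarz. -/
theorem scheme_speed_antitone : Antitone fun i => ‖x i - x (i + 1)‖ := by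
  refine antitone_nat_of_succ_le fun i => ?_
  have h := ((hx (i + 1)).isSubgradient hF hδ).inner_nonneg ((hx i).isSubgradient hF hδ)
  rw [← smul_sub, inner_smul_left] at h
  simp only [conj_trivial] at h
  have h1 : 0 ≤ inner ℝ (x (i + 1) - x (i + 1 + 1) - (x i - x (i + 1)))
      (x (i + 1 + 1) - x (i + 1)) := nonneg_of_mul_nonneg_right h (inv_pos.2 hδ)
  rw [← neg_sub (x (i + 1)) (x (i + 1 + 1)), inner_neg_right, inner_sub_left,
    real_inner_self_eq_norm_sq] at h1
  have h2 := real_inner_le_norm (x i - x (i + 1)) (x (i + 1) - x (i + 1 + 1))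
  by_contra! hc
  nlinarith [norm_nonneg (x i - x (i + 1))]

/-- Speeds decrease, so the last one is at most the average over all steps, and the total
dissipation is at most the initial energy. This is the regularizing effect: the bound needs only
finite energy at the start. -/
theorem scheme_speed_le (hF0 : ∀ u ∈ D, 0 ≤ F u) (h0 : x 0 ∈ D) (i : ℕ) :
    ((i : ℝ) + 1) * δ * ‖δ⁻¹ • (x i - x (i + 1))‖ ^ 2 ≤ F (x 0) := by
  have h1 := scheme_energy_sum hF hδ hx h0 (i + 1)
  have h2 := hF0 _ (hx i).1
  have h3 : ((i : ℝ) + 1) * ‖x i - x (i + 1)‖ ^ 2 ≤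
      ∑ j ∈ Finset.range (i + 1), ‖x j - x (j + 1)‖ ^ 2 := by
    have := Finset.card_nsmul_le_sum (Finset.range (i + 1)) (fun j => ‖x j - x (j + 1)‖ ^ 2)
      (‖x i - x (i + 1)‖ ^ 2) (fun j hj => by
        have := scheme_speed_antitone hF hδ hx (Nat.lt_succ_iff.1 (Finset.mem_range.1 hj))
        exact pow_le_pow_left₀ (norm_nonneg _) this 2)
    simpa using this
  rw [norm_smul, mul_pow, Real.norm_eq_abs, sq_abs]
  have h4 : ((i : ℝ) + 1) * δ * (δ⁻¹ ^ 2 * ‖x i - x (i + 1)‖ ^ 2) =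
      (((i : ℝ) + 1) * ‖x i - x (i + 1)‖ ^ 2) / δ := by field_simp
  rw [h4]
  have h5 := div_le_div_of_nonneg_right h3 hδ.le
  linarith

/-- Cauchy–Schwarz turns the bound on the sum of squared steps into a bound on the length of the
path. -/
theorem scheme_dist_start_le (hF0 : ∀ u ∈ D, 0 ≤ F u) (h0 : x 0 ∈ D) (i : ℕ) :
    ‖x i - x 0‖ ^ 2 ≤ F (x 0) * (i * δ) := by
  have h1 := scheme_energy_sum hF hδ hx h0 i
  have h2 : 0 ≤ F (x i) := by
    cases i with
    | zero => exact hF0 _ h0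
    | succ j => exact hF0 _ (hx j).1
  have h3 : ‖x i - x 0‖ ≤ ∑ j ∈ Finset.range i, ‖x j - x (j + 1)‖ := by
    rw [← Finset.sum_range_sub]
    refine (norm_sum_le _ _).trans (Finset.sum_le_sum fun j _ => ?_)
    rw [norm_sub_rev]
  have h4 := sq_sum_le_card_mul_sum_sq (s := Finset.range i) (f := fun j => ‖x j - x (j + 1)‖)
  rw [Finset.card_range] at h4
  have h5 : (∑ j ∈ Finset.range i, ‖x j - x (j + 1)‖ ^ 2) / δ ≤ F (x 0) := by linarith
  rw [div_le_iff₀ hδ] at h5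
  calc ‖x i - x 0‖ ^ 2 ≤ (∑ j ∈ Finset.range i, ‖x j - x (j + 1)‖) ^ 2 :=
        pow_le_pow_left₀ (norm_nonneg _) h3 2
    _ ≤ i * (F (x 0) * δ) := h4.trans (by gcongr)
    _ = _ := by ring

end Scheme

/-- Monotonicity of the two subgradients, cleared of denominators, then `2⟨a, b⟩ ≤ ‖a‖² + ‖b‖²`. The
right side is, up to the factor `δ + η`, a convex combination of the two squared distances with one
step fewer. -/
theorem step_dist_recursion (hF : ConvexOn ℝ D F) {δ η : ℝ} (hδ : 0 < δ) (hη : 0 < η)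
    {x y x' y' : H} (hx : IsStep D F δ x x') (hy : IsStep D F η y y') :
    (δ + η) * ‖x' - y'‖ ^ 2 ≤ η * ‖x - y'‖ ^ 2 + δ * ‖x' - y‖ ^ 2 := by
  have h := (hx.isSubgradient hF hδ).inner_nonneg (hy.isSubgradient hF hη)
  have h1 : 0 ≤ inner ℝ (η • (x - x') - δ • (y - y')) (x' - y') := by
    have : η • (x - x') - δ • (y - y') = (δ * η) • (δ⁻¹ • (x - x') - η⁻¹ • (y - y')) := by
      rw [smul_sub (δ * η), smul_smul, smul_smul]
      congr 2 <;> field_simp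
    rw [this, inner_smul_left]
    exact mul_nonneg (by simp; positivity) h
  have h2 : η • (x - x') - δ • (y - y') =
      η • (x - y') + δ • (x' - y) - (δ + η) • (x' - y') := by module
  rw [h2, inner_sub_left, inner_add_left, inner_smul_left, inner_smul_left, inner_smul_left,
    real_inner_self_eq_norm_sq] at h1
  simp only [conj_trivial] at h1
  have h3 : inner ℝ (x - y') (x' - y') ≤ (‖x - y'‖ ^ 2 + ‖x' - y'‖ ^ 2) / 2 := by
    have := real_inner_le_norm (x - y') (x' - y')
    nlinarith [sq_nonneg (‖x - y'‖ - ‖x' - y'‖)]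
  have h4 : inner ℝ (x' - y) (x' - y') ≤ (‖x' - y‖ ^ 2 + ‖x' - y'‖ ^ 2) / 2 := by
    have := real_inner_le_norm (x' - y) (x' - y')
    nlinarith [sq_nonneg (‖x' - y‖ - ‖x' - y'‖)]
  have h5 := mul_le_mul_of_nonneg_left h3 hη.le
  have h6 := mul_le_mul_of_nonneg_left h4 hδ.le
  linarith

/-- A Kobayashi-type estimate by double induction. On the boundary (`i = 0` or `j = 0`) it is the
bound on the distance from the start, which controls squared distances by elapsed time; hence the
square on the left and the root on the right. -/
theorem scheme_dist_le (hF : ConvexOn ℝ D F) (hF0 : ∀ u ∈ D, 0 ≤ F u) {δ η : ℝ} (hδ : 0 < δ)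
    (hη : 0 < η) {x y : ℕ → H} (hx : ∀ i, IsStep D F δ (x i) (x (i + 1)))
    (hy : ∀ i, IsStep D F η (y i) (y (i + 1))) {u : H} (hu : u ∈ D) (hx0 : x 0 = u)
    (hy0 : y 0 = u) (i j : ℕ) :
    ‖x i - y j‖ ^ 2 ≤ F u * √((i * δ - j * η) ^ 2 + i * δ ^ 2 + j * η ^ 2) := by
  have hFu := hF0 u hu
  have h0 : ∀ i : ℕ, ‖x i - u‖ ^ 2 ≤ F u * (i * δ) := by
    intro i
    have := scheme_dist_start_le hF hδ hx hF0 (hx0 ▸ hu) i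
    rwa [hx0] at this
  have h0' : ∀ i : ℕ, ‖y i - u‖ ^ 2 ≤ F u * (i * η) := by
    intro i
    have := scheme_dist_start_le hF hη hy hF0 (hy0 ▸ hu) i
    rwa [hy0] at this
  induction i generalizing j with
  | zero =>
    rw [hx0, norm_sub_rev]
    refine (h0' j).trans (mul_le_mul_of_nonneg_left ?_ hFu)
    refine Real.le_sqrt_of_sq_le ?_
    simp
    positivity
  | succ i ihi =>
    induction j with
    | zero =>
      rw [hy0]
      refine (h0 (i + 1)).trans (mul_le_mul_of_nonneg_left ?_ hFu)
      refine Real.le_sqrt_of_sq_le ?_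
      simp
      positivity
    | succ j ihj =>
      have hrec := step_dist_recursion hF hδ hη (hx i) (hy j)
      have h1 := ihi (j + 1)
      set A := ((i : ℝ) * δ - ((j + 1 : ℕ) : ℝ) * η) ^ 2 + i * δ ^ 2 + ((j + 1 : ℕ) : ℝ) * η ^ 2
        with hA
      set B := (((i + 1 : ℕ) : ℝ) * δ - (j : ℝ) * η) ^ 2 + ((i + 1 : ℕ) : ℝ) * δ ^ 2 + j * η ^ 2
        with hB
      set Z := (((i + 1 : ℕ) : ℝ) * δ - ((j + 1 : ℕ) : ℝ) * η) ^ 2 + ((i + 1 : ℕ) : ℝ) * δ ^ 2 +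
        ((j + 1 : ℕ) : ℝ) * η ^ 2 with hZ
      have hpos : 0 < δ + η := by positivity
      have hA0 : 0 ≤ A := by positivity
      have hB0 : 0 ≤ B := by positivity
      have hconc := Real.strictConcaveOn_sqrt.concaveOn.2 (mem_Ici.2 hA0) (mem_Ici.2 hB0)
        (by positivity : 0 ≤ η / (δ + η)) (by positivity : 0 ≤ δ / (δ + η))
        (by field_simp; ring)
      -- The expression under the root is chosen so that the recursion holds for it with equality;
      -- concavity of the root then closes the induction.
      have hAB : (η / (δ + η)) • A + (δ / (δ + η)) • B = Z := by
        simp only [smul_eq_mul, hA, hB, hZ]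
        push_cast
        field_simp
        ring
      rw [hAB] at hconc
      simp only [smul_eq_mul] at hconc
      have h2 : η * √A + δ * √B ≤ (δ + η) * √Z := by
        have := mul_le_mul_of_nonneg_left hconc hpos.le
        have h3 : (δ + η) * (η / (δ + η) * √A + δ / (δ + η) * √B) = η * √A + δ * √B := by
          field_simp
        rwa [h3] at this
      have h4 : (δ + η) * ‖x (i + 1) - y (j + 1)‖ ^ 2 ≤ (δ + η) * (F u * √Z) := by
        calc _ ≤ η * (F u * √A) + δ * (F u * √B) := hrec.trans (by gcongr)
          _ = F u * (η * √A + δ * √B) := by ring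
          _ ≤ F u * ((δ + η) * √Z) := by gcongr
          _ = _ := by ring
      exact le_of_mul_le_mul_left h4 hpos

open Classical in
/-- The resolvent: `resolvent D F δ x` minimizes `F + ‖· - x‖² / (2δ)` over `D`. -/
noncomputable def resolvent (D : Set H) (F : H → ℝ) (δ : ℝ) (x : H) : H :=
  if h : ∃ y, IsStep D F δ x y then h.choose else x

/-- The `i`-th iterate of the implicit Euler scheme with step `δ`. -/
noncomputable def euler (D : Set H) (F : H → ℝ) (u : H) (δ : ℝ) (i : ℕ) : H :=
  (resolvent D F δ)^[i] u

theorem isStep_resolvent [CompleteSpace H] (hF : ConvexOn ℝ D F) (hF0 : ∀ u ∈ D, 0 ≤ F u)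
    (hcl : ∀ c, IsClosed {u | u ∈ D ∧ F u ≤ c}) (hne : D.Nonempty) {δ : ℝ} (hδ : 0 < δ) (x : H) :
    IsStep D F δ x (resolvent D F δ x) := by
  have h := exists_isStep hF hF0 hcl hne hδ x
  rw [resolvent, dif_pos h]
  exact h.choose_spec

section Flow

variable [CompleteSpace H] (hF : ConvexOn ℝ D F) (hF0 : ∀ u ∈ D, 0 ≤ F u)
  (hcl : ∀ c, IsClosed {u | u ∈ D ∧ F u ≤ c}) {u₀ : H} (hu₀ : u₀ ∈ D)

include hF hF0 hcl hu₀

theorem isStep_euler {δ : ℝ} (hδ : 0 < δ) (i : ℕ) :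
    IsStep D F δ (euler D F u₀ δ i) (euler D F u₀ δ (i + 1)) := by
  simp only [euler, Function.iterate_succ_apply']
  exact isStep_resolvent hF hF0 hcl ⟨u₀, hu₀⟩ hδ _

theorem euler_dist_le {δ η : ℝ} (hδ : 0 < δ) (hη : 0 < η) (i j : ℕ) :
    ‖euler D F u₀ δ i - euler D F u₀ η j‖ ^ 2 ≤
      F u₀ * √((i * δ - j * η) ^ 2 + i * δ ^ 2 + j * η ^ 2) :=
  scheme_dist_le hF hF0 hδ hη (isStep_euler hF hF0 hcl hu₀ hδ) (isStep_euler hF hF0 hcl hu₀ hη)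
    hu₀ rfl rfl i j

theorem euler_eq_of_isStep {δ : ℝ} (hδ : 0 < δ) {k : ℕ} {σ : ℕ → H} (h0 : σ 0 = u₀)
    (hσ : ∀ j < k, IsStep D F δ (σ j) (σ (j + 1))) {j : ℕ} (hj : j ≤ k) :
    σ j = euler D F u₀ δ j := by
  induction j with
  | zero => exact h0
  | succ j ih =>
    have h1 := hσ j hj
    rw [ih (by omega)] at h1
    exact h1.unique hF hδ (isStep_euler hF hF0 hcl hu₀ hδ j)

theorem exists_flow {t : ℝ} (ht : 0 < t) :
    ∃ z, Tendsto (fun k : ℕ => euler D F u₀ (t / k) k) atTop (𝓝 z) := by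
  -- The index is shifted because the step `t / k` must be positive. Both schemes end at time `t`,
  -- so the square under the root in `euler_dist_le` vanishes and only terms `t² / k` remain.
  have hcau : CauchySeq fun k : ℕ => euler D F u₀ (t / (k + 1 : ℕ)) (k + 1) := by
    refine cauchySeq_of_le_tendsto_0
      (fun N : ℕ => √(F u₀ * √(2 * t ^ 2 * (1 / ((N : ℝ) + 1))))) ?_ ?_
    · intro k l N hk hl
      rw [dist_eq_norm]
      refine Real.le_sqrt_of_sq_le ((euler_dist_le hF hF0 hcl hu₀ (by positivity) (by positivity)
        _ _).trans (mul_le_mul_of_nonneg_left (Real.sqrt_le_sqrt ?_) (hF0 _ hu₀)))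
      have h1 : ∀ k : ℕ, N ≤ k → ((k + 1 : ℕ) : ℝ) * (t / ((k + 1 : ℕ) : ℝ)) ^ 2 ≤
          t ^ 2 * (1 / ((N : ℝ) + 1)) := by
        intro k hk
        have h2 : ((k + 1 : ℕ) : ℝ) * (t / ((k + 1 : ℕ) : ℝ)) ^ 2 = t ^ 2 * (1 / ((k : ℝ) + 1)) := by
          push_cast
          field_simp
        rw [h2]
        gcongr
      have h2 : ∀ k : ℕ, ((k + 1 : ℕ) : ℝ) * (t / ((k + 1 : ℕ) : ℝ)) = t := by
        intro k
        field_simp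
      rw [h2, h2, sub_self]
      have := h1 k hk
      have := h1 l hl
      linarith
    · have h1 := (tendsto_one_div_add_atTop_nhds_zero_nat (𝕜 := ℝ)).const_mul (2 * t ^ 2)
      have h2 := ((Real.continuous_sqrt.tendsto _).comp h1).const_mul (F u₀)
      have h3 := (Real.continuous_sqrt.tendsto _).comp h2
      simpa [Function.comp_def] using h3
  obtain ⟨z, hz⟩ := cauchySeq_tendsto_of_complete hcau
  exact ⟨z, (tendsto_add_atTop_iff_nat 1).1 hz⟩

variable {u : ℝ → H}
  (hu : ∀ t, 0 < t → Tendsto (fun k : ℕ => euler D F u₀ (t / k) k) atTop (𝓝 (u t)))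

include hu

/-- The limit `k → ∞` of `euler_dist_le` with step `t / k` and index `k`, where `k (t / k)²` tends
to `0`. -/
theorem flow_dist_euler_le {t δ : ℝ} (ht : 0 < t) (hδ : 0 < δ) (j : ℕ) :
    ‖u t - euler D F u₀ δ j‖ ^ 2 ≤ F u₀ * √((t - j * δ) ^ 2 + j * δ ^ 2) := by
  have h1 : Tendsto (fun k : ℕ => ‖euler D F u₀ (t / k) k - euler D F u₀ δ j‖ ^ 2) atTop
      (𝓝 (‖u t - euler D F u₀ δ j‖ ^ 2)) := (((hu t ht).sub_const _).norm).pow 2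
  have h2 : Tendsto (fun k : ℕ => F u₀ * √((t - j * δ) ^ 2 + t ^ 2 * (k : ℝ)⁻¹ + j * δ ^ 2)) atTop
      (𝓝 (F u₀ * √((t - j * δ) ^ 2 + t ^ 2 * 0 + j * δ ^ 2))) := by
    refine (((Real.continuous_sqrt.tendsto _).comp ?_)).const_mul _
    exact (tendsto_const_nhds.add (tendsto_inv_atTop_nhds_zero_nat.const_mul _)).add
      tendsto_const_nhds
  rw [mul_zero, add_zero] at h2
  refine le_of_tendsto_of_tendsto h1 h2 ?_
  filter_upwards [eventually_gt_atTop 0] with k hk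
  have hk' : (0 : ℝ) < k := by exact_mod_cast hk
  have := euler_dist_le hF hF0 hcl hu₀ (by positivity : 0 < t / k) hδ k j
  have e1 : (k : ℝ) * (t / k) = t := by field_simp
  have e2 : (k : ℝ) * (t / k) ^ 2 = t ^ 2 * (k : ℝ)⁻¹ := by field_simp
  rwa [e1, e2] at this

theorem flow_dist_start_le {t : ℝ} (ht : 0 < t) : ‖u t - u₀‖ ^ 2 ≤ F u₀ * t := by
  have := flow_dist_euler_le hF hF0 hcl hu₀ hu ht one_pos 0
  simpa [euler, abs_of_pos ht, Real.sqrt_sq ht.le] using this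

/-- Any refinement of the grid works, as long as the step tends to `0` and the elapsed time `j δ` to
`t`. This freedom allows one grid to be used for two different times. -/
theorem tendsto_euler_flow {t : ℝ} (ht : 0 < t) {ι : Type*} {l : Filter ι} {δ : ι → ℝ} {j : ι → ℕ}
    (hδ0 : ∀ᶠ i in l, 0 < δ i) (hδ : Tendsto δ l (𝓝 0))
    (hj : Tendsto (fun i => j i * δ i) l (𝓝 t)) :
    Tendsto (fun i => euler D F u₀ (δ i) (j i)) l (𝓝 (u t)) := by
  rw [tendsto_iff_norm_sub_tendsto_zero]
  have h1 : Tendsto (fun i => F u₀ * √((t - j i * δ i) ^ 2 + (j i * δ i) * δ i)) l (𝓝 0) := by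
    have := (((Real.continuous_sqrt.tendsto _).comp
      (((hj.const_sub t).pow 2).add (hj.mul hδ)))).const_mul (F u₀)
    simpa [Function.comp_def] using this
  have h2 := (Real.continuous_sqrt.tendsto _).comp h1
  rw [Real.sqrt_zero] at h2
  refine squeeze_zero' (Eventually.of_forall fun _ => norm_nonneg _) ?_ h2
  filter_upwards [hδ0] with i hi
  refine Real.le_sqrt_of_sq_le ?_
  have := flow_dist_euler_le hF hF0 hcl hu₀ hu ht hi (j i)
  rw [norm_sub_rev]
  convert this using 3
  ring

/-- The discrete speeds of the last steps are subgradients bounded by `√(F u₀ / t)`; a weak limit is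
a subgradient at `u t` with the same bound. -/
theorem flow_exists_subgradient {t : ℝ} (ht : 0 < t) :
    ∃ ξ, IsSubgradient D F (u t) ξ ∧ ‖ξ‖ ≤ √(F u₀ / t) := by
  have hpos : ∀ k : ℕ, 0 < t / (k + 1 : ℕ) := fun k => by positivity
  refine exists_subgradient_of_tendsto hcl (l := atTop)
    (x := fun k : ℕ => euler D F u₀ (t / (k + 1 : ℕ)) (k + 1))
    (ξ := fun k : ℕ => (t / (k + 1 : ℕ))⁻¹ •
      (euler D F u₀ (t / (k + 1 : ℕ)) k - euler D F u₀ (t / (k + 1 : ℕ)) (k + 1)))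
    ((tendsto_add_atTop_iff_nat 1).2 (hu t ht)) (Eventually.of_forall fun k => ?_)
    (Eventually.of_forall fun k => ?_)
  · exact (isStep_euler hF hF0 hcl hu₀ (hpos k) k).isSubgradient hF (hpos k)
  · refine Real.le_sqrt_of_sq_le ?_
    have := scheme_speed_le hF (hpos k) (isStep_euler hF hF0 hcl hu₀ (hpos k)) hF0 hu₀ k
    rw [le_div_iff₀ ht, mul_comm]
    have e1 : ((k : ℝ) + 1) * (t / ((k + 1 : ℕ) : ℝ)) = t := by
      push_cast
      field_simp
    rwa [e1] at this

end Flow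

end GradientFlow

/-! ### The time derivative of the limit flow, when subgradients along it are unique. -/

namespace GradientFlow

variable {H : Type*} [NormedAddCommGroup H] [InnerProductSpace ℝ H] {D : Set H} {F : H → ℝ}

theorem tendsto_floor_mul {t : ℝ} (ht : 0 ≤ t) :
    Tendsto (fun δ : ℝ => (⌊t / δ⌋₊ : ℝ) * δ) (𝓝[>] 0) (𝓝 t) := by
  have h1 : Tendsto (fun δ : ℝ => t - δ) (𝓝[>] 0) (𝓝 t) := by
    have : Tendsto (fun δ : ℝ => t - δ) (𝓝 0) (𝓝 (t - 0)) :=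
      (continuous_const.sub continuous_id).tendsto 0
    rw [sub_zero] at this
    exact this.mono_left nhdsWithin_le_nhds
  refine tendsto_of_tendsto_of_tendsto_of_le_of_le' h1 tendsto_const_nhds ?_ ?_
  · filter_upwards [self_mem_nhdsWithin] with δ hδ
    have hδ' : 0 < δ := hδ
    have := (Nat.lt_floor_add_one (t / δ)).le
    rw [div_le_iff₀ hδ'] at this
    linarith
  · filter_upwards [self_mem_nhdsWithin] with δ hδ
    have hδ' : 0 < δ := hδ
    have := Nat.floor_le (by positivity : 0 ≤ t / δ)
    rwa [le_div_iff₀ hδ'] at this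

variable [CompleteSpace H] (hF : ConvexOn ℝ D F) (hF0 : ∀ u ∈ D, 0 ≤ F u)
  (hcl : ∀ c, IsClosed {u | u ∈ D ∧ F u ≤ c}) {u₀ : H} (hu₀ : u₀ ∈ D) {u : ℝ → H}
  (hu : ∀ t, 0 < t → Tendsto (fun k : ℕ => euler D F u₀ (t / k) k) atTop (𝓝 (u t)))

include hF hF0 hcl hu₀ hu

theorem flow_dist_le {t s : ℝ} (ht : 0 < t) (hs : 0 < s) :
    ‖u t - u s‖ ^ 2 ≤ F u₀ * |t - s| := by
  have h1 : Tendsto (fun k : ℕ => ‖u t - euler D F u₀ (s / k) k‖ ^ 2) atTop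
      (𝓝 (‖u t - u s‖ ^ 2)) := (((hu s hs).const_sub _).norm).pow 2
  have h2 : Tendsto (fun k : ℕ => F u₀ * √((t - s) ^ 2 + s ^ 2 * (k : ℝ)⁻¹)) atTop
      (𝓝 (F u₀ * √((t - s) ^ 2 + s ^ 2 * 0))) := by
    refine (((Real.continuous_sqrt.tendsto _).comp ?_)).const_mul _
    exact tendsto_const_nhds.add (tendsto_inv_atTop_nhds_zero_nat.const_mul _)
  rw [mul_zero, add_zero, Real.sqrt_sq_eq_abs] at h2
  refine le_of_tendsto_of_tendsto h1 h2 ?_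
  filter_upwards [eventually_gt_atTop 0] with k hk
  have hk' : (0 : ℝ) < k := by exact_mod_cast hk
  have := flow_dist_euler_le hF hF0 hcl hu₀ hu ht (by positivity : 0 < s / k) k
  have e1 : (k : ℝ) * (s / k) = s := by field_simp
  have e2 : (k : ℝ) * (s / k) ^ 2 = s ^ 2 * (k : ℝ)⁻¹ := by field_simp
  rwa [e1, e2] at this

theorem flow_continuousAt {t : ℝ} (ht : 0 < t) : ContinuousAt u t := by
  rw [ContinuousAt, tendsto_iff_norm_sub_tendsto_zero]
  have h1 : Tendsto (fun s : ℝ => √(F u₀ * |s - t|)) (𝓝 t) (𝓝 0) := by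
    have : Continuous fun s : ℝ => √(F u₀ * |s - t|) := by fun_prop
    simpa using this.tendsto t
  refine squeeze_zero' (Eventually.of_forall fun _ => norm_nonneg _) ?_ h1
  filter_upwards [lt_mem_nhds ht] with s hs
  exact Real.le_sqrt_of_sq_le (flow_dist_le hF hF0 hcl hu₀ hu hs ht)

theorem flow_tendsto_start : Tendsto u (𝓝[>] 0) (𝓝 u₀) := by
  rw [tendsto_iff_norm_sub_tendsto_zero]
  have h1 : Tendsto (fun s : ℝ => √(F u₀ * s)) (𝓝[>] 0) (𝓝 0) := by
    have : Continuous fun s : ℝ => √(F u₀ * s) := by fun_prop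
    have := this.tendsto 0
    rw [mul_zero, Real.sqrt_zero] at this
    exact this.mono_left nhdsWithin_le_nhds
  refine squeeze_zero' (Eventually.of_forall fun _ => norm_nonneg _) ?_ h1
  filter_upwards [self_mem_nhdsWithin] with s hs
  exact Real.le_sqrt_of_sq_le (flow_dist_start_le hF hF0 hcl hu₀ hu hs)

variable {ξ : ℝ → H} (hξ : ∀ t, 0 < t → ∀ z, IsSubgradient D F (u t) z ↔ z = ξ t)

include hξ

theorem flow_norm_subgradient_le {t : ℝ} (ht : 0 < t) : ‖ξ t‖ ≤ √(F u₀ / t) := by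
  obtain ⟨z, hz, hz'⟩ := flow_exists_subgradient hF hF0 hcl hu₀ hu ht
  rwa [(hξ t ht z).1 hz] at hz'

theorem flow_norm_subgradient_bound {t : ℝ} (ht : 0 < t) :
    ∀ᶠ s in 𝓝 t, ‖ξ s‖ ≤ √(F u₀ / (t / 2)) := by
  filter_upwards [lt_mem_nhds (half_lt_self ht)] with s hs
  refine (flow_norm_subgradient_le hF hF0 hcl hu₀ hu hξ (by linarith)).trans (Real.sqrt_le_sqrt ?_)
  have := hF0 _ hu₀
  gcongr

theorem flow_tendsto_inner_subgradient {t : ℝ} (ht : 0 < t) (ψ : H) :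
    Tendsto (fun s => inner ℝ (ξ s) ψ) (𝓝 t) (𝓝 (inner ℝ (ξ t) ψ)) := by
  refine tendsto_inner_subgradient hcl (flow_continuousAt hF hF0 hcl hu₀ hu ht) ?_
    (flow_norm_subgradient_bound hF hF0 hcl hu₀ hu hξ ht) (fun z hz => (hξ t ht z).1 hz) ψ
  filter_upwards [lt_mem_nhds ht] with s hs
  exact (hξ s hs _).2 rfl

/-- All discrete speeds taken with small step at discrete times near `s` are weakly close to `ξ s`,
because every weak limit of them is a subgradient at `u s`. -/
theorem euler_speed_close {s : ℝ} (hs : 0 < s) (ψ : H) {ε : ℝ} (hε : 0 < ε) :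
    ∃ η > 0, ∀ δ : ℝ, 0 < δ → δ < η → ∀ j : ℕ, |j * δ - s| < η →
      |inner ℝ (δ⁻¹ • (euler D F u₀ δ j - euler D F u₀ δ (j + 1))) ψ - inner ℝ (ξ s) ψ| < ε := by
  -- The filter of pairs (step, index) with the step decreasing to `0` and the discrete time tending
  -- to `s`; convergence along it unfolds to the required `η`.
  set L : Filter (ℝ × ℕ) := (𝓝[>] 0 ×ˢ 𝓝 s).comap fun p : ℝ × ℕ => (p.1, (p.2 : ℝ) * p.1)
    with hL
  have hLt : Tendsto (fun p : ℝ × ℕ => (p.1, (p.2 : ℝ) * p.1)) L (𝓝[>] 0 ×ˢ 𝓝 s) :=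
    tendsto_comap
  have h1 : Tendsto (fun p : ℝ × ℕ => p.1) L (𝓝[>] 0) := hLt.fst
  have h2 : Tendsto (fun p : ℝ × ℕ => (p.2 : ℝ) * p.1) L (𝓝 s) := hLt.snd
  have h1' : Tendsto (fun p : ℝ × ℕ => p.1) L (𝓝 0) := h1.mono_right nhdsWithin_le_nhds
  have hpos : ∀ᶠ p : ℝ × ℕ in L, 0 < p.1 := h1 self_mem_nhdsWithin
  -- The speed of the step from `j` to `j + 1` is a subgradient at the later point, whose time also
  -- tends to `s`.
  have h3 : Tendsto (fun p : ℝ × ℕ => ((p.2 + 1 : ℕ) : ℝ) * p.1) L (𝓝 s) := by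
    have := h2.add h1'
    rw [add_zero] at this
    refine this.congr fun p => ?_
    push_cast
    ring
  have hlim := tendsto_inner_subgradient (D := D) (F := F) hcl (l := L)
    (x := fun p => euler D F u₀ p.1 (p.2 + 1))
    (ξ := fun p => p.1⁻¹ • (euler D F u₀ p.1 p.2 - euler D F u₀ p.1 (p.2 + 1)))
    (u := u s) (z := ξ s) (C := √(F u₀ / (s / 2)))
    (tendsto_euler_flow hF hF0 hcl hu₀ hu hs hpos h1' h3)
    (by
      filter_upwards [hpos] with p hp
      exact (isStep_euler hF hF0 hcl hu₀ hp p.2).isSubgradient hF hp)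
    (by
      filter_upwards [hpos, h3.eventually_const_lt (half_lt_self hs)] with p hp hp2
      refine Real.le_sqrt_of_sq_le ?_
      rw [le_div_iff₀ (by positivity), mul_comm]
      have := scheme_speed_le hF hp (isStep_euler hF hF0 hcl hu₀ hp) hF0 hu₀ p.2
      push_cast at hp2
      exact (mul_le_mul_of_nonneg_right hp2.le (sq_nonneg _)).trans this)
    (fun z hz => (hξ s hs z).1 hz) ψ
  have hev := (Metric.tendsto_nhds.1 hlim) ε hε
  rw [hL, eventually_comap] at hev
  rw [eventually_prod_iff] at hev
  obtain ⟨pa, hpa, pb, hpb, hab⟩ := hev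
  obtain ⟨η₁, hη₁, hη₁'⟩ := Metric.mem_nhdsWithin_iff.1 hpa
  obtain ⟨η₂, hη₂, hη₂'⟩ := Metric.eventually_nhds_iff.1 hpb
  refine ⟨min η₁ η₂, lt_min hη₁ hη₂, fun δ hδ hδη j hj => ?_⟩
  have ha : pa δ := hη₁' ⟨by
    rw [Metric.mem_ball, Real.dist_eq, sub_zero, abs_of_pos hδ]
    exact hδη.trans_le (min_le_left _ _), hδ⟩
  have hb : pb (j * δ) := hη₂' (by
    rw [Real.dist_eq]
    exact hj.trans_le (min_le_right _ _))
  exact hab ha hb (δ, j) rfl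

/-- On one grid of step `δ`, the increment from `a` to `b` telescopes into `-δ` times discrete
speeds, each `ε`-close to `ξ s` when paired with `ψ`. Then `δ ↓ 0`. -/
theorem flow_increment_close {s : ℝ} (hs : 0 < s) (ψ : H) {ε : ℝ} (hε : 0 < ε) :
    ∃ η > 0, ∀ a b : ℝ, 0 < a → a ≤ b → |a - s| < η → |b - s| < η →
      |inner ℝ (u b - u a) ψ + (b - a) * inner ℝ (ξ s) ψ| ≤ ε * (b - a) := by
  obtain ⟨η, hη, hclose⟩ := euler_speed_close hF hF0 hcl hu₀ hu hξ hs ψ hε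
  refine ⟨η, hη, fun a b ha hab has hbs => ?_⟩
  have hb : 0 < b := ha.trans_le hab
  have hfa := tendsto_floor_mul ha.le
  have hfb := tendsto_floor_mul hb.le
  have hpos : ∀ᶠ δ : ℝ in 𝓝[>] 0, 0 < δ := self_mem_nhdsWithin
  have hid : Tendsto (fun δ : ℝ => δ) (𝓝[>] 0) (𝓝 0) := tendsto_id.mono_left nhdsWithin_le_nhds
  have hxa := tendsto_euler_flow hF hF0 hcl hu₀ hu ha (j := fun δ => ⌊a / δ⌋₊) hpos hid hfa
  have hxb := tendsto_euler_flow hF hF0 hcl hu₀ hu hb (j := fun δ => ⌊b / δ⌋₊) hpos hid hfb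
  have hl : Tendsto (fun δ : ℝ => |inner ℝ (euler D F u₀ δ ⌊b / δ⌋₊ - euler D F u₀ δ ⌊a / δ⌋₊) ψ +
      ((⌊b / δ⌋₊ : ℝ) * δ - (⌊a / δ⌋₊ : ℝ) * δ) * inner ℝ (ξ s) ψ|) (𝓝[>] 0)
      (𝓝 |inner ℝ (u b - u a) ψ + (b - a) * inner ℝ (ξ s) ψ|) :=
    (((hxb.sub hxa).inner tendsto_const_nhds).add ((hfb.sub hfa).mul_const _)).abs
  refine le_of_tendsto_of_tendsto hl ((hfb.sub hfa).const_mul ε) ?_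
  have hea : ∀ᶠ δ : ℝ in 𝓝[>] 0, |(⌊a / δ⌋₊ : ℝ) * δ - s| < η := by
    have := (hfa.sub_const s).abs
    exact this.eventually_lt_const has
  have heb : ∀ᶠ δ : ℝ in 𝓝[>] 0, |(⌊b / δ⌋₊ : ℝ) * δ - s| < η := by
    have := (hfb.sub_const s).abs
    exact this.eventually_lt_const hbs
  filter_upwards [hpos, hea, heb, hid.eventually_lt_const hη] with δ hδ h1 h2 h3
  have hle : ⌊a / δ⌋₊ ≤ ⌊b / δ⌋₊ := Nat.floor_mono (by gcongr)
  set p := ⌊a / δ⌋₊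
  set q := ⌊b / δ⌋₊
  have hsum : euler D F u₀ δ q - euler D F u₀ δ p =
      ∑ j ∈ Finset.Ico p q, (euler D F u₀ δ (j + 1) - euler D F u₀ δ j) :=
    (Finset.sum_Ico_sub _ hle).symm
  have hcard : (q : ℝ) * δ - (p : ℝ) * δ = ∑ j ∈ Finset.Ico p q, δ := by
    rw [Finset.sum_const, Nat.card_Ico, nsmul_eq_mul, Nat.cast_sub hle]
    ring
  rw [hsum, hcard, sum_inner, Finset.sum_mul, ← Finset.sum_add_distrib, Finset.mul_sum]
  refine (Finset.abs_sum_le_sum_abs _ _).trans (Finset.sum_le_sum fun j hj => ?_)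
  rw [Finset.mem_Ico] at hj
  have hj1 : (p : ℝ) * δ ≤ j * δ := by
    have : (p : ℝ) ≤ j := by exact_mod_cast hj.1
    gcongr
  have hj2 : (j : ℝ) * δ ≤ q * δ := by
    have : (j : ℝ) ≤ q := by exact_mod_cast hj.2.le
    gcongr
  have hjs : |j * δ - s| < η := by
    rw [abs_lt] at h1 h2 ⊢
    constructor <;> linarith [h1.1, h2.2]
  have := hclose δ hδ h3 j hjs
  have e1 : inner ℝ (euler D F u₀ δ (j + 1) - euler D F u₀ δ j) ψ + δ * inner ℝ (ξ s) ψ =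
      - (δ * (inner ℝ (δ⁻¹ • (euler D F u₀ δ j - euler D F u₀ δ (j + 1))) ψ -
        inner ℝ (ξ s) ψ)) := by
    rw [inner_smul_left, ← neg_sub (euler D F u₀ δ j), inner_neg_left]
    simp only [conj_trivial]
    field_simp
    ring
  rw [e1, abs_neg, abs_mul, abs_of_pos hδ, mul_comm ε]
  gcongr

/-- The flow solves `d/dt ⟨u_t, ψ⟩ = -⟨ξ_t, ψ⟩`. -/
theorem flow_hasDerivAt {s : ℝ} (hs : 0 < s) (ψ : H) :
    HasDerivAt (fun t => inner ℝ (u t) ψ) (- inner ℝ (ξ s) ψ) s := by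
  rw [hasDerivAt_iff_isLittleO, Asymptotics.isLittleO_iff]
  intro ε hε
  obtain ⟨η, hη, h⟩ := flow_increment_close hF hF0 hcl hu₀ hu hξ hs ψ hε
  filter_upwards [lt_mem_nhds hs, Metric.ball_mem_nhds s hη] with t ht hts
  rw [Metric.mem_ball, Real.dist_eq] at hts
  have hss : |s - s| < η := by simpa using hη
  rw [Real.norm_eq_abs, Real.norm_eq_abs, ← inner_sub_left]
  simp only [smul_eq_mul, mul_neg, sub_neg_eq_add]
  rcases le_total s t with hst | hst
  · have := h s t hs hst hss hts
    rwa [abs_of_nonneg (sub_nonneg.2 hst)]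
  · have := h t s ht hst hts hss
    rw [abs_sub_comm t s, abs_of_nonneg (sub_nonneg.2 hst), ← abs_neg]
    convert this using 2
    rw [← neg_sub (u s), inner_neg_left]
    ring

end GradientFlow

/-! ### Weak compactness of uniformly integrable families in `L¹`. -/

namespace WeakL1

section Trunc

variable {V : Type*} [NormedAddCommGroup V]

/-- Truncation of a vector at height `K`: vectors of norm larger than `K` become `0`. -/
noncomputable def trunc (K : ℝ) (a : V) : V := (Metric.closedBall (0 : V) K).indicator id a

theorem norm_trunc_le {K : ℝ} (hK : 0 ≤ K) (a : V) : ‖trunc K a‖ ≤ K := by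
  by_cases h : a ∈ Metric.closedBall (0 : V) K
  · rw [trunc, indicator_of_mem h]
    exact mem_closedBall_zero_iff.1 h
  · rw [trunc, indicator_of_notMem h, norm_zero]
    exact hK

theorem measurable_trunc [MeasurableSpace V] [BorelSpace V] (K : ℝ) :
    Measurable (trunc K : V → V) :=
  measurable_id.indicator Metric.isClosed_closedBall.measurableSet

end Trunc

variable {V : Type*} [NormedAddCommGroup V] [InnerProductSpace ℝ V]
  {X : Type*} [MeasurableSpace X] {μ : Measure X}

theorem integrable_inner_of_bounded {θ Y : X → V} {C : ℝ} (hθ : Integrable θ μ)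
    (hY : AEStronglyMeasurable Y μ) (hC : ∀ x, ‖Y x‖ ≤ C) :
    Integrable (fun x => inner ℝ (θ x) (Y x)) μ := by
  refine Integrable.mono' (hθ.norm.mul_const C) (hθ.1.inner hY)
    (Eventually.of_forall fun x => ?_)
  exact (norm_inner_le_norm _ _).trans (mul_le_mul_of_nonneg_left (hC x) (norm_nonneg _))

theorem abs_integral_inner_sub_le {θ θ' Y : X → V} {C : ℝ} (hθ : Integrable θ μ)
    (hθ' : Integrable θ' μ) (hY : AEStronglyMeasurable Y μ) (hC : ∀ x, ‖Y x‖ ≤ C) :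
    |∫ x, inner ℝ (θ x) (Y x) ∂μ - ∫ x, inner ℝ (θ' x) (Y x) ∂μ| ≤
      (∫ x, ‖θ x - θ' x‖ ∂μ) * C := by
  rw [← integral_sub (integrable_inner_of_bounded hθ hY hC)
    (integrable_inner_of_bounded hθ' hY hC), ← integral_mul_const, ← Real.norm_eq_abs]
  refine norm_integral_le_of_norm_le ((hθ.sub hθ').norm.mul_const C)
    (Eventually.of_forall fun x => ?_)
  rw [← inner_sub_left]
  exact (norm_inner_le_norm _ _).trans (mul_le_mul_of_nonneg_left (hC x) (norm_nonneg _))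

variable [MeasurableSpace V] [BorelSpace V] [SecondCountableTopology V] [IsFiniteMeasure μ]
  [CompleteSpace V]

/-- Uniformly integrable families converge weakly in `L¹` along ultrafilters. -/
theorem exists_weak_limit {ι : Type*} (f : Ultrafilter ι) {θ : ι → X → V}
    (hθ : ∀ i, Integrable (θ i) μ)
    (hui : ∀ ε > 0, ∃ R : ℝ, ∀ K ≥ R, ∀ i, ∫ x, ‖θ i x - trunc K (θ i x)‖ ∂μ ≤ ε) :
    ∃ w : X → V, StronglyMeasurable w ∧ Integrable w μ ∧ ∀ (Y : X → V) (C : ℝ),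
      AEStronglyMeasurable Y μ → (∀ x, ‖Y x‖ ≤ C) →
        Tendsto (fun i => ∫ x, inner ℝ (θ i x) (Y x) ∂μ) f (𝓝 (∫ x, inner ℝ (w x) (Y x) ∂μ)) := by
  have htm : ∀ (k : ℕ) i, AEStronglyMeasurable (fun x => trunc k (θ i x)) μ := fun k i =>
    ((measurable_trunc (k : ℝ)).comp_aemeasurable (hθ i).1.aemeasurable).aestronglyMeasurable
  have htL : ∀ (k : ℕ) i, MemLp (fun x => trunc k (θ i x)) 2 μ := fun k i =>
    MemLp.of_bound (htm k i) k (Eventually.of_forall fun x => norm_trunc_le (Nat.cast_nonneg k) _)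
  have hti : ∀ (k : ℕ) i, Integrable (fun x => trunc k (θ i x)) μ := fun k i =>
    (htL k i).integrable one_le_two
  have hbd : ∀ k : ℕ, ∃ C : ℝ, ∀ i, ‖(htL k i).toLp‖ ≤ C := by
    intro k
    refine ⟨_, fun i => Lp.norm_le_of_ae_bound (C := (k : ℝ)) (Nat.cast_nonneg k) ?_⟩
    filter_upwards [(htL k i).coeFn_toLp] with x hx
    rw [hx]
    exact norm_trunc_le (Nat.cast_nonneg k) _
  -- For each height `k` the truncations are bounded in `L²` and have a weak limit `z k`. Uniform
  -- integrability makes `z` Cauchy in `L¹`; its limit is `w`.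
  have hz : ∀ k : ℕ, ∃ z : Lp V 2 μ, ∀ ψ : Lp V 2 μ,
      Tendsto (fun i => inner ℝ (htL k i).toLp ψ) f (𝓝 (inner ℝ z ψ)) := by
    intro k
    obtain ⟨C, hC⟩ := hbd k
    obtain ⟨z, -, hz⟩ := GradientFlow.exists_weak_limit f (Eventually.of_forall hC)
    exact ⟨z, hz⟩
  choose z hz using hz
  have hzi : ∀ k, Integrable (z k) μ := fun k => (Lp.memLp (z k)).integrable one_le_two
  have hzY : ∀ (k : ℕ) (Y : X → V) (C : ℝ), AEStronglyMeasurable Y μ → (∀ x, ‖Y x‖ ≤ C) →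
      Tendsto (fun i => ∫ x, inner ℝ (trunc k (θ i x)) (Y x) ∂μ) f
        (𝓝 (∫ x, inner ℝ (z k x) (Y x) ∂μ)) := by
    intro k Y C hY hC
    have hYL : MemLp Y 2 μ := MemLp.of_bound hY C (Eventually.of_forall hC)
    have := hz k hYL.toLp
    simp only [L2.inner_def] at this
    have e1 : ∫ x, inner ℝ (z k x) ((MemLp.toLp Y hYL : X → V) x) ∂μ = ∫ x, inner ℝ (z k x) (Y x) ∂μ := by
      refine integral_congr_ae ?_
      filter_upwards [hYL.coeFn_toLp] with x hx
      rw [hx]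
    rw [e1] at this
    refine this.congr fun i => integral_congr_ae ?_
    filter_upwards [hYL.coeFn_toLp, (htL k i).coeFn_toLp] with x hx hx'
    rw [hx, hx']
  have hdiff : ∀ ε > 0, ∃ N : ℕ, ∀ k ≥ N, ∀ l ≥ N, ∫ x, ‖z k x - z l x‖ ∂μ ≤ ε := by
    intro ε hε
    obtain ⟨R, hR⟩ := hui (ε / 2) (half_pos hε)
    obtain ⟨N, hN⟩ := exists_nat_ge R
    refine ⟨N, fun k hk l hl => ?_⟩
    -- This bounded test field realizes the `L¹` norm of `z k - z l`, so weak convergence bounds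
    -- that norm by those of the differences of truncations.
    set Y : X → V := fun x => ‖z k x - z l x‖⁻¹ • (z k x - z l x) with hYdef
    have hY1 : ∀ x, ‖Y x‖ ≤ 1 := by
      intro x
      rw [hYdef, norm_smul, norm_inv, norm_norm]
      exact inv_mul_le_one
    have hYm : AEStronglyMeasurable Y μ := by
      have h1 : AEMeasurable (fun x => ‖z k x - z l x‖⁻¹) μ :=
        ((hzi k).sub (hzi l)).1.norm.aemeasurable.inv
      exact h1.aestronglyMeasurable.smul ((hzi k).sub (hzi l)).1
    have e1 : ∫ x, ‖z k x - z l x‖ ∂μ =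
        ∫ x, inner ℝ (z k x) (Y x) ∂μ - ∫ x, inner ℝ (z l x) (Y x) ∂μ := by
      rw [← integral_sub (integrable_inner_of_bounded (hzi k) hYm hY1)
        (integrable_inner_of_bounded (hzi l) hYm hY1)]
      refine integral_congr_ae (Eventually.of_forall fun x => ?_)
      simp only [hYdef]
      rw [← inner_sub_left, inner_smul_right, real_inner_self_eq_norm_sq]
      rcases eq_or_ne ‖z k x - z l x‖ 0 with h0 | h0
      · simp [h0]
      · field_simp
    rw [e1]
    refine le_of_tendsto ((hzY k Y 1 hYm hY1).sub (hzY l Y 1 hYm hY1))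
      (Eventually.of_forall fun i => ?_)
    refine (le_abs_self _).trans ((abs_integral_inner_sub_le (hti k i) (hti l i) hYm hY1).trans ?_)
    rw [mul_one]
    have hk' := hR k (hN.trans (by exact_mod_cast hk)) i
    have hl' := hR l (hN.trans (by exact_mod_cast hl)) i
    calc ∫ x, ‖trunc k (θ i x) - trunc l (θ i x)‖ ∂μ
        ≤ ∫ x, (‖θ i x - trunc k (θ i x)‖ + ‖θ i x - trunc l (θ i x)‖) ∂μ := by
          refine integral_mono ((hti k i).sub (hti l i)).norm
            (((hθ i).sub (hti k i)).norm.add ((hθ i).sub (hti l i)).norm) fun x => ?_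
          rw [← norm_sub_rev (trunc k (θ i x))]
          exact norm_sub_le_norm_sub_add_norm_sub _ _ _
      _ = _ := integral_add ((hθ i).sub (hti k i)).norm ((hθ i).sub (hti l i)).norm
      _ ≤ ε := by linarith
  have hcau : CauchySeq fun k => (hzi k).toL1 (z k) := by
    rw [Metric.cauchySeq_iff]
    intro ε hε
    obtain ⟨N, hN⟩ := hdiff (ε / 2) (half_pos hε)
    refine ⟨N, fun k hk l hl => ?_⟩
    rw [dist_eq_norm, ← Integrable.toL1_sub, L1.norm_of_fun_eq_integral_norm]
    exact (hN k hk l hl).trans_lt (half_lt_self hε)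
  obtain ⟨w, hw⟩ := cauchySeq_tendsto_of_complete hcau
  have hwi : Integrable w μ := L1.integrable_coeFn w
  have hw' : Tendsto (fun k => ∫ x, ‖z k x - w x‖ ∂μ) atTop (𝓝 0) := by
    rw [tendsto_iff_norm_sub_tendsto_zero] at hw
    refine hw.congr fun k => ?_
    have e1 : (hzi k).toL1 (z k) - w = ((hzi k).sub hwi).toL1 ((z k : X → V) - (w : X → V)) := by
      rw [Integrable.toL1_sub _ _ (hzi k) hwi, Integrable.toL1_coeFn]
    rw [e1]
    exact L1.norm_of_fun_eq_integral_norm _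
  refine ⟨w, L1.stronglyMeasurable_coeFn w, hwi, fun Y C hY hC => ?_⟩
  rcases isEmpty_or_nonempty X with hX | ⟨⟨x₀⟩⟩
  · simp [Measure.eq_zero_of_isEmpty μ]
  have hC0 : 0 ≤ C := (norm_nonneg _).trans (hC x₀)
  rw [Metric.tendsto_nhds]
  intro ε hε
  -- Three errors: replacing `θ i` by its truncation and `z k` by `w` costs at most `ε' C < ε / 3`
  -- each; weak convergence of the truncations costs the remaining `ε / 3`.
  set ε' := ε / (3 * (C + 1)) with hε'
  have hε'0 : 0 < ε' := by positivity
  have hC' : ε' * C < ε / 3 := by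
    have : ε' * (C + 1) = ε / 3 := by rw [hε']; field_simp
    linarith
  obtain ⟨R, hR⟩ := hui ε' hε'0
  obtain ⟨N, hN⟩ := exists_nat_ge R
  obtain ⟨k, hkN, hk⟩ := ((eventually_ge_atTop N).and
    (hw'.eventually_lt_const hε'0)).exists
  have h1 := (Metric.tendsto_nhds.1 (hzY k Y C hY hC)) (ε / 3) (by positivity)
  filter_upwards [h1] with i hi
  rw [Real.dist_eq] at hi ⊢
  have h2 := abs_integral_inner_sub_le (hθ i) (hti k i) hY hC
  have h3 := abs_integral_inner_sub_le (hzi k) hwi hY hC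
  have h4 := hR k (hN.trans (by exact_mod_cast hkN)) i
  have h5 : (∫ x, ‖θ i x - trunc k (θ i x)‖ ∂μ) * C ≤ ε' * C := by gcongr
  have h6 : (∫ x, ‖z k x - w x‖ ∂μ) * C ≤ ε' * C := by gcongr
  rw [abs_le] at h2 h3
  rw [abs_lt] at hi ⊢
  constructor <;> linarith [h2.1, h2.2, h3.1, h3.2, hi.1, hi.2]

end WeakL1

/-! ### Conjugates of measurable families of functions on a vector space. -/

namespace FibreLagrangian

variable {X V : Type*} [NormedAddCommGroup V] [InnerProductSpace ℝ V]

/-- The convex conjugate `h(x, a) = ⟪a, τ(x, a)⟫ - l(x, τ(x, a))` of `l`, where `τ(x, a)` maximizes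
`v ↦ ⟪a, v⟫ - l(x, v)`. -/
def conj (l : X → V → ℝ) (τ : X → V → V) (x : X) (a : V) : ℝ := inner ℝ a (τ x a) - l x (τ x a)

variable [SecondCountableTopology V]

/-- The best of the first `N` members of a dense sequence (and of `0`) in the supremum that defines
the conjugate at `θ x`. -/
noncomputable def approxArgmax (l : X → V → ℝ) (θ : X → V) : ℕ → X → V
  | 0, _ => 0
  | N + 1, x => open Classical in
    if inner ℝ (θ x) (approxArgmax l θ N x) - l x (approxArgmax l θ N x) <
        inner ℝ (θ x) (TopologicalSpace.denseSeq V N) - l x (TopologicalSpace.denseSeq V N)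
      then TopologicalSpace.denseSeq V N else approxArgmax l θ N x

/-- The value of the conjugate at `θ x` reached by `approxArgmax`. -/
noncomputable def approxConj (l : X → V → ℝ) (θ : X → V) (N : ℕ) (x : X) : ℝ :=
  inner ℝ (θ x) (approxArgmax l θ N x) - l x (approxArgmax l θ N x)

/-- Each approximate maximizer is bounded uniformly in `x`, hence an admissible test field for weak
`L¹` limits, whereas the exact maximizer need not be bounded. -/
theorem exists_bound_approxArgmax (l : X → V → ℝ) (θ : X → V) (N : ℕ) :
    ∃ C : ℝ, ∀ x, ‖approxArgmax l θ N x‖ ≤ C := by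
  classical
  induction N with
  | zero => exact ⟨0, fun x => by simp [approxArgmax]⟩
  | succ N ih =>
    obtain ⟨C, hC⟩ := ih
    refine ⟨max C ‖TopologicalSpace.denseSeq V N‖, fun x => ?_⟩
    simp only [approxArgmax]
    split_ifs
    · exact le_max_right _ _
    · exact (hC x).trans (le_max_left _ _)

theorem approxConj_succ (l : X → V → ℝ) (θ : X → V) (N : ℕ) (x : X) :
    approxConj l θ (N + 1) x = max (approxConj l θ N x)
      (inner ℝ (θ x) (TopologicalSpace.denseSeq V N) - l x (TopologicalSpace.denseSeq V N)) := by
  classical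
  simp only [approxConj, approxArgmax]
  split_ifs with hlt
  · rw [max_eq_right hlt.le]
  · rw [max_eq_left (not_lt.1 hlt)]

theorem monotone_approxConj (l : X → V → ℝ) (θ : X → V) (x : X) :
    Monotone fun N => approxConj l θ N x :=
  monotone_nat_of_le_succ fun N => by
    rw [approxConj_succ]
    exact le_max_left _ _

end FibreLagrangian

/-- A measurable family `l(x, ·)` of nonnegative continuous functions on `V`, vanishing at `0` and
locally bounded uniformly in `x`, such that `v ↦ ⟪a, v⟫ - l(x, v)` has the unique maximizer
`τ(x, a)`, which grows at most linearly in `a`. -/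
structure FibreLagrangian {X V : Type*} [MeasurableSpace X] [NormedAddCommGroup V]
    [InnerProductSpace ℝ V] (l : X → V → ℝ) (τ : X → V → V) : Prop where
  nonneg : ∀ x v, 0 ≤ l x v
  zero : ∀ x, l x 0 = 0
  continuous : ∀ x, Continuous (l x)
  measurable : ∀ v, Measurable fun x => l x v
  bounded : ∀ R : ℝ, ∃ B : ℝ, 0 ≤ B ∧ ∀ x v, ‖v‖ ≤ R → l x v ≤ B
  le_conj : ∀ x a v, inner ℝ a v - l x v ≤ FibreLagrangian.conj l τ x a
  unique : ∀ x a v, inner ℝ a v - l x v = FibreLagrangian.conj l τ x a → v = τ x a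
  growth : ∃ C : ℝ, 0 ≤ C ∧ ∀ x a, ‖τ x a‖ ≤ C * (1 + ‖a‖)

namespace FibreLagrangian

variable {X V : Type*} [MeasurableSpace X] [NormedAddCommGroup V] [InnerProductSpace ℝ V]
  {l : X → V → ℝ} {τ : X → V → V} (h : FibreLagrangian l τ)

include h

theorem conj_nonneg (x : X) (a : V) : 0 ≤ conj l τ x a := by
  have := h.le_conj x a 0
  rwa [inner_zero_right, h.zero, sub_zero] at this

theorem conj_zero (x : X) : conj l τ x 0 = 0 := by
  refine le_antisymm ?_ (h.conj_nonneg x 0)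
  rw [conj, inner_zero_left]
  linarith [h.nonneg x (τ x 0)]

/-- The maximizer `τ x a` is a subgradient of the conjugate at `a`. Convexity, continuity and
differentiability of the conjugate all come from this inequality. -/
theorem conj_add_inner_le (x : X) (a b : V) :
    conj l τ x a + inner ℝ (b - a) (τ x a) ≤ conj l τ x b := by
  have := h.le_conj x b (τ x a)
  rw [inner_sub_left]
  rw [conj]
  linarith

theorem convexOn_conj (x : X) : ConvexOn ℝ univ (conj l τ x) := by
  refine ⟨convex_univ, fun a _ b _ s t hs ht hst => ?_⟩
  set c := s • a + t • b with hc
  have h1 := h.conj_add_inner_le x c a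
  have h2 := h.conj_add_inner_le x c b
  have h3 : s * inner ℝ (a - c) (τ x c) + t * inner ℝ (b - c) (τ x c) = 0 := by
    rw [← real_inner_smul_left, ← real_inner_smul_left, ← inner_add_left]
    have : s • (a - c) + t • (b - c) = 0 := by
      rw [smul_sub, smul_sub, sub_add_sub_comm, ← hc, ← add_smul, hst, one_smul, sub_self]
    rw [this, inner_zero_left]
  have h4 : s * conj l τ x c + t * conj l τ x c = conj l τ x c := by
    rw [← add_mul, hst, one_mul]
  simp only [smul_eq_mul]
  nlinarith [mul_le_mul_of_nonneg_left h1 hs, mul_le_mul_of_nonneg_left h2 ht]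

/-- Test the supremum with the vector of length `R` in the direction of `a`, where `l` is at most a
constant `B`. -/
theorem superlinear (R : ℝ) (hR : 0 ≤ R) :
    ∃ B : ℝ, 0 ≤ B ∧ ∀ x a, R * ‖a‖ - B ≤ conj l τ x a := by
  obtain ⟨B, hB0, hB⟩ := h.bounded R
  refine ⟨B, hB0, fun x a => ?_⟩
  have h1 := h.le_conj x a (R • ‖a‖⁻¹ • a)
  have h2 : l x (R • ‖a‖⁻¹ • a) ≤ B := by
    refine hB x _ ?_
    rw [norm_smul, norm_smul, norm_inv, norm_norm, Real.norm_of_nonneg hR]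
    exact mul_le_of_le_one_right hR inv_mul_le_one
  have h3 : inner ℝ a (R • ‖a‖⁻¹ • a) = R * ‖a‖ := by
    rw [inner_smul_right, inner_smul_right, real_inner_self_eq_norm_sq]
    rcases eq_or_ne ‖a‖ 0 with h0 | h0
    · simp [h0]
    · field_simp
  linarith

theorem continuous_conj (x : X) : Continuous (conj l τ x) := by
  obtain ⟨C, hC0, hC⟩ := h.growth
  rw [continuous_iff_continuousAt]
  intro a
  rw [ContinuousAt, tendsto_iff_norm_sub_tendsto_zero]
  have h1 : Tendsto (fun b => ‖b - a‖ * (C * (1 + ‖b‖) + C * (1 + ‖a‖))) (𝓝 a) (𝓝 0) := by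
    have : Continuous fun b : V => ‖b - a‖ * (C * (1 + ‖b‖) + C * (1 + ‖a‖)) := by fun_prop
    simpa using this.tendsto a
  refine squeeze_zero (fun _ => norm_nonneg _) (fun b => ?_) h1
  have h2 := h.conj_add_inner_le x a b
  have h3 := h.conj_add_inner_le x b a
  have h4 := abs_real_inner_le_norm (b - a) (τ x a)
  have h5 := abs_real_inner_le_norm (a - b) (τ x b)
  rw [norm_sub_rev a b] at h5
  have h6 : ‖b - a‖ * ‖τ x a‖ ≤ ‖b - a‖ * (C * (1 + ‖a‖)) := by gcongr; exact hC x a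
  have h7 : ‖b - a‖ * ‖τ x b‖ ≤ ‖b - a‖ * (C * (1 + ‖b‖)) := by gcongr; exact hC x b
  rw [abs_le] at h4 h5
  have h8 : 0 ≤ ‖b - a‖ * (C * (1 + ‖a‖)) := by positivity
  have h9 : 0 ≤ ‖b - a‖ * (C * (1 + ‖b‖)) := by positivity
  rw [Real.norm_eq_abs, abs_le, mul_add]
  constructor <;> linarith [h4.1, h5.1]

/-- Linear growth keeps `τ x b` in a compact ball as `b → a`. By continuity of the conjugate every
limit point attains the supremum at `a`, so it is `τ x a`. -/
theorem continuous_argmax [ProperSpace V] (x : X) : Continuous (τ x) := by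
  obtain ⟨C, hC0, hC⟩ := h.growth
  rw [continuous_iff_continuousAt]
  intro a
  rw [ContinuousAt, tendsto_iff_ultrafilter]
  intro f hf
  have hfa : Tendsto (fun b : V => b) f (𝓝 a) := hf
  have hev : ∀ᶠ b in (f : Filter V), τ x b ∈ Metric.closedBall (0 : V) (C * (1 + (‖a‖ + 1))) := by
    have h1 := hfa.norm.eventually_lt_const (lt_add_one ‖a‖)
    filter_upwards [h1] with b hb
    rw [mem_closedBall_zero_iff]
    exact (hC x b).trans (by gcongr)
  obtain ⟨v, -, hv⟩ := (isCompact_closedBall (0 : V) (C * (1 + (‖a‖ + 1)))).ultrafilter_le_nhds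
    (f.map (τ x)) (le_principal_iff.2 hev)
  have hv' : Tendsto (τ x) f (𝓝 v) := hv
  have h1 : Tendsto (conj l τ x) f (𝓝 (inner ℝ a v - l x v)) :=
    (hfa.inner hv').sub (((h.continuous x).tendsto v).comp hv')
  have h2 : Tendsto (conj l τ x) f (𝓝 (conj l τ x a)) := ((h.continuous_conj x).tendsto a).mono_left hf
  rwa [← h.unique x a v (tendsto_nhds_unique h1 h2)]

/-- The subgradient inequalities at `a` and at `a + s b` squeeze the quotient between the values of
`⟨b, τ⟩` at these two points. -/
theorem tendsto_slope_conj [ProperSpace V] (x : X) (a b : V) :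
    Tendsto (fun s : ℝ => (conj l τ x (a + s • b) - conj l τ x a) / s) (𝓝[>] 0)
      (𝓝 (inner ℝ b (τ x a))) := by
  have h1 : Tendsto (fun s : ℝ => inner ℝ b (τ x (a + s • b))) (𝓝[>] 0)
      (𝓝 (inner ℝ b (τ x a))) := by
    have hc : Continuous fun s : ℝ => inner ℝ b (τ x (a + s • b)) :=
      continuous_const.inner ((h.continuous_argmax x).comp (by fun_prop))
    have := hc.tendsto 0
    rw [zero_smul, add_zero] at this
    exact this.mono_left nhdsWithin_le_nhds
  refine tendsto_of_tendsto_of_tendsto_of_le_of_le' tendsto_const_nhds h1 ?_ ?_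
  · filter_upwards [self_mem_nhdsWithin] with s hs
    have hs' : 0 < s := hs
    rw [le_div_iff₀ hs']
    have := h.conj_add_inner_le x a (a + s • b)
    rw [add_sub_cancel_left, real_inner_smul_left] at this
    linarith
  · filter_upwards [self_mem_nhdsWithin] with s hs
    have hs' : 0 < s := hs
    rw [div_le_iff₀ hs']
    have := h.conj_add_inner_le x (a + s • b) a
    rw [sub_add_cancel_left, inner_neg_left, real_inner_smul_left] at this
    linarith

section Approx

variable [SecondCountableTopology V]

theorem approxConj_le (θ : X → V) (N : ℕ) (x : X) : approxConj l θ N x ≤ conj l τ x (θ x) :=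
  h.le_conj _ _ _

theorem approxConj_nonneg (θ : X → V) (N : ℕ) (x : X) : 0 ≤ approxConj l θ N x := by
  have := monotone_approxConj l θ x (Nat.zero_le N)
  simp only [approxConj, approxArgmax, inner_zero_right, h.zero] at this ⊢
  linarith

theorem tendsto_approxConj (θ : X → V) (x : X) :
    Tendsto (fun N => approxConj l θ N x) atTop (𝓝 (conj l τ x (θ x))) := by
  rw [Metric.tendsto_atTop]
  intro ε hε
  have hc : Continuous fun v : V => inner ℝ (θ x) v - l x v :=
    (continuous_const.inner continuous_id).sub (h.continuous x)
  have hopen : IsOpen {v : V | conj l τ x (θ x) - ε < inner ℝ (θ x) v - l x v} :=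
    isOpen_lt continuous_const hc
  obtain ⟨k, hv⟩ := (TopologicalSpace.denseRange_denseSeq V).exists_mem_open hopen
    ⟨τ x (θ x), show conj l τ x (θ x) - ε < conj l τ x (θ x) by linarith⟩
  refine ⟨k + 1, fun N hN => ?_⟩
  have h1 := monotone_approxConj l θ x hN
  simp only [approxConj_succ] at h1
  have h2 := h.approxConj_le θ N x
  have h3 := (le_max_right _ _).trans h1
  have h4 : conj l τ x (θ x) - ε < _ := hv
  rw [Real.dist_eq, abs_lt]
  constructor <;> linarith

variable [MeasurableSpace V] [BorelSpace V]

theorem measurable_approx {θ : X → V} (hθ : Measurable θ) (N : ℕ) :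
    Measurable (approxArgmax l θ N) ∧ Measurable fun x => l x (approxArgmax l θ N x) := by
  classical
  induction N with
  | zero =>
    refine ⟨measurable_const, ?_⟩
    exact h.measurable 0
  | succ N ih =>
    have hs : MeasurableSet {x | inner ℝ (θ x) (approxArgmax l θ N x) -
        l x (approxArgmax l θ N x) < inner ℝ (θ x) (TopologicalSpace.denseSeq V N) -
          l x (TopologicalSpace.denseSeq V N)} :=
      measurableSet_lt ((hθ.inner ih.1).sub ih.2)
        ((hθ.inner measurable_const).sub (h.measurable _))
    constructor
    · have e : approxArgmax l θ (N + 1) = fun x => if inner ℝ (θ x) (approxArgmax l θ N x) -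
          l x (approxArgmax l θ N x) < inner ℝ (θ x) (TopologicalSpace.denseSeq V N) -
            l x (TopologicalSpace.denseSeq V N) then TopologicalSpace.denseSeq V N
          else approxArgmax l θ N x := by
        funext x
        simp only [approxArgmax]
      rw [e]
      exact Measurable.ite hs measurable_const ih.1
    · have e : (fun x => l x (approxArgmax l θ (N + 1) x)) = fun x =>
          if inner ℝ (θ x) (approxArgmax l θ N x) -
          l x (approxArgmax l θ N x) < inner ℝ (θ x) (TopologicalSpace.denseSeq V N) -
            l x (TopologicalSpace.denseSeq V N) then l x (TopologicalSpace.denseSeq V N)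
          else l x (approxArgmax l θ N x) := by
        funext x
        simp only [approxArgmax]
        split_ifs <;> rfl
      rw [e]
      exact Measurable.ite hs (h.measurable (TopologicalSpace.denseSeq V N)) ih.2

theorem measurable_approxConj {θ : X → V} (hθ : Measurable θ) (N : ℕ) :
    Measurable (approxConj l θ N) :=
  (hθ.inner (h.measurable_approx hθ N).1).sub (h.measurable_approx hθ N).2

theorem measurable_conj_comp {θ : X → V} (hθ : Measurable θ) :
    Measurable fun x => conj l τ x (θ x) :=
  measurable_of_tendsto_metrizable (h.measurable_approxConj hθ)
    (tendsto_pi_nhds.2 fun x => h.tendsto_approxConj θ x)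

theorem aemeasurable_conj_comp {μ : Measure X} {θ : X → V} (hθ : AEMeasurable θ μ) :
    AEMeasurable (fun x => conj l τ x (θ x)) μ := by
  refine ⟨fun x => conj l τ x (hθ.mk θ x), h.measurable_conj_comp hθ.measurable_mk, ?_⟩
  filter_upwards [hθ.ae_eq_mk] with x hx
  rw [hx]

/-- The pairing with the maximizer is a limit of difference quotients of the conjugate, which are
measurable; no measurable selection is involved. -/
theorem aemeasurable_inner_argmax [ProperSpace V] {μ : Measure X} {θ β : X → V}
    (hθ : AEMeasurable θ μ) (hβ : AEMeasurable β μ) :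
    AEMeasurable (fun x => inner ℝ (β x) (τ x (θ x))) μ := by
  have hlim : Tendsto (fun n : ℕ => (1 : ℝ) / ((n : ℝ) + 1)) atTop (𝓝[>] 0) :=
    tendsto_nhdsWithin_iff.2 ⟨tendsto_one_div_add_atTop_nhds_zero_nat,
      Eventually.of_forall fun n => mem_Ioi.2 (by positivity)⟩
  refine aemeasurable_of_tendsto_metrizable_ae atTop
    (f := fun (n : ℕ) x => (conj l τ x (θ x + ((1 : ℝ) / ((n : ℝ) + 1)) • β x) -
      conj l τ x (θ x)) / ((1 : ℝ) / ((n : ℝ) + 1))) (fun n => ?_)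
    (Eventually.of_forall fun x => (h.tendsto_slope_conj x (θ x) (β x)).comp hlim)
  exact ((h.aemeasurable_conj_comp (hθ.add (hβ.const_smul _))).sub
    (h.aemeasurable_conj_comp hθ)).div_const _

end Approx

end FibreLagrangian

/-! ### The integral of the conjugate: compactness, lower semicontinuity, derivatives. -/

namespace FibreLagrangian

variable {X V : Type*} [MeasurableSpace X] [NormedAddCommGroup V] [InnerProductSpace ℝ V]
  [FiniteDimensional ℝ V] [MeasurableSpace V] [BorelSpace V]
  {l : X → V → ℝ} {τ : X → V → V} (h : FibreLagrangian l τ) {μ : Measure X} [IsFiniteMeasure μ]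

include h

omit [IsFiniteMeasure μ] in
theorem aestronglyMeasurable_conj_comp {θ : X → V} (hθ : AEStronglyMeasurable θ μ) :
    AEStronglyMeasurable (fun x => conj l τ x (θ x)) μ :=
  (h.aemeasurable_conj_comp hθ.aemeasurable).aestronglyMeasurable

/-- A bound on the integral of the conjugate gives uniform integrability. -/
theorem uniform_integrability {ι : Type*} {θ : ι → X → V}
    (hc : ∀ i, Integrable (fun x => conj l τ x (θ i x)) μ) {c : ℝ}
    (hcc : ∀ i, ∫ x, conj l τ x (θ i x) ∂μ ≤ c) {ε : ℝ} (hε : 0 < ε) :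
    ∃ R : ℝ, ∀ K ≥ R, ∀ i, ∫ x, ‖θ i x - WeakL1.trunc K (θ i x)‖ ∂μ ≤ ε := by
  set R := 2 * (|c| + 1) / ε with hR
  have hR0 : 0 < R := by positivity
  obtain ⟨B, hB0, hB⟩ := h.superlinear R hR0.le
  -- Where `‖a‖ ≥ 2B / R`, the bound `conj ≥ R‖a‖ - B` gives `conj ≥ R‖a‖ / 2`. The part cut off is
  -- thus at most `(2 / R) conj`, and `R` makes its integral at most `ε`.
  refine ⟨2 * B / R, fun K hK i => ?_⟩
  have hle : ∀ x, ‖θ i x - WeakL1.trunc K (θ i x)‖ ≤ 2 / R * conj l τ x (θ i x) := by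
    intro x
    by_cases hx : θ i x ∈ Metric.closedBall (0 : V) K
    · rw [WeakL1.trunc, indicator_of_mem hx, id, sub_self, norm_zero]
      exact mul_nonneg (by positivity) (h.conj_nonneg _ _)
    · rw [WeakL1.trunc, indicator_of_notMem hx, sub_zero]
      rw [mem_closedBall_zero_iff, not_le] at hx
      have h1 : 2 * B / R ≤ ‖θ i x‖ := hK.le.trans hx.le
      rw [div_le_iff₀ hR0] at h1
      have h2 := hB x (θ i x)
      rw [div_mul_eq_mul_div, le_div_iff₀ hR0]
      linarith
  calc ∫ x, ‖θ i x - WeakL1.trunc K (θ i x)‖ ∂μ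
      ≤ ∫ x, 2 / R * conj l τ x (θ i x) ∂μ := by
        refine integral_mono_of_nonneg (Eventually.of_forall fun _ => norm_nonneg _)
          ((hc i).const_mul _) (Eventually.of_forall hle)
    _ = 2 / R * ∫ x, conj l τ x (θ i x) ∂μ := integral_const_mul _ _
    _ ≤ 2 / R * (|c| + 1) := by
        gcongr
        linarith [hcc i, le_abs_self c]
    _ = ε := by rw [hR]; field_simp

/-- Weak lower semicontinuity of the integral of the conjugate. -/
theorem integral_conj_le_of_weak_limit {ι : Type*} {f : Filter ι} [f.NeBot] {θ : ι → X → V}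
    (hθ : ∀ i, Integrable (θ i) μ) (hc : ∀ i, Integrable (fun x => conj l τ x (θ i x)) μ) {c : ℝ}
    (hcc : ∀ i, ∫ x, conj l τ x (θ i x) ∂μ ≤ c) {w : X → V} (hwm : StronglyMeasurable w)
    (hw : Integrable w μ)
    (hlim : ∀ (Y : X → V) (C : ℝ), AEStronglyMeasurable Y μ → (∀ x, ‖Y x‖ ≤ C) →
      Tendsto (fun i => ∫ x, inner ℝ (θ i x) (Y x) ∂μ) f (𝓝 (∫ x, inner ℝ (w x) (Y x) ∂μ))) :
    Integrable (fun x => conj l τ x (w x)) μ ∧ ∫ x, conj l τ x (w x) ∂μ ≤ c := by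
  have hwm' := hwm.measurable
  have hc0 : 0 ≤ c := by
    obtain ⟨i⟩ := nonempty_of_neBot f
    exact (integral_nonneg fun x => h.conj_nonneg _ _).trans (hcc i)
  -- Fenchel's inequality for `θ i` with the approximate maximizers of `w` as test field is affine
  -- in `θ i`, so it survives the weak limit. Monotone convergence in `N` then recovers the
  -- conjugate at `w`.
  have key : ∀ N, ∫⁻ x, ENNReal.ofReal (approxConj l w N x) ∂μ ≤ ENNReal.ofReal c := by
    intro N
    obtain ⟨C, hC⟩ := exists_bound_approxArgmax l w N
    obtain ⟨hYm, hlm⟩ := h.measurable_approx hwm' N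
    obtain ⟨B, hB0, hB⟩ := h.bounded C
    have hli : Integrable (fun x => l x (approxArgmax l w N x)) μ :=
      Integrable.of_bound hlm.aestronglyMeasurable B (Eventually.of_forall fun x => by
        rw [Real.norm_of_nonneg (h.nonneg _ _)]
        exact hB x _ (hC x))
    have hwY := WeakL1.integrable_inner_of_bounded hw hYm.aestronglyMeasurable hC
    have hgi : Integrable (approxConj l w N) μ := hwY.sub hli
    rw [← ofReal_integral_eq_lintegral_ofReal hgi
      (Eventually.of_forall fun x => h.approxConj_nonneg w N x)]
    refine ENNReal.ofReal_le_ofReal ?_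
    have e1 : ∫ x, approxConj l w N x ∂μ = ∫ x, inner ℝ (w x) (approxArgmax l w N x) ∂μ -
        ∫ x, l x (approxArgmax l w N x) ∂μ := integral_sub hwY hli
    rw [e1]
    refine le_of_tendsto ((hlim _ C hYm.aestronglyMeasurable hC).sub_const _)
      (Eventually.of_forall fun i => ?_)
    have hθY := WeakL1.integrable_inner_of_bounded (hθ i) hYm.aestronglyMeasurable hC
    rw [← integral_sub hθY hli]
    exact (integral_mono (hθY.sub hli) (hc i) fun x => h.le_conj _ _ _).trans (hcc i)
  have hlint : ∫⁻ x, ENNReal.ofReal (conj l τ x (w x)) ∂μ ≤ ENNReal.ofReal c := by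
    refine le_of_tendsto' (lintegral_tendsto_of_tendsto_of_monotone
      (fun N => (h.measurable_approxConj hwm' N).ennreal_ofReal.aemeasurable)
      (Eventually.of_forall fun x => fun a b hab =>
        ENNReal.ofReal_le_ofReal (monotone_approxConj l w x hab))
      (Eventually.of_forall fun x =>
        (ENNReal.continuous_ofReal.tendsto _).comp (h.tendsto_approxConj w x))) key
  have hint : Integrable (fun x => conj l τ x (w x)) μ := by
    refine ⟨(h.measurable_conj_comp hwm').aestronglyMeasurable, ?_⟩
    rw [hasFiniteIntegral_iff_ofReal (Eventually.of_forall fun x => h.conj_nonneg _ _)]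
    exact hlint.trans_lt ENNReal.ofReal_lt_top
  refine ⟨hint, ?_⟩
  rw [← ofReal_integral_eq_lintegral_ofReal hint
    (Eventually.of_forall fun x => h.conj_nonneg _ _)] at hlint
  exact (ENNReal.ofReal_le_ofReal_iff hc0).1 hlint

/-- Weak compactness of the sublevels of the integral of the conjugate. -/
theorem exists_weak_limit {ι : Type*} (f : Ultrafilter ι) {θ : ι → X → V}
    (hθ : ∀ i, Integrable (θ i) μ) (hc : ∀ i, Integrable (fun x => conj l τ x (θ i x)) μ) {c : ℝ}
    (hcc : ∀ i, ∫ x, conj l τ x (θ i x) ∂μ ≤ c) :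
    ∃ w : X → V, Integrable w μ ∧
      (∀ (Y : X → V) (C : ℝ), AEStronglyMeasurable Y μ → (∀ x, ‖Y x‖ ≤ C) →
        Tendsto (fun i => ∫ x, inner ℝ (θ i x) (Y x) ∂μ) f
          (𝓝 (∫ x, inner ℝ (w x) (Y x) ∂μ))) ∧
      Integrable (fun x => conj l τ x (w x)) μ ∧ ∫ x, conj l τ x (w x) ∂μ ≤ c := by
  obtain ⟨w, hwm, hw, hlim⟩ := WeakL1.exists_weak_limit f hθ
    fun ε hε => h.uniform_integrability hc hcc hε
  exact ⟨w, hw, hlim, h.integral_conj_le_of_weak_limit hθ hc hcc hwm hw hlim⟩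

theorem integrable_argmax_inner {θ β : X → V} (hθ : Integrable θ μ)
    (hβ : AEStronglyMeasurable β μ) {B : ℝ} (hB : ∀ x, ‖β x‖ ≤ B) :
    Integrable (fun x => inner ℝ (β x) (τ x (θ x))) μ := by
  obtain ⟨C, hC0, hC⟩ := h.growth
  refine Integrable.mono' (((integrable_const (1 : ℝ)).add hθ.norm).const_mul (B * C))
    (h.aemeasurable_inner_argmax hθ.1.aemeasurable hβ.aemeasurable).aestronglyMeasurable
    (Eventually.of_forall fun x => ?_)
  have hB0 : 0 ≤ B := (norm_nonneg _).trans (hB x)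
  calc ‖inner ℝ (β x) (τ x (θ x))‖ ≤ ‖β x‖ * ‖τ x (θ x)‖ := norm_inner_le_norm _ _
    _ ≤ B * (C * (1 + ‖θ x‖)) := by gcongr; exacts [hB x, hC x _]
    _ = _ := by simp only [Pi.add_apply]; ring

theorem abs_conj_add_sub_le {C : ℝ} (hC : ∀ x a, ‖τ x a‖ ≤ C * (1 + ‖a‖)) (hC0 : 0 ≤ C)
    (x : X) (a b : V) :
    |conj l τ x (a + b) - conj l τ x a| ≤ ‖b‖ * (C * (1 + ‖a‖ + ‖b‖)) := by
  have h1 := h.conj_add_inner_le x a (a + b)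
  have h2 := h.conj_add_inner_le x (a + b) a
  rw [add_sub_cancel_left] at h1
  rw [sub_add_cancel_left, inner_neg_left] at h2
  have h3 := abs_real_inner_le_norm b (τ x a)
  have h4 := abs_real_inner_le_norm b (τ x (a + b))
  have h5 : ‖b‖ * ‖τ x a‖ ≤ ‖b‖ * (C * (1 + ‖a‖ + ‖b‖)) := by
    gcongr
    exact (hC x a).trans (mul_le_mul_of_nonneg_left (by linarith [norm_nonneg b]) hC0)
  have h6 : ‖b‖ * ‖τ x (a + b)‖ ≤ ‖b‖ * (C * (1 + ‖a‖ + ‖b‖)) := by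
    gcongr
    exact (hC x _).trans (mul_le_mul_of_nonneg_left (by linarith [norm_add_le a b]) hC0)
  rw [abs_le] at h3 h4 ⊢
  constructor <;> linarith [h3.1, h4.2]

theorem integrable_conj_add {θ β : X → V} (hθ : Integrable θ μ)
    (hc : Integrable (fun x => conj l τ x (θ x)) μ)
    (hβ : AEStronglyMeasurable β μ) {B : ℝ} (hB : ∀ x, ‖β x‖ ≤ B) :
    Integrable (fun x => conj l τ x (θ x + β x)) μ := by
  obtain ⟨C, hC0, hC⟩ := h.growth
  have hd : Integrable (fun x => conj l τ x (θ x + β x) - conj l τ x (θ x)) μ := by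
    refine Integrable.mono' (((integrable_const (1 + B)).add hθ.norm).const_mul (B * C))
      ((h.aestronglyMeasurable_conj_comp (hθ.1.add hβ)).sub hc.1)
      (Eventually.of_forall fun x => ?_)
    have hB0 : 0 ≤ B := (norm_nonneg _).trans (hB x)
    refine (h.abs_conj_add_sub_le hC hC0 x _ _).trans ?_
    simp only [Pi.add_apply]
    calc ‖β x‖ * (C * (1 + ‖θ x‖ + ‖β x‖)) ≤ B * (C * (1 + ‖θ x‖ + B)) := by
          gcongr <;> exact hB x
      _ = _ := by ring
  have := hd.add hc
  refine this.congr (Eventually.of_forall fun x => ?_)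
  simp

/-- The integral of the conjugate is differentiable in bounded directions. -/
theorem tendsto_slope_integral_conj {θ β : X → V} (hθ : Integrable θ μ)
    (hc : Integrable (fun x => conj l τ x (θ x)) μ)
    (hβ : AEStronglyMeasurable β μ) {B : ℝ} (hB : ∀ x, ‖β x‖ ≤ B) :
    Tendsto (fun s : ℝ => (∫ x, conj l τ x (θ x + s • β x) ∂μ - ∫ x, conj l τ x (θ x) ∂μ) / s)
      (𝓝[>] 0) (𝓝 (∫ x, inner ℝ (β x) (τ x (θ x)) ∂μ)) := by
  obtain ⟨C, hC0, hC⟩ := h.growth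
  have hint : ∀ s : ℝ, Integrable (fun x => conj l τ x (θ x + s • β x)) μ := fun s =>
    h.integrable_conj_add hθ hc (hβ.const_smul s) (B := |s| * B) fun x => by
      rw [norm_smul, Real.norm_eq_abs]
      exact mul_le_mul_of_nonneg_left (hB x) (abs_nonneg s)
  have hlim : Tendsto (fun s : ℝ => ∫ x, (conj l τ x (θ x + s • β x) - conj l τ x (θ x)) / s ∂μ)
      (𝓝[>] 0) (𝓝 (∫ x, inner ℝ (β x) (τ x (θ x)) ∂μ)) := by
    refine tendsto_integral_filter_of_dominated_convergence
      -- For `0 < s ≤ 1` this dominates the quotients by `abs_conj_add_sub_le`, since `‖s β‖ ≤ s B ≤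
      -- B`; linear growth of `τ` is what makes it integrable.
      (fun x => B * (C * (1 + ‖θ x‖ + B))) ?_ ?_ ?_
      (Eventually.of_forall fun x => h.tendsto_slope_conj x (θ x) (β x))
    · refine Eventually.of_forall fun s => ?_
      exact (((hint s).sub hc).div_const s).1
    · filter_upwards [Ioc_mem_nhdsGT (zero_lt_one' ℝ)] with s hs
      refine Eventually.of_forall fun x => ?_
      have hB0 : 0 ≤ B := (norm_nonneg _).trans (hB x)
      rw [Real.norm_eq_abs, abs_div, abs_of_pos hs.1, div_le_iff₀ hs.1]
      refine (h.abs_conj_add_sub_le hC hC0 x _ _).trans ?_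
      have h1 : ‖s • β x‖ ≤ s * B := by
        rw [norm_smul, Real.norm_of_nonneg hs.1.le]
        exact mul_le_mul_of_nonneg_left (hB x) hs.1.le
      have h2 : s * B ≤ B := mul_le_of_le_one_left hB0 hs.2
      have h3 : 0 ≤ s * B := mul_nonneg hs.1.le hB0
      calc ‖s • β x‖ * (C * (1 + ‖θ x‖ + ‖s • β x‖))
          ≤ (s * B) * (C * (1 + ‖θ x‖ + B)) := by gcongr; exact h1.trans h2
        _ = _ := by ring
    · have h1 : Integrable (fun x => 1 + ‖θ x‖ + B) μ :=
        ((integrable_const (1 : ℝ)).add hθ.norm).add (integrable_const B)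
      exact (h1.const_mul C).const_mul B
  refine hlim.congr fun s => ?_
  rw [integral_div, integral_sub (hint s) hc]

/-- If the integral of the conjugate decreases at finite rate under `θ ↦ (1 - s) θ`, then
`l(x, τ(x, θ(x)))` is integrable. -/
theorem integrable_comp_argmax {θ : X → V} (hθ : Integrable θ μ)
    (hc : Integrable (fun x => conj l τ x (θ x)) μ) {K : ℝ}
    (hK : ∀ s : ℝ, 0 < s → s ≤ 1 → Integrable (fun x => conj l τ x ((1 - s) • θ x)) μ →
      ∫ x, conj l τ x (θ x) ∂μ - ∫ x, conj l τ x ((1 - s) • θ x) ∂μ ≤ s * K) :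
    Integrable (fun x => l x (τ x (θ x))) μ := by
  have hle : ∀ s : ℝ, 0 < s → s ≤ 1 → ∀ x, conj l τ x ((1 - s) • θ x) ≤ conj l τ x (θ x) := by
    intro s hs hs1 x
    have h1 := (h.convexOn_conj x).2 (mem_univ (θ x)) (mem_univ (0 : V))
      (by linarith : 0 ≤ 1 - s) hs.le (by ring)
    rw [smul_zero, add_zero, h.conj_zero, smul_zero, add_zero, smul_eq_mul] at h1
    nlinarith [h.conj_nonneg x (θ x)]
  have hint : ∀ s : ℝ, 0 < s → s ≤ 1 → Integrable (fun x => conj l τ x ((1 - s) • θ x)) μ := by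
    intro s hs hs1
    refine Integrable.mono' hc (h.aestronglyMeasurable_conj_comp (hθ.1.const_smul (1 - s)))
      (Eventually.of_forall fun x => ?_)
    rw [Real.norm_of_nonneg (h.conj_nonneg _ _)]
    exact hle s hs hs1 x
  -- These quotients are nonnegative, have integral at most `K` and tend to `⟨θ, τ(θ)⟩`. Fatou makes
  -- the limit integrable, and `l(τ(θ))` is this limit minus the conjugate.
  set g : ℕ → X → ℝ := fun n x =>
    (conj l τ x (θ x) - conj l τ x ((1 - (1 : ℝ) / ((n : ℝ) + 1)) • θ x)) / ((1 : ℝ) / ((n : ℝ) + 1))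
    with hg
  have hs0 : ∀ n : ℕ, (0 : ℝ) < (1 : ℝ) / ((n : ℝ) + 1) := fun n => by positivity
  have hs1 : ∀ n : ℕ, (1 : ℝ) / ((n : ℝ) + 1) ≤ 1 := fun n => by
    rw [div_le_one (by positivity)]
    linarith [n.cast_nonneg (α := ℝ)]
  have hgi : ∀ n, Integrable (g n) μ := fun n => (hc.sub (hint _ (hs0 n) (hs1 n))).div_const _
  have hg0 : ∀ n x, 0 ≤ g n x := fun n x =>
    div_nonneg (sub_nonneg.2 (hle _ (hs0 n) (hs1 n) x)) (hs0 n).le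
  have hgK : ∀ n, ∫ x, g n x ∂μ ≤ K := by
    intro n
    rw [hg, integral_div, integral_sub hc (hint _ (hs0 n) (hs1 n)), div_le_iff₀ (hs0 n), mul_comm K]
    exact hK _ (hs0 n) (hs1 n) (hint _ (hs0 n) (hs1 n))
  have hlimx : ∀ x, Tendsto (fun n => g n x) atTop (𝓝 (inner ℝ (θ x) (τ x (θ x)))) := by
    intro x
    have hlim : Tendsto (fun n : ℕ => (1 : ℝ) / ((n : ℝ) + 1)) atTop (𝓝[>] 0) :=
      tendsto_nhdsWithin_iff.2 ⟨tendsto_one_div_add_atTop_nhds_zero_nat,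
        Eventually.of_forall fun n => mem_Ioi.2 (by positivity)⟩
    have h1 := ((h.tendsto_slope_conj x (θ x) (-θ x)).comp hlim).neg
    rw [inner_neg_left, neg_neg] at h1
    refine h1.congr fun n => ?_
    simp only [hg, Function.comp]
    rw [← neg_div, neg_sub]
    congr 4
    module
  have hmeas := (h.aemeasurable_inner_argmax hθ.1.aemeasurable hθ.1.aemeasurable)
  have hin : Integrable (fun x => inner ℝ (θ x) (τ x (θ x))) μ := by
    refine ⟨hmeas.aestronglyMeasurable, ?_⟩
    rw [hasFiniteIntegral_iff_ofReal (Eventually.of_forall fun x =>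
      ge_of_tendsto (hlimx x) (Eventually.of_forall fun n => hg0 n x))]
    calc ∫⁻ x, ENNReal.ofReal (inner ℝ (θ x) (τ x (θ x))) ∂μ
        = ∫⁻ x, liminf (fun n => ENNReal.ofReal (g n x)) atTop ∂μ := by
          refine lintegral_congr fun x => ?_
          exact (((ENNReal.continuous_ofReal.tendsto _).comp (hlimx x)).liminf_eq).symm
      _ ≤ liminf (fun n => ∫⁻ x, ENNReal.ofReal (g n x) ∂μ) atTop :=
          lintegral_liminf_le' fun n => (hgi n).1.aemeasurable.ennreal_ofReal
      _ ≤ ENNReal.ofReal K := by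
          refine liminf_le_of_le (by isBoundedDefault) fun b hb => ?_
          obtain ⟨n, hn⟩ := hb.exists
          refine hn.trans ?_
          rw [← ofReal_integral_eq_lintegral_ofReal (hgi n) (Eventually.of_forall (hg0 n))]
          exact ENNReal.ofReal_le_ofReal (hgK n)
      _ < ⊤ := ENNReal.ofReal_lt_top
  refine (hin.sub hc).congr (Eventually.of_forall fun x => ?_)
  simp [conj]

end FibreLagrangian

/-! ### Existence and uniqueness of the maximizer on one fibre. -/

section ConvexFibre

variable {V : Type*} [NormedAddCommGroup V] [InnerProductSpace ℝ V]

/-- On a line the second derivative is positive except at the one parameter where the line may meet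
the origin. Since `f` is `C¹` there, strict monotonicity of the first derivative glues across it. -/
theorem strictConvexOn_of_second_deriv_pos {V : Type*} [NormedAddCommGroup V] [NormedSpace ℝ V]
    {f : V → ℝ} (hf : ContDiff ℝ 1 f)
    (h2 : ∀ v : V, v ≠ 0 → ∀ w : V, w ≠ 0 → 0 < iteratedDeriv 2 (fun s : ℝ => f (v + s • w)) 0) :
    StrictConvexOn ℝ univ f := by
  refine ⟨convex_univ, fun x _ y _ hxy a b ha hb hab => ?_⟩
  set w := y - x with hw
  have hw0 : w ≠ 0 := sub_ne_zero.2 hxy.symm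
  set g : ℝ → ℝ := fun s => f (x + s • w) with hg
  have hgc : ContDiff ℝ 1 g := hf.comp (contDiff_const.add (contDiff_id.smul contDiff_const))
  have hg' : Continuous (deriv g) := hgc.continuous_deriv le_rfl
  obtain ⟨s₀, hs₀⟩ : ∃ s₀ : ℝ, ∀ s, s ≠ s₀ → x + s • w ≠ 0 := by
    by_cases hex : ∃ s₀ : ℝ, x + s₀ • w = 0
    · obtain ⟨s₀, hs₀⟩ := hex
      refine ⟨s₀, fun s hs h => hs ?_⟩
      have : (s - s₀) • w = 0 := by
        rw [sub_smul, ← add_sub_add_left_eq_sub _ _ x, h, hs₀, sub_zero]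
      exact sub_eq_zero.1 ((smul_eq_zero.1 this).resolve_right hw0)
    · push Not at hex
      exact ⟨0, fun s _ => hex s⟩
  have hpos : ∀ s, s ≠ s₀ → 0 < deriv (deriv g) s := by
    intro s hs
    have h := h2 _ (hs₀ s hs) w hw0
    have e1 : (fun r : ℝ => f (x + s • w + r • w)) = fun r => g (s + r) := by
      funext r
      simp only [hg, add_smul, add_assoc]
    rw [e1, iteratedDeriv_comp_const_add, iteratedDeriv_succ, iteratedDeriv_one] at h
    simpa only [add_zero] using h
  have hmono : StrictMono (deriv g) := by
    refine StrictMonoOn.Iic_union_Ici (a := s₀)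
      (strictMonoOn_of_deriv_pos (convex_Iic _) hg'.continuousOn fun s hs => hpos s ?_)
      (strictMonoOn_of_deriv_pos (convex_Ici _) hg'.continuousOn fun s hs => hpos s ?_)
    · rw [interior_Iic] at hs
      exact hs.ne
    · rw [interior_Ici] at hs
      exact hs.ne'
  have hconv := hmono.strictConvexOn_univ_of_deriv hgc.continuous
  have := hconv.2 (mem_univ 0) (mem_univ 1) zero_ne_one ha hb hab
  simp only [hg, smul_eq_mul, mul_zero, mul_one, zero_add, zero_smul, add_zero, one_smul] at this
  have e2 : a • x + b • y = x + b • w := by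
    rw [hw, eq_sub_of_add_eq hab]
    module
  rw [e2]
  simpa only [hw, add_sub_cancel, smul_eq_mul] using this

/-- The conjugate is finite and convex in finite dimension, hence continuous and bounded by some `B`
on the unit ball around `a`. Testing it at `a + v/‖v‖` gives `f v - ⟨a, v⟩ ≥ ‖v‖ - B`, so a
minimizer exists by coercivity. -/
theorem exists_forall_conj_le [FiniteDimensional ℝ V] {f : V → ℝ} (hf : Continuous f)
    (hbdd : ∀ a : V, BddAbove (range fun v => inner ℝ a v - f v)) (a : V) :
    ∃ v, ∀ w, inner ℝ a w - f w ≤ inner ℝ a v - f v := by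
  set h : V → ℝ := fun a => ⨆ v, (inner ℝ a v - f v) with hh
  have hle : ∀ a v, inner ℝ a v - f v ≤ h a := fun a v => le_ciSup (hbdd a) v
  have hconv : ConvexOn ℝ univ h := by
    refine ⟨convex_univ, fun x _ y _ s t hs ht hst => ciSup_le fun v => ?_⟩
    have h1 := mul_le_mul_of_nonneg_left (hle x v) hs
    have h2 := mul_le_mul_of_nonneg_left (hle y v) ht
    have h3 : f v = s * f v + t * f v := by rw [← add_mul, hst, one_mul]
    rw [inner_add_left, real_inner_smul_left, real_inner_smul_left, h3]
    simp only [smul_eq_mul]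
    linarith
  have hcont : Continuous h := hconv.locallyLipschitz.continuous
  obtain ⟨B, hB⟩ := (isCompact_closedBall a 1).bddAbove_image hcont.continuousOn
  have hgrow : ∀ v, ‖v‖ - B ≤ f v - inner ℝ a v := by
    intro v
    have h1 : h (a + ‖v‖⁻¹ • v) ≤ B := hB (mem_image_of_mem _ (by
      rw [mem_closedBall_iff_norm, add_sub_cancel_left, norm_smul, norm_inv, norm_norm]
      exact inv_mul_le_one))
    have h2 := hle (a + ‖v‖⁻¹ • v) v
    have h3 : inner ℝ (‖v‖⁻¹ • v) v = ‖v‖ := by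
      rw [real_inner_smul_left, real_inner_self_eq_norm_sq]
      rcases eq_or_ne ‖v‖ 0 with h0 | h0
      · simp [h0]
      · field_simp
    rw [inner_add_left, h3] at h2
    linarith
  have htend : Tendsto (fun v => f v - inner ℝ a v) (cocompact V) atTop := by
    refine tendsto_atTop_mono hgrow ?_
    exact tendsto_atTop_add_const_right _ _ tendsto_norm_cocompact_atTop
  obtain ⟨v, hv⟩ := (hf.sub (continuous_const.inner continuous_id)).exists_forall_le htend
  exact ⟨v, fun w => by have := hv w; simp only [Pi.sub_apply, id] at this; linarith⟩

theorem StrictConvexOn.conj_argmax_unique {f : V → ℝ} (hf : StrictConvexOn ℝ univ f) {a v v' : V}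
    (hv : ∀ w, inner ℝ a w - f w ≤ inner ℝ a v - f v)
    (hv' : inner ℝ a v' - f v' = inner ℝ a v - f v) : v' = v := by
  by_contra hne
  have h1 := hf.2 (mem_univ v') (mem_univ v) hne (by norm_num : (0 : ℝ) < 1 / 2)
    (by norm_num : (0 : ℝ) < 1 / 2) (by norm_num)
  have h2 := hv ((1 / 2 : ℝ) • v' + (1 / 2 : ℝ) • v)
  rw [inner_add_right, inner_smul_right, inner_smul_right] at h2
  simp only [smul_eq_mul] at h1
  linarith

end ConvexFibre

/-! ### Frames of the tangent bundle given by charts. -/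

namespace HamHeat

section Frames

variable {n : ℕ} {M : Type*} [TopologicalSpace M] [ChartedSpace (Vec n) M]

/-- The frame of `T_xM` given by the chart `e`: it sends `w` to the vector with components `w`. -/
noncomputable def frame (e : OpenPartialHomeomorph M (Vec n)) (x : M) : Vec n →L[ℝ] Vec n :=
  mfderiv 𝓘(ℝ, Vec n) (𝓡 n) e.symm (e x)

/-- The components, in the chart `e`, of vectors of `T_xM`. -/
noncomputable def coframe (e : OpenPartialHomeomorph M (Vec n)) (x : M) : Vec n →L[ℝ] Vec n :=
  mfderiv (𝓡 n) 𝓘(ℝ, Vec n) e x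

variable [IsManifold (𝓡 n) ∞ M] {e e' : OpenPartialHomeomorph M (Vec n)}

theorem frame_coframe (he : e ∈ atlas (Vec n) M) {x : M} (hx : x ∈ e.source) (v : Vec n) :
    frame e x (coframe e x v) = v :=
  ((mdifferentiable_of_mem_atlas (I := 𝓡 n) he).mfderiv hx).symm_apply_apply v

theorem coframe_frame (he : e ∈ atlas (Vec n) M) {x : M} (hx : x ∈ e.source) (v : Vec n) :
    coframe e x (frame e x v) = v :=
  ((mdifferentiable_of_mem_atlas (I := 𝓡 n) he).mfderiv hx).apply_symm_apply v

theorem contMDiffOn_atlas (he : e ∈ atlas (Vec n) M) : ContMDiffOn (𝓡 n) (𝓡 n) ∞ e e.source :=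
  contMDiffOn_of_mem_maximalAtlas (IsManifold.subset_maximalAtlas he)

theorem contMDiffOn_atlas_symm (he : e ∈ atlas (Vec n) M) :
    ContMDiffOn (𝓡 n) (𝓡 n) ∞ e.symm e.target :=
  contMDiffOn_symm_of_mem_maximalAtlas (IsManifold.subset_maximalAtlas he)

/-- Joint continuity in the point and the components, because the frame is the tangent map of the
smooth map `e.symm`. -/
theorem continuousOn_frame (he : e ∈ atlas (Vec n) M) :
    ContinuousOn (fun p : M × Vec n => (⟨p.1, frame e p.1 p.2⟩ : TangentBundle (𝓡 n) M))
      (e.source ×ˢ univ) := by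
  have h1 : ContinuousOn (tangentMapWithin (𝓡 n) (𝓡 n) e.symm e.target)
      (Bundle.TotalSpace.proj ⁻¹' e.target) :=
    (contMDiffOn_atlas_symm he).continuousOn_tangentMapWithin (by simp)
      e.open_target.uniqueMDiffOn
  have h2 : ContinuousOn (fun p : M × Vec n =>
      ((tangentBundleModelSpaceHomeomorph (𝓡 n)).symm (e p.1, p.2) : TangentBundle (𝓡 n) (Vec n)))
      (e.source ×ˢ univ) := by
    refine (tangentBundleModelSpaceHomeomorph (𝓡 n)).symm.continuous.comp_continuousOn ?_
    exact (e.continuousOn.comp continuousOn_fst fun p hp => hp.1).prodMk continuousOn_snd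
  have h3 := h1.comp h2 (fun p hp => e.map_source hp.1)
  refine h3.congr fun p hp => ?_
  have hp1 : p.1 ∈ e.source := hp.1
  simp only [Function.comp, tangentBundleModelSpaceHomeomorph_coe_symm]
  have key := tangentMapWithin_eq_tangentMap (p := (⟨e p.1, p.2⟩ : TangentBundle (𝓡 n) (Vec n)))
    (e.open_target.uniqueMDiffOn _ (e.map_source hp1))
    ((contMDiffOn_atlas_symm he).mdifferentiableOn (by simp) |>.mdifferentiableAt
      (e.open_target.mem_nhds (e.map_source hp1)))
  refine Eq.trans ?_ key.symm
  refine Bundle.TotalSpace.ext (e.left_inv hp1).symm ?_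
  rfl

theorem continuousOn_coframe (he : e ∈ atlas (Vec n) M) :
    ContinuousOn (fun p : TangentBundle (𝓡 n) M => coframe e p.1 p.2)
      (Bundle.TotalSpace.proj ⁻¹' e.source) := by
  have h1 : ContinuousOn (tangentMapWithin (𝓡 n) (𝓡 n) e e.source)
      (Bundle.TotalSpace.proj ⁻¹' e.source) :=
    (contMDiffOn_atlas he).continuousOn_tangentMapWithin (by simp) e.open_source.uniqueMDiffOn
  have h2 := continuous_snd.comp_continuousOn
    ((tangentBundleModelSpaceHomeomorph (𝓡 n)).continuous.comp_continuousOn h1)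
  refine h2.congr fun p hp => ?_
  have hp1 : p.1 ∈ e.source := hp
  simp only [Function.comp, tangentBundleModelSpaceHomeomorph_coe]
  rw [tangentMapWithin_eq_tangentMap (e.open_source.uniqueMDiffOn _ hp1)
    ((contMDiffOn_atlas he).mdifferentiableOn (by simp) |>.mdifferentiableAt
      (e.open_source.mem_nhds hp1))]
  rfl

theorem continuousOn_coframe_frame (he : e ∈ atlas (Vec n) M) (he' : e' ∈ atlas (Vec n) M)
    (w : Vec n) :
    ContinuousOn (fun x => coframe e x (frame e' x w)) (e.source ∩ e'.source) := by
  have h1 : ContinuousOn (fun x : M => (⟨x, frame e' x w⟩ : TangentBundle (𝓡 n) M))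
      (e.source ∩ e'.source) :=
    (continuousOn_frame he').comp (f := fun x : M => (x, w)) (by fun_prop)
      fun x hx => ⟨hx.2, mem_univ _⟩
  exact (continuousOn_coframe he).comp h1 fun x hx => hx.1

theorem continuousOn_lagrangian_frame {L : TangentBundle (𝓡 n) M → ℝ} (hL : Continuous L)
    (he : e ∈ atlas (Vec n) M) :
    ContinuousOn (fun p : M × Vec n => L ⟨p.1, frame e p.1 p.2⟩) (e.source ×ˢ univ) :=
  hL.comp_continuousOn (continuousOn_frame he)

theorem continuousOn_metric_frame (g : RiemMetric n M) (he : e ∈ atlas (Vec n) M) :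
    ContinuousOn (fun p : M × Vec n => tangentNorm g (x := p.1) (frame e p.1 p.2))
      (e.source ×ˢ univ) := by
  refine Real.continuous_sqrt.comp_continuousOn fun p hp => ?_
  have hv : ContinuousWithinAt (fun p : M × Vec n =>
      Bundle.TotalSpace.mk' (Vec n) (E := TangentSpace (𝓡 n)) p.1 (frame e p.1 p.2))
      (e.source ×ˢ univ) p := continuousOn_frame he p hp
  have hg : ContinuousWithinAt (fun p : M × Vec n =>
      Bundle.TotalSpace.mk' (Vec n →L[ℝ] Vec n →L[ℝ] ℝ)
        (E := fun x : M => TangentSpace (𝓡 n) x →L[ℝ] TangentSpace (𝓡 n) x →L[ℝ] ℝ)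
        p.1 (g.inner p.1)) (e.source ×ˢ univ) p :=
    (g.contMDiff.continuous.comp continuous_fst).continuousWithinAt
  have h1 := ContinuousWithinAt.clm_bundle_apply₂ (F₁ := Vec n) (F₂ := Vec n) (F₃ := ℝ)
    (E₁ := fun x : M => TangentSpace (𝓡 n) x) (E₂ := fun x : M => TangentSpace (𝓡 n) x)
    (E₃ := Bundle.Trivial M ℝ) (𝕜 := ℝ) (b := fun p : M × Vec n => p.1) hg hv hv
  simp only [FiberBundle.continuousWithinAt_totalSpace] at h1
  exact h1.2

theorem contDiff_lagrangian_fibre {L : TangentBundle (𝓡 n) M → ℝ}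
    (hL : ContMDiff (𝓡 n).tangent 𝓘(ℝ, ℝ) 1 L) (x : M) (A : Vec n →L[ℝ] Vec n) :
    ContDiff ℝ 1 fun v : Vec n => L ⟨x, A v⟩ := by
  rw [← contMDiff_iff_contDiff]
  have h1 : ContMDiff 𝓘(ℝ, Vec n) (𝓡 n).tangent 1
      fun v : Vec n => (⟨x, A v⟩ : TangentBundle (𝓡 n) M) := by
    intro v
    rw [Bundle.contMDiffAt_totalSpace]
    refine ⟨contMDiffAt_const, ?_⟩
    have h2 : ∀ v : Vec n, (trivializationAt (Vec n) (TangentSpace (𝓡 n)) x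
        (⟨x, A v⟩ : TangentBundle (𝓡 n) M)).2 =
        (Bundle.Trivialization.continuousLinearMapAt ℝ
          (trivializationAt (Vec n) (TangentSpace (𝓡 n)) x) x) (A v) := by
      intro v
      rw [Bundle.Trivialization.continuousLinearMapAt_apply,
        Bundle.Trivialization.coe_linearMapAt_of_mem _ (FiberBundle.mem_baseSet_trivializationAt' x)]
    simp only [h2]
    rw [contMDiffAt_iff_contDiffAt]
    exact (((Bundle.Trivialization.continuousLinearMapAt ℝ
      (trivializationAt (Vec n) (TangentSpace (𝓡 n)) x) x : Vec n →L[ℝ] Vec n).comp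
        A).contDiff).contDiffAt
  exact hL.comp h1

end Frames

end HamHeat

/-! ### A measurable trivialization of the tangent bundle. -/

namespace HamHeat

/-- Finitely many charts, with compact subsets of their domains that cover `M`, and a measurable
choice `idx` of one of these compact sets around each point. -/
structure ChartCover (n : ℕ) (M : Type*) [TopologicalSpace M] [ChartedSpace (Vec n) M]
    [MeasurableSpace M] where
  chart : ℕ → OpenPartialHomeomorph M (Vec n)
  chart_mem : ∀ i, chart i ∈ atlas (Vec n) M
  K : ℕ → Set M
  isCompact : ∀ i, IsCompact (K i)
  subset : ∀ i, K i ⊆ (chart i).source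
  card : ℕ
  idx : M → ℕ
  idx_lt : ∀ x, idx x < card
  mem_idx : ∀ x, x ∈ K (idx x)
  measurable_idx : Measurable idx

section Cover

variable {n : ℕ} {M : Type*} [TopologicalSpace M] [ChartedSpace (Vec n) M] [MeasurableSpace M]

theorem nonempty_chartCover [T2Space M] [CompactSpace M] [Nonempty M] [BorelSpace M] :
    Nonempty (ChartCover n M) := by
  classical
  have h1 : ∀ x : M, ∃ K ∈ 𝓝 x, K ⊆ (chartAt (Vec n) x).source ∧ IsCompact K := fun x =>
    local_compact_nhds (chart_source_mem_nhds (Vec n) x)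
  choose K hK hKs hKc using h1
  obtain ⟨t, ht⟩ := CompactSpace.elim_nhds_subcover K hK
  obtain ⟨x₀⟩ := ‹Nonempty M›
  have hex : ∀ x, ∃ i, i < t.toList.length ∧ x ∈ K (t.toList.getD i x₀) := by
    intro x
    have : x ∈ ⋃ y ∈ t, K y := by rw [ht]; trivial
    obtain ⟨y, hy, hxy⟩ := mem_iUnion₂.1 this
    obtain ⟨i, hi, hiy⟩ := List.getElem_of_mem (Finset.mem_toList.2 hy)
    refine ⟨i, hi, ?_⟩
    rwa [List.getD_eq_getElem _ _ hi, hiy]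
  exact ⟨{
    chart := fun i => chartAt (Vec n) (t.toList.getD i x₀)
    chart_mem := fun i => chart_mem_atlas _ _
    K := fun i => K (t.toList.getD i x₀)
    isCompact := fun i => hKc _
    subset := fun i => hKs _
    card := t.toList.length
    idx := fun x => Nat.find (hex x)
    idx_lt := fun x => (Nat.find_spec (hex x)).1
    mem_idx := fun x => (Nat.find_spec (hex x)).2
    measurable_idx := measurable_find hex fun k =>
      (MeasurableSet.const _).inter (hKc _).isClosed.measurableSet }⟩

namespace ChartCover

variable (c : ChartCover n M)

/-- The frame of `T_xM` chosen by the cover. -/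
noncomputable def T (x : M) : Vec n →L[ℝ] TangentSpace (𝓡 n) x := frame (c.chart (c.idx x)) x

/-- The inverse of the frame of `T_xM` chosen by the cover. -/
noncomputable def S (x : M) : TangentSpace (𝓡 n) x →L[ℝ] Vec n := coframe (c.chart (c.idx x)) x

/-- The covector `α` in coordinates. -/
noncomputable def hat (x : M) (α : Cotangent n x) : Vec n :=
  (InnerProductSpace.toDual ℝ (Vec n)).symm (α.comp (c.T x))

/-- The covector with coordinates `a`. -/
noncomputable def unhat (x : M) (a : Vec n) : Cotangent n x :=
  (InnerProductSpace.toDual ℝ (Vec n) a).comp (c.S x)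

/-- The Lagrangian in coordinates. -/
noncomputable def lag (L : TangentBundle (𝓡 n) M → ℝ) (x : M) (v : Vec n) : ℝ := L ⟨x, c.T x v⟩

/-- The Legendre transform in coordinates. -/
noncomputable def leg (L : TangentBundle (𝓡 n) M → ℝ) (x : M) (a : Vec n) : Vec n :=
  c.S x (legendre L (c.unhat x a))

theorem mem_source (x : M) : x ∈ (c.chart (c.idx x)).source := c.subset _ (c.mem_idx x)

theorem inner_hat (x : M) (α : Cotangent n x) (w : Vec n) :
    inner ℝ (c.hat x α) w = α (c.T x w) := by
  rw [hat, InnerProductSpace.toDual_symm_apply]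
  rfl

theorem unhat_apply (x : M) (a : Vec n) (v : TangentSpace (𝓡 n) x) :
    c.unhat x a v = inner ℝ a (c.S x v) := rfl

theorem hat_smul (x : M) (r : ℝ) (α : Cotangent n x) : c.hat x (r • α) = r • c.hat x α := by
  refine ext_inner_right ℝ fun w => ?_
  rw [real_inner_smul_left, inner_hat, inner_hat]
  rfl

theorem hat_zero (x : M) : c.hat x 0 = 0 := by
  have := c.hat_smul x 0 0
  rwa [zero_smul, zero_smul] at this

/-- The frames jump where `idx` does, so objects in coordinates are only continuous piece by piece;
countably many measurable pieces are enough for measurability. -/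
theorem measurable_of_continuousOn [T2Space M] [BorelSpace M] {Y : Type*} [TopologicalSpace Y]
    [MeasurableSpace Y]
    [BorelSpace Y] {f : M → Y} {F : ℕ → M → Y} (hF : ∀ i, ContinuousOn (F i) (c.K i))
    (hf : ∀ x, f x = F (c.idx x) x) : Measurable f := by
  refine measurable_of_isClosed fun s hs => ?_
  have : f ⁻¹' s = ⋃ i, (c.idx ⁻¹' {i} ∩ (c.K i ∩ F i ⁻¹' s)) := by
    ext x
    simp only [mem_preimage, mem_iUnion, mem_inter_iff, mem_singleton_iff]
    constructor
    · intro hx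
      exact ⟨_, rfl, c.mem_idx x, by rwa [← hf]⟩
    · rintro ⟨i, rfl, -, hx⟩
      rwa [hf]
  rw [this]
  exact MeasurableSet.iUnion fun i => (c.measurable_idx (measurableSet_singleton i)).inter
    ((hF i).preimage_isClosed_of_isClosed (c.isCompact i).isClosed hs).measurableSet

section Manifold

variable [IsManifold (𝓡 n) ∞ M]

theorem T_S (x : M) (v : TangentSpace (𝓡 n) x) : c.T x (c.S x v) = v :=
  frame_coframe (c.chart_mem _) (c.mem_source x) v

theorem S_T (x : M) (v : Vec n) : c.S x (c.T x v) = v :=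
  coframe_frame (c.chart_mem _) (c.mem_source x) v

theorem hat_unhat (x : M) (a : Vec n) : c.hat x (c.unhat x a) = a := by
  refine ext_inner_right ℝ fun w => ?_
  rw [inner_hat, unhat_apply, S_T]

theorem unhat_hat (x : M) (α : Cotangent n x) : c.unhat x (c.hat x α) = α := by
  refine ContinuousLinearMap.ext fun v => ?_
  rw [unhat_apply, inner_hat, T_S]

theorem T_leg (L : TangentBundle (𝓡 n) M → ℝ) (x : M) (α : Cotangent n x) :
    c.T x (c.leg L x (c.hat x α)) = legendre L α := by
  rw [leg, T_S, unhat_hat]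

/-- The frames distort lengths by at most a constant factor. -/
theorem exists_norm_le_tangentNorm (g : RiemMetric n M) :
    ∃ C : ℝ, 0 < C ∧ ∀ x v, ‖v‖ ≤ C * tangentNorm g (x := x) (c.T x v) := by
  have hsm : ∀ (x : M) (r : ℝ) (v : TangentSpace (𝓡 n) x), 0 ≤ r →
      tangentNorm g (r • v) = r * tangentNorm g v := by
    intro x r v hr
    simp only [tangentNorm, map_smul, smul_apply, smul_eq_mul]
    rw [← mul_assoc, Real.sqrt_mul (mul_self_nonneg r), Real.sqrt_mul_self hr]
  have key : ∀ i, ∃ C : ℝ, 0 < C ∧ ∀ x ∈ c.K i, ∀ v : Vec n, ‖v‖ = 1 →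
      C ≤ tangentNorm g (x := x) (frame (c.chart i) x v) := by
    intro i
    have hcomp : IsCompact (c.K i ×ˢ Metric.sphere (0 : Vec n) 1) :=
      (c.isCompact i).prod (isCompact_sphere 0 1)
    have hcont : ContinuousOn (fun p : M × Vec n =>
        tangentNorm g (x := p.1) (frame (c.chart i) p.1 p.2))
        (c.K i ×ˢ Metric.sphere (0 : Vec n) 1) :=
      (continuousOn_metric_frame g (c.chart_mem i)).mono
        (prod_mono (c.subset i) (subset_univ _))
    rcases (c.K i ×ˢ Metric.sphere (0 : Vec n) 1).eq_empty_or_nonempty with he | hne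
    · refine ⟨1, one_pos, fun x hx v hv => ?_⟩
      have : (x, v) ∈ c.K i ×ˢ Metric.sphere (0 : Vec n) 1 := ⟨hx, mem_sphere_zero_iff_norm.2 hv⟩
      rw [he] at this
      exact this.elim
    · obtain ⟨⟨x₀, v₀⟩, hmem, hmin⟩ := hcomp.exists_isMinOn hne hcont
      have hv₀ : v₀ ≠ 0 := by
        intro h0
        have := mem_sphere_zero_iff_norm.1 hmem.2
        simp [h0] at this
      refine ⟨_, ?_, fun x hx v hv => hmin (show (x, v) ∈ _ from
        ⟨hx, mem_sphere_zero_iff_norm.2 hv⟩)⟩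
      refine Real.sqrt_pos.2 (g.pos x₀ _ fun h0 => hv₀ ?_)
      rw [← coframe_frame (c.chart_mem i) (c.subset i hmem.1) v₀]
      exact (congrArg (coframe (c.chart i) x₀) h0).trans (map_zero _)
  choose C hC0 hC using key
  have hS : (∑ i ∈ Finset.range c.card, (C i)⁻¹) + 1 > 0 := by
    have := Finset.sum_nonneg (s := Finset.range c.card) fun i _ => (inv_pos.2 (hC0 i)).le
    linarith
  refine ⟨_, hS, fun x v => ?_⟩
  rcases eq_or_ne v 0 with rfl | hv
  · rw [norm_zero]
    exact mul_nonneg hS.le (Real.sqrt_nonneg _)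
  have hv' : 0 < ‖v‖ := norm_pos_iff.2 hv
  have h1 := hC (c.idx x) x (c.mem_idx x) (‖v‖⁻¹ • v) (by
    rw [norm_smul, norm_inv, norm_norm, inv_mul_cancel₀ hv'.ne'])
  have h2 : tangentNorm g (x := x) (frame (c.chart (c.idx x)) x (‖v‖⁻¹ • v)) =
      ‖v‖⁻¹ * tangentNorm g (x := x) (c.T x v) := by
    refine (congrArg (tangentNorm g) (map_smul (c.T x) ‖v‖⁻¹ v)).trans ?_
    exact hsm x _ _ (inv_nonneg.2 hv'.le)
  rw [h2] at h1
  have h3 : (C (c.idx x))⁻¹ ≤ (∑ i ∈ Finset.range c.card, (C i)⁻¹) + 1 := by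
    have := Finset.single_le_sum (f := fun i => (C i)⁻¹) (fun i _ => (inv_pos.2 (hC0 i)).le)
      (Finset.mem_range.2 (c.idx_lt x))
    linarith
  have h4 : 0 ≤ tangentNorm g (x := x) (c.T x v) := Real.sqrt_nonneg _
  have h5 : ‖v‖ ≤ (C (c.idx x))⁻¹ * tangentNorm g (x := x) (c.T x v) := by
    rw [inv_mul_eq_div, le_div_iff₀ (hC0 _)]
    rw [inv_mul_eq_div, le_div_iff₀ hv'] at h1
    linarith
  exact h5.trans (mul_le_mul_of_nonneg_right h3 h4)

end Manifold

end ChartCover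

end Cover

end HamHeat

/-! ### The Lagrangian and the Legendre transform in coordinates. -/

namespace HamHeat

namespace ChartCover

variable {n : ℕ} {M : Type*} [TopologicalSpace M] [ChartedSpace (Vec n) M] [MeasurableSpace M]
  [T2Space M] [CompactSpace M] [BorelSpace M] [IsManifold (𝓡 n) ∞ M] (c : ChartCover n M)
  {L : TangentBundle (𝓡 n) M → ℝ}

include c

theorem continuous_lag (hL : IsLagrangian L) (x : M) : Continuous (c.lag L x) :=
  (contDiff_lagrangian_fibre hL.contMDiff_one x (c.T x)).continuous

theorem strictConvexOn_lag (hL : IsLagrangian L) (x : M) : StrictConvexOn ℝ univ (c.lag L x) := by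
  refine strictConvexOn_of_second_deriv_pos
    (contDiff_lagrangian_fibre hL.contMDiff_one x (c.T x)) fun v hv w hw => ?_
  have hne : ∀ v : Vec n, v ≠ 0 → c.T x v ≠ 0 := by
    intro v hv h0
    apply hv
    rw [← c.S_T x v, h0, map_zero]
  have := hL.strongly_convex x (c.T x v) (hne v hv) (c.T x w) (hne w hw)
  convert this using 3 with s
  exact congrArg (fun z : TangentSpace (𝓡 n) x => L ⟨x, z⟩)
    ((map_add (c.T x) v (s • w)).trans (congrArg (c.T x v + ·) (map_smul (c.T x) s w)))

omit c in
theorem le_hamiltonian (hH : HamiltonianFinite L) {x : M} (α : Cotangent n x)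
    (v : TangentSpace (𝓡 n) x) : α v - L ⟨x, v⟩ ≤ hamiltonian L α :=
  le_ciSup (hH x α) v

/-- Finiteness of the Hamiltonian gives coercivity on the fibre, so the supremum is attained and the
default value in `legendre` never occurs. -/
theorem hamiltonian_eq_legendre (hL : IsLagrangian L) (hH : HamiltonianFinite L) {x : M}
    (α : Cotangent n x) : hamiltonian L α = α (legendre L α) - L ⟨x, legendre L α⟩ := by
  have hex : ∃ v : TangentSpace (𝓡 n) x, hamiltonian L α = α v - L ⟨x, v⟩ := by
    obtain ⟨v, hv⟩ := exists_forall_conj_le (c.continuous_lag hL x) (fun a => by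
      obtain ⟨B, hB⟩ := hH x (c.unhat x a)
      refine ⟨B, ?_⟩
      rintro _ ⟨v, rfl⟩
      have := hB ⟨c.T x v, rfl⟩
      simp only [unhat_apply, S_T] at this
      exact this) (c.hat x α)
    refine ⟨c.T x v, le_antisymm (ciSup_le fun w => ?_) (le_hamiltonian hH α _)⟩
    have := hv (c.S x w)
    simp only [inner_hat, lag, T_S] at this
    exact this
  rw [legendre, dif_pos hex]
  exact hex.choose_spec

theorem hamiltonian_eq_conj (hL : IsLagrangian L) (hH : HamiltonianFinite L) {x : M}
    (α : Cotangent n x) :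
    hamiltonian L α = FibreLagrangian.conj (c.lag L) (c.leg L) x (c.hat x α) := by
  rw [c.hamiltonian_eq_legendre hL hH, FibreLagrangian.conj, inner_hat, lag, T_leg]

theorem lag_le_conj (hL : IsLagrangian L) (hH : HamiltonianFinite L) (x : M) (a v : Vec n) :
    inner ℝ a v - c.lag L x v ≤ FibreLagrangian.conj (c.lag L) (c.leg L) x a := by
  have h1 := le_hamiltonian hH (c.unhat x a) (c.T x v)
  rw [c.hamiltonian_eq_conj hL hH, hat_unhat, unhat_apply, S_T] at h1
  exact h1

theorem leg_unique (hL : IsLagrangian L) (hH : HamiltonianFinite L) (x : M) (a v : Vec n)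
    (hv : inner ℝ a v - c.lag L x v = FibreLagrangian.conj (c.lag L) (c.leg L) x a) :
    v = c.leg L x a :=
  (c.strictConvexOn_lag hL x).conj_argmax_unique (c.lag_le_conj hL hH x a) hv

theorem leg_zero (hL : IsLagrangian L) (hH : HamiltonianFinite L) (x : M) : c.leg L x 0 = 0 := by
  refine (c.leg_unique hL hH x 0 0 (le_antisymm (c.lag_le_conj hL hH x 0 0) ?_)).symm
  rw [FibreLagrangian.conj, inner_zero_left, inner_zero_left, lag, lag, map_zero, hL.zero]
  linarith [hL.nonneg ⟨x, c.T x (c.leg L x 0)⟩]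

theorem legendre_zero (hL : IsLagrangian L) (hH : HamiltonianFinite L) (x : M) :
    legendre L (0 : Cotangent n x) = 0 := by
  rw [← c.T_leg L x 0, hat_zero, c.leg_zero hL hH, map_zero]

/-- Condition (A) with `ε = 1` and `β = 0`: either the Legendre transform of `α` has length at most
`1`, or it is at most a multiple of `|α|`. Comparison of the frames with the metric turns this into
coordinates. -/
theorem exists_leg_growth {g : RiemMetric n M} (hL : IsLagrangian L) (hH : HamiltonianFinite L)
    (hA : ConditionA g L) : ∃ C : ℝ, 0 ≤ C ∧ ∀ x a, ‖c.leg L x a‖ ≤ C * (1 + ‖a‖) := by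
  obtain ⟨C₁, hC₁, hT⟩ := c.exists_norm_le_tangentNorm g
  obtain ⟨C₂, hC₂, hA⟩ := hA 1 one_pos
  have hcot : ∀ (x : M) (a : Vec n), cotangentNorm g (c.unhat x a) ≤ C₁ * ‖a‖ := by
    intro x a
    have : Nonempty {v : TangentSpace (𝓡 n) x // tangentNorm g v ≤ 1} :=
      ⟨⟨0, by simp [tangentNorm]⟩⟩
    refine ciSup_le fun v => ?_
    rw [unhat_apply]
    refine (real_inner_le_norm _ _).trans ?_
    rw [mul_comm]
    gcongr
    refine (hT x (c.S x v)).trans ?_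
    rw [T_S]
    exact mul_le_of_le_one_right hC₁.le v.2
  refine ⟨C₁ * (1 + C₂ * C₁), by positivity, fun x a => ?_⟩
  have h1 := hT x (c.leg L x a)
  have h2 : c.T x (c.leg L x a) = legendre L (c.unhat x a) := by
    rw [← c.T_leg L x (c.unhat x a), hat_unhat]
  rw [h2] at h1
  have h3 : tangentNorm g (legendre L (c.unhat x a)) ≤ 1 + C₂ * (C₁ * ‖a‖) := by
    have hc := hcot x a
    have h0 : 0 ≤ C₁ * ‖a‖ := by positivity
    rcases le_total 1 (tangentNorm g (legendre L (c.unhat x a))) with h | h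
    · have := hA x (c.unhat x a) 0
      rw [c.legendre_zero hL hH, sub_zero, sub_zero] at this
      have h4 := this h
      have h5 : C₂ * cotangentNorm g (c.unhat x a) ≤ C₂ * (C₁ * ‖a‖) := by gcongr
      linarith
    · have : 0 ≤ C₂ * (C₁ * ‖a‖) := by positivity
      linarith
  calc ‖c.leg L x a‖ ≤ C₁ * (1 + C₂ * (C₁ * ‖a‖)) := h1.trans (by gcongr)
    _ ≤ C₁ * (1 + C₂ * C₁) * (1 + ‖a‖) := by
      have h6 : 0 ≤ ‖a‖ := norm_nonneg a
      have h7 : 0 ≤ C₂ * C₁ := by positivity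
      have h8 : 1 + C₂ * (C₁ * ‖a‖) ≤ (1 + C₂ * C₁) * (1 + ‖a‖) := by nlinarith
      calc _ ≤ C₁ * ((1 + C₂ * C₁) * (1 + ‖a‖)) := by gcongr
        _ = _ := by ring

theorem fibreLagrangian {g : RiemMetric n M} (hL : IsLagrangian L) (hH : HamiltonianFinite L)
    (hA : ConditionA g L) : FibreLagrangian (c.lag L) (c.leg L) where
  nonneg x v := hL.nonneg _
  zero x := by rw [lag, map_zero, hL.zero]
  continuous := c.continuous_lag hL
  measurable v := by
    refine c.measurable_of_continuousOn (F := fun i x => L ⟨x, frame (c.chart i) x v⟩)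
      (fun i => ?_) fun x => rfl
    exact (continuousOn_lagrangian_frame hL.contMDiff_one.continuous (c.chart_mem i)).comp
      (f := fun x : M => (x, v)) (by fun_prop) fun x hx => ⟨c.subset i hx, mem_univ _⟩
  bounded R := by
    have key : ∀ i, ∃ B : ℝ, ∀ x ∈ c.K i, ∀ v : Vec n, ‖v‖ ≤ R →
        L ⟨x, frame (c.chart i) x v⟩ ≤ B := by
      intro i
      have hcomp : IsCompact (c.K i ×ˢ Metric.closedBall (0 : Vec n) R) :=
        (c.isCompact i).prod (isCompact_closedBall 0 R)
      obtain ⟨B, hB⟩ := hcomp.bddAbove_image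
        ((continuousOn_lagrangian_frame hL.contMDiff_one.continuous (c.chart_mem i)).mono
          (prod_mono (c.subset i) (subset_univ _)))
      exact ⟨B, fun x hx v hv => hB ⟨(x, v), ⟨hx, mem_closedBall_zero_iff.2 hv⟩, rfl⟩⟩
    choose B hB using key
    refine ⟨∑ i ∈ Finset.range c.card, |B i|, Finset.sum_nonneg fun i _ => abs_nonneg _,
      fun x v hv => ?_⟩
    refine (hB (c.idx x) x (c.mem_idx x) v hv).trans ((le_abs_self _).trans ?_)
    exact Finset.single_le_sum (f := fun i => |B i|) (fun i _ => abs_nonneg _)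
      (Finset.mem_range.2 (c.idx_lt x))
  le_conj := c.lag_le_conj hL hH
  unique := c.leg_unique hL hH
  growth := c.exists_leg_growth hL hH hA

end ChartCover

end HamHeat

/-! ### Smooth measures in charts. -/

namespace HamHeat

section ChartDensity

variable {n : ℕ} {M : Type*} [TopologicalSpace M] [ChartedSpace (Vec n) M] [MeasurableSpace M]

/-- `ρ` is the density of `m` in the chart `e`. -/
def IsChartDensity (m : Measure M) (e : OpenPartialHomeomorph M (Vec n)) (ρ : Vec n → ℝ) : Prop :=
  ContDiffOn ℝ ∞ ρ e.target ∧ (∀ y ∈ e.target, 0 < ρ y) ∧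
    (m.restrict e.source).map e =
      (volume.restrict e.target).withDensity fun y => ENNReal.ofReal (ρ y)

variable [T2Space M] [BorelSpace M] {m : Measure M} {e : OpenPartialHomeomorph M (Vec n)} {ρ : Vec n → ℝ}
  {s : Set (Vec n)}

theorem aemeasurable_chart (m : Measure M) (e : OpenPartialHomeomorph M (Vec n)) :
    AEMeasurable e (m.restrict e.source) :=
  e.continuousOn.aemeasurable e.open_source.measurableSet

theorem aemeasurable_chart_symm (e : OpenPartialHomeomorph M (Vec n)) :
    AEMeasurable e.symm (volume.restrict e.target) :=
  e.symm.continuousOn.aemeasurable e.open_target.measurableSet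

theorem source_inter_preimage_image {K : Set M} (hK : K ⊆ e.source) :
    e.source ∩ e ⁻¹' (e '' K) = K := by
  ext x
  constructor
  · rintro ⟨hx, y, hy, hxy⟩
    rwa [← e.injOn (hK hy) hx hxy]
  · exact fun hx => ⟨hK hx, mem_image_of_mem _ hx⟩

theorem isCompact_source_inter_preimage (hs : IsCompact s) (hst : s ⊆ e.target) :
    IsCompact (e.source ∩ e ⁻¹' s) := by
  rw [← e.symm_image_eq_source_inter_preimage hst]
  exact hs.image_of_continuousOn (e.symm.continuousOn.mono hst)

namespace IsChartDensity

theorem bounds (h : IsChartDensity m e ρ) (hs : IsCompact s)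
    (hst : s ⊆ e.target) : ∃ a b : ℝ, 0 < a ∧ 0 < b ∧ ∀ y ∈ s, a ≤ ρ y ∧ ρ y ≤ b := by
  have hc : ContinuousOn ρ s := h.1.continuousOn.mono hst
  rcases s.eq_empty_or_nonempty with rfl | hne
  · exact ⟨1, 1, one_pos, one_pos, fun y hy => hy.elim⟩
  obtain ⟨y₁, hy₁, h₁⟩ := hs.exists_isMinOn hne hc
  obtain ⟨y₂, hy₂, h₂⟩ := hs.exists_isMaxOn hne hc
  exact ⟨ρ y₁, ρ y₂, h.2.1 _ (hst hy₁), h.2.1 _ (hst hy₂), fun y hy => ⟨h₁ hy, h₂ hy⟩⟩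

theorem map_restrict (h : IsChartDensity m e ρ) (hs : MeasurableSet s) (hst : s ⊆ e.target) :
    (m.restrict (e.source ∩ e ⁻¹' s)).map e =
      (volume.restrict s).withDensity fun y => ENNReal.ofReal (ρ y) := by
  have h1 := congrArg (fun μ => μ.restrict s) h.2.2
  rw [Measure.restrict_map_of_aemeasurable (aemeasurable_chart m e) hs,
    Measure.restrict_restrict₀ ((aemeasurable_chart m e).nullMeasurable hs),
    restrict_withDensity hs, Measure.restrict_restrict hs, inter_eq_left.2 hst] at h1
  rwa [inter_comm]

/-- On a compact part of the chart `m` and Lebesgue measure bound each other, so integrability moves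
in both directions between `M` and the chart. -/
theorem exists_map_restrict_le (h : IsChartDensity m e ρ) (hs : IsCompact s)
    (hst : s ⊆ e.target) : ∃ a b : ℝ≥0∞, a ≠ 0 ∧ a ≠ ⊤ ∧ b ≠ ⊤ ∧
      a • volume.restrict s ≤ (m.restrict (e.source ∩ e ⁻¹' s)).map e ∧
      (m.restrict (e.source ∩ e ⁻¹' s)).map e ≤ b • volume.restrict s := by
  obtain ⟨a, b, ha, hb, hab⟩ := h.bounds hs hst
  refine ⟨ENNReal.ofReal a, ENNReal.ofReal b, by simpa using ha, ENNReal.ofReal_ne_top,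
    ENNReal.ofReal_ne_top, ?_, ?_⟩
  · rw [h.map_restrict hs.measurableSet hst, ← withDensity_const]
    refine withDensity_mono ?_
    filter_upwards [ae_restrict_mem hs.measurableSet] with y hy
    exact ENNReal.ofReal_le_ofReal (hab y hy).1
  · rw [h.map_restrict hs.measurableSet hst, ← withDensity_const]
    refine withDensity_mono ?_
    filter_upwards [ae_restrict_mem hs.measurableSet] with y hy
    exact ENNReal.ofReal_le_ofReal (hab y hy).2

theorem integrableOn_comp {E : Type*} [NormedAddCommGroup E] (h : IsChartDensity m e ρ)
    (hs : IsCompact s) (hst : s ⊆ e.target) {f : Vec n → E} (hf : IntegrableOn f s) :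
    IntegrableOn (fun x => f (e x)) (e.source ∩ e ⁻¹' s) m := by
  obtain ⟨a, b, -, -, hb, -, hle⟩ := h.exists_map_restrict_le hs hst
  exact ((hf.smul_measure hb).mono_measure hle).comp_aemeasurable
    ((aemeasurable_chart m e).mono_measure (Measure.restrict_mono inter_subset_left le_rfl))

theorem integrableOn_comp_symm {E : Type*} [NormedAddCommGroup E] (h : IsChartDensity m e ρ)
    (hs : IsCompact s) (hst : s ⊆ e.target) {f : M → E}
    (hf : IntegrableOn f (e.source ∩ e ⁻¹' s) m) :
    IntegrableOn (fun y => f (e.symm y)) s := by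
  obtain ⟨a, b, ha, ha', -, hle, -⟩ := h.exists_map_restrict_le hs hst
  have hme : AEMeasurable e (m.restrict (e.source ∩ e ⁻¹' s)) :=
    (aemeasurable_chart m e).mono_measure (Measure.restrict_mono inter_subset_left le_rfl)
  have hme' : AEMeasurable e.symm ((m.restrict (e.source ∩ e ⁻¹' s)).map e) := by
    rw [h.map_restrict hs.measurableSet hst]
    exact ((aemeasurable_chart_symm e).mono_measure (Measure.restrict_mono hst le_rfl)).mono_ac
      (withDensity_absolutelyContinuous _ _)
  have hid : ((m.restrict (e.source ∩ e ⁻¹' s)).map e).map e.symm =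
      m.restrict (e.source ∩ e ⁻¹' s) := by
    rw [AEMeasurable.map_map_of_aemeasurable hme' hme]
    conv_rhs => rw [← Measure.map_id (μ := m.restrict (e.source ∩ e ⁻¹' s))]
    refine Measure.map_congr ?_
    filter_upwards [ae_restrict_mem (isCompact_source_inter_preimage hs hst).measurableSet]
      with x hx
    exact e.left_inv hx.1
  have hle' := Measure.map_mono_of_aemeasurable hle hme'
  rw [hid] at hle'
  have h2 : Integrable (fun y => f (e.symm y)) (a • volume.restrict s) :=
    (Integrable.mono_measure hf hle').comp_aemeasurable (hme'.mono_measure hle)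
  exact (integrable_smul_measure ha ha').1 h2

theorem setIntegral_target (h : IsChartDensity m e ρ) {f : Vec n → ℝ}
    (hf : AEStronglyMeasurable f (volume.restrict e.target)) :
    ∫ y in e.target, f y = ∫ x in e.source, f (e x) / ρ (e x) ∂m := by
  have hρ : AEMeasurable ρ (volume.restrict e.target) :=
    h.1.continuousOn.aemeasurable e.open_target.measurableSet
  have h1 : AEStronglyMeasurable (fun y => f y / ρ y) ((m.restrict e.source).map e) := by
    rw [h.2.2]
    exact (hf.aemeasurable.div hρ).aestronglyMeasurable.mono_ac
      (withDensity_absolutelyContinuous _ _)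
  have h2 := integral_map (aemeasurable_chart m e) h1
  rw [← h2, h.2.2, integral_withDensity_eq_integral_toReal_smul₀ hρ.ennreal_ofReal
    (Eventually.of_forall fun _ => ENNReal.ofReal_lt_top)]
  refine setIntegral_congr_fun e.open_target.measurableSet fun y hy => ?_
  have := h.2.1 y hy
  simp only [smul_eq_mul, ENNReal.toReal_ofReal this.le]
  field_simp

theorem ae_source (h : IsChartDensity m e ρ) {p : Vec n → Prop}
    (hp : ∀ᵐ y ∂volume.restrict e.target, p y) : ∀ᵐ x ∂m.restrict e.source, p (e x) := by
  refine ae_of_ae_map (aemeasurable_chart m e) ?_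
  rw [h.2.2]
  exact (withDensity_absolutelyContinuous _ _).ae_le hp

end IsChartDensity

theorem isFiniteMeasure_of_isPositiveSmoothMeasure (c : ChartCover n M)
    (hm : IsPositiveSmoothMeasure n m) : IsFiniteMeasure m := by
  have h1 : ∀ i, m (c.K i) < ⊤ := by
    intro i
    obtain ⟨ρ, hρ⟩ := hm _ (c.chart_mem i)
    have hs : IsCompact (c.chart i '' c.K i) :=
      (c.isCompact i).image_of_continuousOn ((c.chart i).continuousOn.mono (c.subset i))
    have hst : c.chart i '' c.K i ⊆ (c.chart i).target :=
      image_subset_iff.2 fun x hx => (c.chart i).map_source (c.subset i hx)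
    have hone : IntegrableOn (fun _ : Vec n => (1 : ℝ)) (c.chart i '' c.K i) :=
      integrableOn_const hs.measure_lt_top.ne
    have h2 := IsChartDensity.integrableOn_comp (m := m) (e := c.chart i) hρ hs hst hone
    rw [source_inter_preimage_image (c.subset i)] at h2
    have := (integrable_const_iff.1 h2).resolve_left one_ne_zero
    rw [isFiniteMeasure_restrict] at this
    exact lt_top_iff_ne_top.2 this
  refine ⟨?_⟩
  have h3 : (univ : Set M) ⊆ ⋃ i ∈ Finset.range c.card, c.K i := fun x _ =>
    mem_iUnion₂.2 ⟨c.idx x, Finset.mem_range.2 (c.idx_lt x), c.mem_idx x⟩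
  exact (measure_mono h3).trans_lt ((measure_biUnion_finset_le _ _).trans_lt
    (ENNReal.sum_lt_top.2 fun i _ => h1 i))

end ChartDensity

end HamHeat

/-! ### Weak differentials as pairings with bounded fields on `M`. -/

namespace HamHeat

section WeakPair

variable {n : ℕ} {M : Type*} [TopologicalSpace M] [ChartedSpace (Vec n) M] [MeasurableSpace M]

theorem integrable_of_inner {μ : Measure M} {f : M → Vec n}
    (hf : ∀ w, Integrable (fun x => inner ℝ (f x) w) μ) : Integrable f μ := by
  have h1 : f = fun x => ∑ k, inner ℝ (f x) (EuclideanSpace.basisFun (Fin n) ℝ k) •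
      EuclideanSpace.basisFun (Fin n) ℝ k := by
    funext x
    conv_lhs => rw [← (EuclideanSpace.basisFun (Fin n) ℝ).sum_repr' (f x)]
    exact Finset.sum_congr rfl fun k _ => by rw [real_inner_comm]
  rw [h1]
  exact integrable_finsetSum _ fun k _ => (hf _).smul_const _

theorem _root_.ContinuousOn.of_zero_outside {X Y : Type*} [TopologicalSpace X] [TopologicalSpace Y]
    [Zero Y] {f : X → Y} {U Q A : Set X} (hU : IsOpen U) (hQ : IsClosed Q) (hQU : Q ⊆ U)
    (hf : ContinuousOn f (U ∩ A)) (h0 : ∀ x ∉ Q, f x = 0) : ContinuousOn f A := by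
  intro x hx
  by_cases hxQ : x ∈ Q
  · have := hf x ⟨hQU hxQ, hx⟩
    rwa [inter_comm, continuousWithinAt_inter (hU.mem_nhds (hQU hxQ))] at this
  · refine ContinuousAt.continuousWithinAt ?_
    have : f =ᶠ[𝓝 x] fun _ => 0 := by
      filter_upwards [hQ.isOpen_compl.mem_nhds hxQ] with y hy using h0 y hy
    exact continuousAt_const.congr this.symm

/-- The factor of `u` in the definition of the weak differential, as a function on `M`. -/
noncomputable def testFun (e : OpenPartialHomeomorph M (Vec n)) (ρ ψ : Vec n → ℝ) (w : Vec n) :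
    M → ℝ :=
  e.source.indicator fun x => fderiv ℝ ψ (e x) w / ρ (e x)

/-- The factor of `du` in the definition of the weak differential, as a vector field on `M`. -/
noncomputable def testVec (c : ChartCover n M) (e : OpenPartialHomeomorph M (Vec n))
    (ρ ψ : Vec n → ℝ) (w : Vec n) : M → Vec n :=
  e.source.indicator fun x => (ψ (e x) / ρ (e x)) • c.S x (frame e x w)

variable (c : ChartCover n M) {m : Measure M} {e : OpenPartialHomeomorph M (Vec n)}
  {ρ ψ : Vec n → ℝ}

theorem ChartCover.exists_bound {E : Type*} [SeminormedAddCommGroup E] {f : M → E}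
    {F : ℕ → M → E} (hF : ∀ i, ContinuousOn (F i) (c.K i)) (hf : ∀ x, f x = F (c.idx x) x) :
    ∃ C : ℝ, ∀ x, ‖f x‖ ≤ C := by
  choose C hC using fun i => (c.isCompact i).exists_bound_of_continuousOn (hF i)
  refine ⟨∑ i ∈ Finset.range c.card, |C i|, fun x => ?_⟩
  rw [hf]
  exact ((hC _ _ (c.mem_idx x)).trans (le_abs_self _)).trans
    (Finset.single_le_sum (f := fun i => |C i|) (fun i _ => abs_nonneg _)
      (Finset.mem_range.2 (c.idx_lt x)))

theorem ChartCover.cotangent_apply [IsManifold (𝓡 n) ∞ M] (θ : ∀ x : M, Cotangent n x)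
    {y : Vec n} (hy : y ∈ e.target) (w : Vec n) :
    θ (e.symm y) (mfderiv 𝓘(ℝ, Vec n) (𝓡 n) e.symm y w) =
      inner ℝ (c.hat (e.symm y) (θ (e.symm y))) (c.S (e.symm y) (frame e (e.symm y) w)) := by
  rw [c.inner_hat]
  have h1 : frame e (e.symm y) = mfderiv 𝓘(ℝ, Vec n) (𝓡 n) e.symm y := by
    rw [frame, e.right_inv hy]
  exact congrArg (θ (e.symm y)) ((congrArg (fun A : Vec n →L[ℝ] Vec n => A w) h1).symm.trans
    (c.T_S (e.symm y) (frame e (e.symm y) w)).symm)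

variable [T2Space M] [BorelSpace M]

theorem continuous_testFun (h : IsChartDensity m e ρ) (hψ : ContDiff ℝ ∞ ψ)
    (hc : HasCompactSupport ψ) (ht : tsupport ψ ⊆ e.target) (w : Vec n) :
    Continuous (testFun e ρ ψ w) := by
  rw [← continuousOn_univ]
  refine ContinuousOn.of_zero_outside e.open_source
    (isCompact_source_inter_preimage hc ht).isClosed inter_subset_left ?_ fun x hx => ?_
  · rw [inter_univ]
    have h1 : ContinuousOn (fun x => fderiv ℝ ψ (e x) w / ρ (e x)) e.source := by
      refine ContinuousOn.div ?_ (h.1.continuousOn.comp e.continuousOn e.mapsTo)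
        fun x hx => (h.2.1 _ (e.map_source hx)).ne'
      have : Continuous fun y => fderiv ℝ ψ y w :=
        (hψ.continuous_fderiv (by simp)).clm_apply continuous_const
      exact this.comp_continuousOn e.continuousOn
    exact h1.congr fun x hx => indicator_of_mem hx _
  · by_cases hxs : x ∈ e.source
    · rw [testFun, indicator_of_mem hxs]
      have : e x ∉ tsupport ψ := fun h => hx ⟨hxs, h⟩
      rw [fderiv_of_notMem_tsupport ℝ this]
      simp
    · exact indicator_of_notMem hxs _

/-- `testVec` may jump with `idx`; where `idx` equals `i` it agrees with this field, which is
continuous on `K i`. That suffices for its measurability and boundedness. -/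
theorem continuousOn_testVec_aux [IsManifold (𝓡 n) ∞ M] (h : IsChartDensity m e ρ)
    (he : e ∈ atlas (Vec n) M) (hψ : ContDiff ℝ ∞ ψ)
    (hc : HasCompactSupport ψ) (ht : tsupport ψ ⊆ e.target) (w : Vec n) (i : ℕ) :
    ContinuousOn (e.source.indicator fun x =>
      (ψ (e x) / ρ (e x)) • coframe (c.chart i) x (frame e x w)) (c.K i) := by
  refine ContinuousOn.of_zero_outside e.open_source
    (isCompact_source_inter_preimage hc ht).isClosed inter_subset_left ?_ fun x hx => ?_
  · have h1 : ContinuousOn (fun x => ψ (e x) / ρ (e x)) e.source :=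
      ContinuousOn.div (hψ.continuous.comp_continuousOn e.continuousOn)
        (h.1.continuousOn.comp e.continuousOn e.mapsTo) fun x hx => (h.2.1 _ (e.map_source hx)).ne'
    have h2 := (h1.mono inter_subset_left).smul ((continuousOn_coframe_frame (c.chart_mem i) he
      w).mono fun x (hx : x ∈ e.source ∩ c.K i) => ⟨c.subset i hx.2, hx.1⟩)
    exact h2.congr fun x hx => indicator_of_mem hx.1 _
  · by_cases hxs : x ∈ e.source
    · rw [indicator_of_mem hxs, image_eq_zero_of_notMem_tsupport fun h => hx ⟨hxs, h⟩]
      simp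
    · exact indicator_of_notMem hxs _

theorem measurable_testVec [IsManifold (𝓡 n) ∞ M] (h : IsChartDensity m e ρ)
    (he : e ∈ atlas (Vec n) M) (hψ : ContDiff ℝ ∞ ψ)
    (hc : HasCompactSupport ψ) (ht : tsupport ψ ⊆ e.target) (w : Vec n) :
    Measurable (testVec c e ρ ψ w) :=
  c.measurable_of_continuousOn (fun i => continuousOn_testVec_aux c h he hψ hc ht w i) fun x => by
    simp only [testVec, indicator]
    rfl

theorem exists_bound_testVec [IsManifold (𝓡 n) ∞ M] (h : IsChartDensity m e ρ)
    (he : e ∈ atlas (Vec n) M) (hψ : ContDiff ℝ ∞ ψ)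
    (hc : HasCompactSupport ψ) (ht : tsupport ψ ⊆ e.target) (w : Vec n) :
    ∃ C : ℝ, ∀ x, ‖testVec c e ρ ψ w x‖ ≤ C :=
  c.exists_bound (fun i => continuousOn_testVec_aux c h he hψ hc ht w i) fun x => by
    simp only [testVec, indicator]
    rfl

theorem integral_target_mul (h : IsChartDensity m e ρ) {f : M → ℝ} {η : Vec n → ℝ}
    (hf : LocallyIntegrableOn (fun y => f (e.symm y)) e.target) (hη : Continuous η) :
    ∫ y in e.target, f (e.symm y) * η y =
      ∫ x, e.source.indicator (fun x => f x * (η (e x) / ρ (e x))) x ∂m := by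
  rw [h.setIntegral_target (f := fun y => f (e.symm y) * η y)
      (hf.aestronglyMeasurable.mul hη.aestronglyMeasurable),
    integral_indicator e.open_source.measurableSet]
  refine setIntegral_congr_fun e.open_source.measurableSet fun x hx => ?_
  simp only [e.left_inv hx]
  ring

/-- `θ` is the weak differential of `u`, in coordinates. -/
def IsWeakPair (m : Measure M) (u : M → ℝ) (θ : M → Vec n) : Prop :=
  Integrable θ m ∧ ∀ e ∈ atlas (Vec n) M, ∀ ρ, IsChartDensity m e ρ → ∀ (w : Vec n)
    (ψ : Vec n → ℝ), ContDiff ℝ ∞ ψ → HasCompactSupport ψ → tsupport ψ ⊆ e.target →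
      ∫ x, u x * testFun e ρ ψ w x ∂m = - ∫ x, inner ℝ (θ x) (testVec c e ρ ψ w x) ∂m

theorem locallyIntegrableOn_comp_symm (h : IsChartDensity m e ρ) {f : M → ℝ}
    (hf : ∀ K ⊆ e.source, IsCompact K → IntegrableOn f K m) :
    LocallyIntegrableOn (fun y => f (e.symm y)) e.target := by
  rw [locallyIntegrableOn_iff e.open_target.isLocallyClosed]
  exact fun s hs hsc => h.integrableOn_comp_symm hsc hs
    (hf _ inter_subset_left (isCompact_source_inter_preimage hsc hs))

theorem integrableOn_of_locallyIntegrableOn (h : IsChartDensity m e ρ) {g : Vec n → ℝ}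
    (hg : LocallyIntegrableOn g e.target) {K : Set M} (hK : IsCompact K) (hKe : K ⊆ e.source) :
    IntegrableOn (fun x => g (e x)) K m := by
  have hst : e '' K ⊆ e.target := image_subset_iff.2 fun x hx => e.map_source (hKe hx)
  have hs : IsCompact (e '' K) := hK.image_of_continuousOn (e.continuousOn.mono hKe)
  have := h.integrableOn_comp hs hst (hg.integrableOn_compact_subset hst hs)
  rwa [source_inter_preimage_image hKe] at this

theorem ChartCover.integrable_of_integrableOn {E : Type*} [NormedAddCommGroup E] {f : M → E}
    (hf : ∀ i, IntegrableOn f (c.idx ⁻¹' {i}) m) : Integrable f m := by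
  have h1 : (⋃ i ∈ Finset.range c.card, c.idx ⁻¹' {i}) = univ := by
    refine eq_univ_of_forall fun x => mem_iUnion₂.2 ⟨c.idx x, Finset.mem_range.2 (c.idx_lt x), rfl⟩
  rw [← integrableOn_univ, ← h1]
  exact (integrableOn_finset_iUnion).2 fun i _ => hf i

variable [IsManifold (𝓡 n) ∞ M]

theorem ChartCover.S_frame (x : M) (w : Vec n) : c.S x (frame (c.chart (c.idx x)) x w) = w :=
  coframe_frame (c.chart_mem _) (c.mem_source x) w

theorem ChartCover.locallyIntegrableOn_component (h : IsChartDensity m e ρ)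
    (he : e ∈ atlas (Vec n) M) {θ : M → Vec n} (hθ : Integrable θ m) (w : Vec n) :
    LocallyIntegrableOn (fun y => inner ℝ (θ (e.symm y)) (c.S (e.symm y) (frame e (e.symm y) w)))
      e.target := by
  refine locallyIntegrableOn_comp_symm (f := fun x => inner ℝ (θ x) (c.S x (frame e x w))) h
    fun K hK hKc => ?_
  have hF : ∀ i, ContinuousOn (fun x => coframe (c.chart i) x (frame e x w)) (c.K i ∩ K) :=
    fun i => (continuousOn_coframe_frame (c.chart_mem i) he w).mono fun x hx =>
      ⟨c.subset i hx.1, hK hx.2⟩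
  choose C hC using fun i =>
    ((c.isCompact i).inter_right hKc.isClosed).exists_bound_of_continuousOn (hF i)
  have hpart : ∀ i, IntegrableOn (fun x => inner ℝ (θ x) (c.S x (frame e x w)))
      (K ∩ c.idx ⁻¹' {i}) m := by
    intro i
    have hmeas : MeasurableSet (K ∩ c.idx ⁻¹' {i}) :=
      hKc.isClosed.measurableSet.inter (c.measurable_idx (measurableSet_singleton i))
    have hsub : K ∩ c.idx ⁻¹' {i} ⊆ c.K i ∩ K := by
      rintro x ⟨hx, rfl⟩
      exact ⟨c.mem_idx x, hx⟩
    have h1 : AEStronglyMeasurable (fun x => coframe (c.chart i) x (frame e x w))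
        (m.restrict (K ∩ c.idx ⁻¹' {i})) :=
      ((hF i).mono hsub).aestronglyMeasurable hmeas
    have h2 : IntegrableOn (fun x => inner ℝ (θ x) (coframe (c.chart i) x (frame e x w)))
        (K ∩ c.idx ⁻¹' {i}) m := by
      refine Integrable.mono' (hθ.integrableOn.norm.mul_const (C i))
        (hθ.integrableOn.aestronglyMeasurable.inner h1) ?_
      filter_upwards [ae_restrict_mem hmeas] with x hx
      exact (norm_inner_le_norm _ _).trans
        (mul_le_mul_of_nonneg_left (hC i x (hsub hx)) (norm_nonneg _))
    refine h2.congr_fun (fun x hx => ?_) hmeas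
    obtain ⟨-, rfl⟩ := hx
    rfl
  have h3 : K = ⋃ i ∈ Finset.range c.card, (K ∩ c.idx ⁻¹' {i}) := by
    ext x
    simp only [mem_iUnion, mem_inter_iff, mem_preimage, mem_singleton_iff, Finset.mem_range]
    exact ⟨fun hx => ⟨_, c.idx_lt x, hx, rfl⟩, fun ⟨_, _, hx, _⟩ => hx⟩
  rw [h3]
  exact (integrableOn_finset_iUnion).2 fun i _ => hpart i

theorem integral_pair (h : IsChartDensity m e ρ) (he : e ∈ atlas (Vec n) M) (hψ : Continuous ψ)
    {θ : M → Vec n} (hθ : Integrable θ m) (w : Vec n) :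
    ∫ y in e.target, inner ℝ (θ (e.symm y)) (c.S (e.symm y) (frame e (e.symm y) w)) * ψ y =
      ∫ x, inner ℝ (θ x) (testVec c e ρ ψ w x) ∂m := by
  rw [integral_target_mul (f := fun x => inner ℝ (θ x) (c.S x (frame e x w))) h
    (c.locallyIntegrableOn_component h he hθ w) hψ]
  refine integral_congr_ae (Eventually.of_forall fun x => ?_)
  by_cases hx : x ∈ e.source
  · simp only [testVec, indicator_of_mem hx, real_inner_smul_right]
    ring
  · simp only [testVec, indicator_of_notMem hx, inner_zero_right]

theorem integral_fun (h : IsChartDensity m e ρ) (hψ : ContDiff ℝ ∞ ψ)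
    {u : M → ℝ} (hu : LocallyIntegrableOn (fun y => u (e.symm y)) e.target) (w : Vec n) :
    ∫ y in e.target, u (e.symm y) * fderiv ℝ ψ y w = ∫ x, u x * testFun e ρ ψ w x ∂m := by
  rw [integral_target_mul h hu ((hψ.continuous_fderiv (by simp)).clm_apply continuous_const)]
  refine integral_congr_ae (Eventually.of_forall fun x => ?_)
  by_cases hx : x ∈ e.source
  · simp only [testFun, indicator_of_mem hx]
  · simp only [testFun, indicator_of_notMem hx, mul_zero]

/-- The change of variables absorbs the density into the test fields. Local integrability in the
charts becomes integrability on `M` because finitely many compact pieces cover `M`. In this form the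
notion is linear and stable under weak limits. -/
theorem isWeakDifferential_iff (hm : IsPositiveSmoothMeasure n m) {u : M → ℝ}
    (hu : Integrable u m) {θ : ∀ x : M, Cotangent n x} :
    IsWeakDifferential u θ ↔ IsWeakPair c m u fun x => c.hat x (θ x) := by
  have hul : ∀ e ∈ atlas (Vec n) M, LocallyIntegrableOn (fun y => u (e.symm y)) e.target := by
    intro e he
    obtain ⟨ρ, hρ⟩ := hm e he
    exact locallyIntegrableOn_comp_symm (m := m) hρ fun K _ _ => hu.integrableOn
  have hset : ∀ e : OpenPartialHomeomorph M (Vec n), ∀ (w : Vec n) (ψ : Vec n → ℝ),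
      ∫ y in e.target, θ (e.symm y) (mfderiv 𝓘(ℝ, Vec n) (𝓡 n) e.symm y w) * ψ y =
      ∫ y in e.target, inner ℝ (c.hat (e.symm y) (θ (e.symm y)))
        (c.S (e.symm y) (frame e (e.symm y) w)) * ψ y := fun e w ψ =>
    setIntegral_congr_fun e.open_target.measurableSet fun y hy =>
      congrArg (· * ψ y) (c.cotangent_apply θ hy w)
  constructor
  · intro h
    have hint : Integrable (fun x => c.hat x (θ x)) m := by
      refine integrable_of_inner fun w => c.integrable_of_integrableOn fun i => ?_
      obtain ⟨ρ, hρ⟩ := hm _ (c.chart_mem i)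
      have h1 := integrableOn_of_locallyIntegrableOn (m := m) hρ ((h _ (c.chart_mem i)).2 w).1
        (c.isCompact i) (c.subset i)
      refine (h1.mono_set ?_).congr_fun ?_ (c.measurable_idx (measurableSet_singleton i))
      · rintro x rfl
        exact c.mem_idx x
      · rintro x rfl
        simp only
        rw [c.cotangent_apply θ ((c.chart _).map_source (c.mem_source x)),
          (c.chart _).left_inv (c.mem_source x), c.S_frame]
    refine ⟨hint, fun e he ρ hρ w ψ hψ hc ht => ?_⟩
    have := ((h e he).2 w).2 ψ hψ hc ht
    rwa [hset, integral_fun hρ hψ (hul e he), integral_pair c hρ he hψ.continuous hint] at this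
  · intro h e he
    obtain ⟨ρ, hρ⟩ := hm _ he
    refine ⟨hul e he, fun w => ⟨?_, fun ψ hψ hc ht => ?_⟩⟩
    · have h1 := c.locallyIntegrableOn_component hρ he h.1 w
      rw [locallyIntegrableOn_iff e.open_target.isLocallyClosed] at h1 ⊢
      exact fun s hs hsc => (h1 s hs hsc).congr_fun
        (fun y hy => (c.cotangent_apply θ (hs hy) w).symm) hsc.measurableSet
    · rw [hset, integral_fun hρ hψ (hul e he), integral_pair c hρ he hψ.continuous h.1]
      exact h.2 e he ρ hρ w ψ hψ hc ht

end WeakPair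

end HamHeat

/-! ### Linearity, closedness and uniqueness of weak differentials. -/

namespace HamHeat

section WeakPairLemmas

variable {n : ℕ} {M : Type*} [TopologicalSpace M] [ChartedSpace (Vec n) M] [MeasurableSpace M]
  [T2Space M] [BorelSpace M] [CompactSpace M] [IsManifold (𝓡 n) ∞ M]
  {c : ChartCover n M} {m : Measure M} {e : OpenPartialHomeomorph M (Vec n)} {ρ ψ : Vec n → ℝ}
  {u v : M → ℝ} {θ η : M → Vec n}

theorem integrable_mul_testFun (h : IsChartDensity m e ρ) (hψ : ContDiff ℝ ∞ ψ)
    (hc : HasCompactSupport ψ) (ht : tsupport ψ ⊆ e.target) (w : Vec n) (hu : Integrable u m) :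
    Integrable (fun x => u x * testFun e ρ ψ w x) m := by
  have h1 := continuous_testFun h hψ hc ht w
  obtain ⟨C, hC⟩ := isCompact_univ.exists_bound_of_continuousOn h1.continuousOn
  exact hu.mul_bdd h1.measurable.aestronglyMeasurable
    (Eventually.of_forall fun x => hC x (mem_univ x))

theorem integrable_inner_testVec (h : IsChartDensity m e ρ) (he : e ∈ atlas (Vec n) M)
    (hψ : ContDiff ℝ ∞ ψ)
    (hc : HasCompactSupport ψ) (ht : tsupport ψ ⊆ e.target) (w : Vec n) (hθ : Integrable θ m) :
    Integrable (fun x => inner ℝ (θ x) (testVec c e ρ ψ w x)) m := by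
  have h1 := measurable_testVec c h he hψ hc ht w
  obtain ⟨C, hC⟩ := exists_bound_testVec c h he hψ hc ht w
  refine Integrable.mono' (hθ.norm.mul_const C) (hθ.1.inner h1.aestronglyMeasurable)
    (Eventually.of_forall fun x => (norm_inner_le_norm _ _).trans
      (mul_le_mul_of_nonneg_left (hC x) (norm_nonneg _)))

namespace IsWeakPair

theorem congr_left (h : IsWeakPair c m u θ) (huv : u =ᵐ[m] v) : IsWeakPair c m v θ := by
  refine ⟨h.1, fun e he ρ hρ w ψ hψ hc ht => ?_⟩
  rw [← h.2 e he ρ hρ w ψ hψ hc ht]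
  refine integral_congr_ae ?_
  filter_upwards [huv] with x hx
  rw [hx]

theorem add (h : IsWeakPair c m u θ) (h' : IsWeakPair c m v η) (hu : Integrable u m)
    (hv : Integrable v m) : IsWeakPair c m (fun x => u x + v x) (fun x => θ x + η x) := by
  refine ⟨h.1.add h'.1, fun e he ρ hρ w ψ hψ hc ht => ?_⟩
  simp only [add_mul, inner_add_left]
  rw [integral_add (integrable_mul_testFun hρ hψ hc ht w hu)
      (integrable_mul_testFun hρ hψ hc ht w hv),
    integral_add (integrable_inner_testVec hρ he hψ hc ht w h.1)
      (integrable_inner_testVec hρ he hψ hc ht w h'.1), h.2 e he ρ hρ w ψ hψ hc ht,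
    h'.2 e he ρ hρ w ψ hψ hc ht, neg_add]

theorem const_smul (h : IsWeakPair c m u θ) (r : ℝ) :
    IsWeakPair c m (fun x => r * u x) (fun x => r • θ x) := by
  refine ⟨h.1.smul r, fun e he ρ hρ w ψ hψ hc ht => ?_⟩
  simp only [mul_assoc, real_inner_smul_left]
  rw [integral_const_mul, integral_const_mul, h.2 e he ρ hρ w ψ hψ hc ht, mul_neg]

theorem of_tendsto {ι : Type*} {f : Filter ι} [f.NeBot] {u' : ι → M → ℝ} {θ' : ι → M → Vec n}
    (h : ∀ i, IsWeakPair c m (u' i) (θ' i)) (hθ : Integrable θ m)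
    (hu : ∀ φ : M → ℝ, Continuous φ →
      Tendsto (fun i => ∫ x, u' i x * φ x ∂m) f (𝓝 (∫ x, u x * φ x ∂m)))
    (hlim : ∀ (Y : M → Vec n) (C : ℝ), AEStronglyMeasurable Y m → (∀ x, ‖Y x‖ ≤ C) →
      Tendsto (fun i => ∫ x, inner ℝ (θ' i x) (Y x) ∂m) f (𝓝 (∫ x, inner ℝ (θ x) (Y x) ∂m))) :
    IsWeakPair c m u θ := by
  refine ⟨hθ, fun e he ρ hρ w ψ hψ hc ht => ?_⟩
  obtain ⟨C, hC⟩ := exists_bound_testVec c hρ he hψ hc ht w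
  have h1 := hu _ (continuous_testFun hρ hψ hc ht w)
  have h2 := (hlim _ C (measurable_testVec c hρ he hψ hc ht w).aestronglyMeasurable hC).neg
  exact tendsto_nhds_unique h1
    (h2.congr fun i => ((h i).2 e he ρ hρ w ψ hψ hc ht).symm)

/-- The fundamental lemma of the calculus of variations, in each chart of the cover and for each
basis vector. -/
theorem ae_eq_zero (hm : IsPositiveSmoothMeasure n m) (h : IsWeakPair c m (fun _ => 0) θ) :
    θ =ᵐ[m] 0 := by
  have key : ∀ i (w : Vec n), ∀ᵐ x ∂m.restrict (c.chart i).source,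
      inner ℝ (θ x) (c.S x (frame (c.chart i) x w)) = 0 := by
    intro i w
    obtain ⟨ρ, hρ⟩ := hm _ (c.chart_mem i)
    have hρ' : IsChartDensity m (c.chart i) ρ := hρ
    have h1 := (c.chart i).open_target.ae_eq_zero_of_integral_contDiff_smul_eq_zero
      (c.locallyIntegrableOn_component hρ' (c.chart_mem i) h.1 w) fun ψ hψ hc ht => by
        have h2 := h.2 _ (c.chart_mem i) ρ hρ w ψ hψ hc ht
        rw [← integral_pair c hρ' (c.chart_mem i) hψ.continuous h.1 w] at h2
        simp only [zero_mul, integral_zero] at h2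
        rw [← setIntegral_eq_integral_of_forall_compl_eq_zero (s := (c.chart i).target)]
        · rw [← neg_eq_zero, h2]
          simp only [smul_eq_mul, mul_comm]
        · intro y hy
          rw [image_eq_zero_of_notMem_tsupport fun hy' => hy (ht hy'), zero_smul]
    have h3 := hρ'.ae_source ((ae_restrict_iff' (c.chart i).open_target.measurableSet).2 h1)
    filter_upwards [h3, ae_restrict_mem (c.chart i).open_source.measurableSet] with x hx hxs
    rwa [(c.chart i).left_inv hxs] at hx
  have h4 : ∀ᵐ x ∂m, ∀ i (k : Fin n), x ∈ (c.chart i).source →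
      inner ℝ (θ x) (c.S x (frame (c.chart i) x (EuclideanSpace.basisFun (Fin n) ℝ k))) = 0 :=
    ae_all_iff.2 fun i => ae_all_iff.2 fun k =>
      (ae_restrict_iff' (c.chart i).open_source.measurableSet).1 (key i _)
  filter_upwards [h4] with x hx
  rw [Pi.zero_apply, ← (EuclideanSpace.basisFun (Fin n) ℝ).sum_repr' (θ x)]
  refine Finset.sum_eq_zero fun k _ => ?_
  have := hx _ k (c.mem_source x)
  rw [c.S_frame, real_inner_comm] at this
  rw [this, zero_smul]

theorem ae_eq (hm : IsPositiveSmoothMeasure n m) (hu : Integrable u m) (h : IsWeakPair c m u θ)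
    (h' : IsWeakPair c m u η) : θ =ᵐ[m] η := by
  have h1 := (h.add (h'.const_smul (-1)) hu (hu.const_mul _)).congr_left (v := fun _ => 0)
    (Eventually.of_forall fun x => by ring)
  filter_upwards [h1.ae_eq_zero hm] with x hx
  simpa [sub_eq_zero, ← sub_eq_add_neg] using hx

theorem weaklyDifferentiable (hm : IsPositiveSmoothMeasure n m) (hu : Integrable u m)
    (h : IsWeakPair c m u θ) : WeaklyDifferentiable n u := by
  refine ⟨fun x => c.unhat x (θ x), (isWeakDifferential_iff c hm hu).2 ?_⟩
  simpa only [c.hat_unhat] using h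

end IsWeakPair

theorem WeaklyDifferentiable.isWeakPair (hm : IsPositiveSmoothMeasure n m) (hu : Integrable u m)
    (h : WeaklyDifferentiable n u) : IsWeakPair c m u fun x => c.hat x (weakDiff n u x) := by
  refine (isWeakDifferential_iff c hm hu).1 ?_
  rw [weakDiff, dif_pos h]
  exact h.choose_spec

/-- The arbitrary choice made in `weakDiff` is harmless: it agrees almost everywhere with any weak
differential found otherwise. -/
theorem IsWeakPair.hat_weakDiff_ae_eq (hm : IsPositiveSmoothMeasure n m) (hu : Integrable u m)
    (h : IsWeakPair c m u θ) : (fun x => c.hat x (weakDiff n u x)) =ᵐ[m] θ :=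
  ((h.weaklyDifferentiable hm hu).isWeakPair hm hu).ae_eq hm hu h

end WeakPairLemmas

/-! ### Smooth functions: the weak differential is the differential, and it is bounded. -/

section Smooth

variable {n : ℕ} {M : Type*} [TopologicalSpace M] [ChartedSpace (Vec n) M]
  [IsManifold (𝓡 n) ∞ M] {e : OpenPartialHomeomorph M (Vec n)} {φ : M → ℝ}

theorem contDiffOn_comp_symm (hφ : ContMDiff (𝓡 n) 𝓘(ℝ, ℝ) ∞ φ) (he : e ∈ atlas (Vec n) M) :
    ContDiffOn ℝ ∞ (fun y => φ (e.symm y)) e.target :=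
  (hφ.comp_contMDiffOn (contMDiffOn_atlas_symm he)).contDiffOn

theorem diff_apply_mfderiv_symm (hφ : ContMDiff (𝓡 n) 𝓘(ℝ, ℝ) ∞ φ) (he : e ∈ atlas (Vec n) M)
    {y : Vec n} (hy : y ∈ e.target) (w : Vec n) :
    diff n φ (e.symm y) (mfderiv 𝓘(ℝ, Vec n) (𝓡 n) e.symm y w) =
      fderiv ℝ (fun y => φ (e.symm y)) y w := by
  have h1 := mfderiv_comp (I := 𝓘(ℝ, Vec n)) (I' := 𝓡 n) (I'' := 𝓘(ℝ, ℝ)) y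
    (hφ.mdifferentiableAt (by simp) (x := e.symm y))
    (((contMDiffOn_atlas_symm he).mdifferentiableOn (by simp)).mdifferentiableAt
      (e.open_target.mem_nhds hy))
  rw [← mfderiv_eq_fderiv]
  exact (congrArg (fun A : Vec n →L[ℝ] ℝ => A w) h1).symm

theorem integrable_mul_of_zero_outside {F χ : Vec n → ℝ} {U Q : Set (Vec n)} (hU : IsOpen U)
    (hQ : IsCompact Q) (hQU : Q ⊆ U) (hF : ContinuousOn F U) (hχ : Continuous χ)
    (h0 : ∀ y ∉ Q, χ y = 0) : Integrable fun y => F y * χ y := by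
  have h1 : Continuous fun y => F y * χ y := by
    rw [← continuousOn_univ]
    refine ContinuousOn.of_zero_outside hU hQ.isClosed hQU ?_ fun y hy => by rw [h0 y hy, mul_zero]
    rw [inter_univ]
    exact hF.mul hχ.continuousOn
  exact h1.integrable_of_hasCompactSupport
    (HasCompactSupport.intro hQ fun y hy => by rw [h0 y hy, mul_zero])

theorem isWeakDifferential_diff (hφ : ContMDiff (𝓡 n) 𝓘(ℝ, ℝ) ∞ φ) :
    IsWeakDifferential φ (diff n φ) := by
  intro e he
  have hf := contDiffOn_comp_symm hφ he
  have hd : ∀ w, ContinuousOn (fun y => fderiv ℝ (fun y => φ (e.symm y)) y w) e.target := fun w =>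
    (hf.continuousOn_fderiv_of_isOpen e.open_target (by simp)).clm_apply continuousOn_const
  refine ⟨hf.continuousOn.locallyIntegrableOn e.open_target.measurableSet, fun w => ⟨?_, ?_⟩⟩
  · have h1 := (hd w).locallyIntegrableOn (μ := volume) e.open_target.measurableSet
    rw [locallyIntegrableOn_iff e.open_target.isLocallyClosed] at h1 ⊢
    exact fun s hs hsc => (h1 s hs hsc).congr_fun
      (fun y hy => (diff_apply_mfderiv_symm hφ he (hs hy) w).symm) hsc.measurableSet
  intro ψ hψ hc ht
  have hset : ∫ y in e.target, diff n φ (e.symm y) (mfderiv 𝓘(ℝ, Vec n) (𝓡 n) e.symm y w) * ψ y =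
      ∫ y in e.target, fderiv ℝ (fun y => φ (e.symm y)) y w * ψ y :=
    setIntegral_congr_fun e.open_target.measurableSet fun y hy =>
      congrArg (· * ψ y) (diff_apply_mfderiv_symm hφ he hy w)
  have hc' := (hψ.continuous_fderiv (by simp)).clm_apply (continuous_const (y := w))
  have hz : ∀ y ∉ tsupport ψ, ψ y = 0 := fun y => image_eq_zero_of_notMem_tsupport
  have hz' : ∀ y ∉ tsupport ψ, fderiv ℝ ψ y w = 0 := fun y hy => by
    rw [fderiv_of_notMem_tsupport ℝ hy]
    rfl
  rw [hset, setIntegral_eq_integral_of_forall_compl_eq_zero (fun y hy => by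
      rw [hz' y fun hy' => hy (ht hy'), mul_zero]),
    setIntegral_eq_integral_of_forall_compl_eq_zero (fun y hy => by
      rw [hz y fun hy' => hy (ht hy'), mul_zero])]
  exact integral_mul_fderiv_eq_neg_fderiv_mul_of_integrable
    (integrable_mul_of_zero_outside e.open_target hc ht (hd w) hψ.continuous hz)
    (integrable_mul_of_zero_outside e.open_target hc ht hf.continuousOn hc' hz')
    (integrable_mul_of_zero_outside e.open_target hc ht hf.continuousOn hψ.continuous hz)
    (fun y hy => (hf.differentiableOn (by simp)).differentiableAt
      (e.open_target.mem_nhds (ht hy)))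
    (fun y _ => hψ.differentiable (by simp) y)

theorem continuousOn_diff_frame (hφ : ContMDiff (𝓡 n) 𝓘(ℝ, ℝ) ∞ φ) (he : e ∈ atlas (Vec n) M)
    (w : Vec n) :
    ContinuousOn (fun x => (diff n φ x : Vec n →L[ℝ] ℝ) (frame e x w)) e.source := by
  have hf := contDiffOn_comp_symm hφ he
  have hd : ContinuousOn (fun y => fderiv ℝ (fun y => φ (e.symm y)) y w) e.target :=
    (hf.continuousOn_fderiv_of_isOpen e.open_target (by simp)).clm_apply continuousOn_const
  refine (hd.comp e.continuousOn e.mapsTo).congr fun x hx => ?_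
  have h1 := diff_apply_mfderiv_symm hφ he (e.map_source hx) w
  have h2 : (diff n φ (e.symm (e x)) : Vec n →L[ℝ] ℝ) = diff n φ x := by rw [e.left_inv hx]
  exact (congrArg (fun A : Vec n →L[ℝ] ℝ => A (frame e x w)) h2).symm.trans h1

variable [MeasurableSpace M] (c : ChartCover n M)

theorem hat_diff_eq (x : M) : c.hat x (diff n φ x) =
    ∑ k, ((diff n φ x : Vec n →L[ℝ] ℝ) (frame (c.chart (c.idx x)) x
      (EuclideanSpace.basisFun (Fin n) ℝ k))) • EuclideanSpace.basisFun (Fin n) ℝ k := by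
  rw [← (EuclideanSpace.basisFun (Fin n) ℝ).sum_repr' (c.hat x (diff n φ x))]
  refine Finset.sum_congr rfl fun k _ => ?_
  rw [real_inner_comm, c.inner_hat]
  rfl

theorem continuousOn_hat_diff_aux (hφ : ContMDiff (𝓡 n) 𝓘(ℝ, ℝ) ∞ φ) (i : ℕ) :
    ContinuousOn (fun x => ∑ k, ((diff n φ x : Vec n →L[ℝ] ℝ) (frame (c.chart i) x
      (EuclideanSpace.basisFun (Fin n) ℝ k))) • EuclideanSpace.basisFun (Fin n) ℝ k) (c.K i) :=
  continuousOn_finsetSum _ fun _ _ =>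
    ((continuousOn_diff_frame hφ (c.chart_mem i) _).mono (c.subset i)).smul continuousOn_const

theorem exists_bound_hat_diff (hφ : ContMDiff (𝓡 n) 𝓘(ℝ, ℝ) ∞ φ) :
    ∃ B : ℝ, ∀ x, ‖c.hat x (diff n φ x)‖ ≤ B :=
  c.exists_bound (fun i => continuousOn_hat_diff_aux c hφ i) fun x => hat_diff_eq c x

theorem measurable_hat_diff [T2Space M] [BorelSpace M] (hφ : ContMDiff (𝓡 n) 𝓘(ℝ, ℝ) ∞ φ) :
    Measurable fun x => c.hat x (diff n φ x) :=
  c.measurable_of_continuousOn (fun i => continuousOn_hat_diff_aux c hφ i) fun x => hat_diff_eq c x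

end Smooth

end HamHeat

/-! ### The energy: convexity, lower semicontinuity, derivatives, subgradients. -/

namespace HamHeat

open FibreLagrangian GradientFlow

section L2

variable {M : Type*} [MeasurableSpace M] {m : Measure M}

theorem inner_toLp_right {φ : M → ℝ} (hφ : MemLp φ 2 m) (u : Lp ℝ 2 m) :
    inner ℝ u (hφ.toLp φ) = ∫ x, u x * φ x ∂m := by
  rw [L2.inner_def]
  refine integral_congr_ae ?_
  filter_upwards [hφ.coeFn_toLp] with x hx
  rw [hx]
  simp [mul_comm]

theorem integrable_coeFn [IsFiniteMeasure m] (u : Lp ℝ 2 m) : Integrable (u : M → ℝ) m :=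
  (Lp.memLp u).integrable one_le_two

theorem memLp_of_continuous [TopologicalSpace M] [CompactSpace M] [OpensMeasurableSpace M]
    [IsFiniteMeasure m] {φ : M → ℝ} (hφ : Continuous φ) : MemLp φ 2 m := by
  obtain ⟨C, hC⟩ := isCompact_univ.exists_bound_of_continuousOn hφ.continuousOn
  exact MemLp.of_bound hφ.measurable.aestronglyMeasurable C
    (Eventually.of_forall fun x => hC x (mem_univ x))

end L2

section Energy

variable {n : ℕ} {M : Type*} [TopologicalSpace M] [ChartedSpace (Vec n) M] [MeasurableSpace M]
  [T2Space M] [CompactSpace M] [BorelSpace M] [IsManifold (𝓡 n) ∞ M] {c : ChartCover n M}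
  {m : Measure M} [IsFiniteMeasure m] (hm : IsPositiveSmoothMeasure n m)
  {L : TangentBundle (𝓡 n) M → ℝ} {u v : Lp ℝ 2 m} {θ η : M → Vec n}

include hm

theorem isWeakPair_weakDiff (hu : WeaklyDifferentiable n (u : M → ℝ)) :
    IsWeakPair c m u fun x => c.hat x (weakDiff n (u : M → ℝ) x) :=
  hu.isWeakPair hm (integrable_coeFn u)

variable {g : RiemMetric n M} (hL : IsLagrangian L) (hH : HamiltonianFinite L)
  (hA : ConditionA g L)

include hL hH

theorem hamiltonian_weakDiff_ae_eq (h : IsWeakPair c m u θ) :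
    (fun x => hamiltonian L (weakDiff n (u : M → ℝ) x)) =ᵐ[m]
      fun x => conj (c.lag L) (c.leg L) x (θ x) := by
  filter_upwards [h.hat_weakDiff_ae_eq hm (integrable_coeFn u)] with x hx
  rw [c.hamiltonian_eq_conj hL hH, hx]

theorem mem_sobolevH_of_isWeakPair (h : IsWeakPair c m u θ)
    (hθ : Integrable (fun x => conj (c.lag L) (c.leg L) x (θ x)) m) : u ∈ sobolevH L m :=
  ⟨h.weaklyDifferentiable hm (integrable_coeFn u),
    hθ.congr (hamiltonian_weakDiff_ae_eq hm hL hH h).symm⟩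

theorem exists_isWeakPair_of_mem_sobolevH (c : ChartCover n M) (hu : u ∈ sobolevH L m) :
    ∃ θ, IsWeakPair c m u θ ∧ Integrable (fun x => conj (c.lag L) (c.leg L) x (θ x)) m ∧
      ∀ x, θ x = c.hat x (weakDiff n (u : M → ℝ) x) :=
  ⟨_, isWeakPair_weakDiff hm hu.1,
    hu.2.congr (hamiltonian_weakDiff_ae_eq hm hL hH (isWeakPair_weakDiff hm hu.1)),
    fun _ => rfl⟩

include hA

theorem energy_eq_of_isWeakPair (h : IsWeakPair c m u θ)
    (hθ : Integrable (fun x => conj (c.lag L) (c.leg L) x (θ x)) m) :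
    energy L m u = ENNReal.ofReal (∫ x, conj (c.lag L) (c.leg L) x (θ x) ∂m) := by
  rw [energy, if_pos (h.weaklyDifferentiable hm (integrable_coeFn u)),
    ofReal_integral_eq_lintegral_ofReal hθ (Eventually.of_forall fun x =>
      (c.fibreLagrangian hL hH hA).conj_nonneg x _)]
  refine lintegral_congr_ae ?_
  filter_upwards [hamiltonian_weakDiff_ae_eq hm hL hH h] with x hx
  rw [hx]

theorem toReal_energy (h : IsWeakPair c m u θ)
    (hθ : Integrable (fun x => conj (c.lag L) (c.leg L) x (θ x)) m) :
    (energy L m u).toReal = ∫ x, conj (c.lag L) (c.leg L) x (θ x) ∂m := by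
  rw [energy_eq_of_isWeakPair hm hL hH hA h hθ, ENNReal.toReal_ofReal]
  exact integral_nonneg fun x => (c.fibreLagrangian hL hH hA).conj_nonneg x _

/-- The energy is a lower integral while `sobolevH` asks for integrability; the gap is the
measurability of `H(du)`, which `FibreLagrangian` provides. -/
theorem energy_ne_top_iff (c : ChartCover n M) : energy L m u ≠ ⊤ ↔ u ∈ sobolevH L m := by
  constructor
  · intro h
    by_cases hw : WeaklyDifferentiable n (u : M → ℝ)
    · refine ⟨hw, ?_⟩
      rw [energy, if_pos hw] at h
      have hp := isWeakPair_weakDiff (c := c) hm hw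
      have h1 : AEStronglyMeasurable (fun x => hamiltonian L (weakDiff n (u : M → ℝ) x)) m :=
        ((c.fibreLagrangian hL hH hA).aestronglyMeasurable_conj_comp hp.1.1).congr
          (hamiltonian_weakDiff_ae_eq hm hL hH hp).symm
      refine ⟨h1, (hasFiniteIntegral_iff_ofReal (Eventually.of_forall fun x => ?_)).2
        (lt_top_iff_ne_top.2 h)⟩
      rw [c.hamiltonian_eq_conj hL hH]
      exact (c.fibreLagrangian hL hH hA).conj_nonneg x _
    · rw [energy, if_neg hw] at h
      exact (h rfl).elim
  · intro hu
    obtain ⟨θ, h, hθ, -⟩ := exists_isWeakPair_of_mem_sobolevH hm hL hH c hu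
    rw [energy_eq_of_isWeakPair hm hL hH hA h hθ]
    exact ENNReal.ofReal_ne_top

theorem convexOn_energy (c : ChartCover n M) :
    ConvexOn ℝ (sobolevH L m) fun u => (energy L m u).toReal := by
  have hfib := c.fibreLagrangian hL hH hA
  have key : ∀ u ∈ sobolevH L m, ∀ v ∈ sobolevH L m, ∀ a b : ℝ, 0 ≤ a → 0 ≤ b → a + b = 1 →
      a • u + b • v ∈ sobolevH L m ∧ (energy L m (a • u + b • v)).toReal ≤
        a • (energy L m u).toReal + b • (energy L m v).toReal := by
    intro u hu v hv a b ha hb hab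
    obtain ⟨θ, hθ, hθi, -⟩ := exists_isWeakPair_of_mem_sobolevH hm hL hH c hu
    obtain ⟨η, hη, hηi, -⟩ := exists_isWeakPair_of_mem_sobolevH hm hL hH c hv
    have hpair : IsWeakPair c m (a • u + b • v : Lp ℝ 2 m) fun x => a • θ x + b • η x := by
      refine ((hθ.const_smul a).add (hη.const_smul b) ((integrable_coeFn u).const_mul a)
        ((integrable_coeFn v).const_mul b)).congr_left ?_
      filter_upwards [Lp.coeFn_add (a • u) (b • v), Lp.coeFn_smul a u, Lp.coeFn_smul b v]
        with x h1 h2 h3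
      rw [h1, Pi.add_apply, h2, h3]
      rfl
    have hle : ∀ x, conj (c.lag L) (c.leg L) x (a • θ x + b • η x) ≤
        a * conj (c.lag L) (c.leg L) x (θ x) + b * conj (c.lag L) (c.leg L) x (η x) := fun x =>
      (hfib.convexOn_conj x).2 (mem_univ _) (mem_univ _) ha hb hab
    have hsum := (hθi.const_mul a).add (hηi.const_mul b)
    have hint : Integrable (fun x => conj (c.lag L) (c.leg L) x (a • θ x + b • η x)) m := by
      refine Integrable.mono' hsum (hfib.aestronglyMeasurable_conj_comp hpair.1.1)
        (Eventually.of_forall fun x => ?_)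
      rw [Real.norm_of_nonneg (hfib.conj_nonneg x _)]
      exact hle x
    refine ⟨mem_sobolevH_of_isWeakPair hm hL hH hpair hint, ?_⟩
    rw [toReal_energy hm hL hH hA hpair hint, toReal_energy hm hL hH hA hθ hθi,
      toReal_energy hm hL hH hA hη hηi, smul_eq_mul, smul_eq_mul, ← integral_const_mul,
      ← integral_const_mul, ← integral_add (hθi.const_mul a) (hηi.const_mul b)]
    exact integral_mono hint hsum hle
  exact ⟨fun u hu v hv a b ha hb hab => (key u hu v hv a b ha hb hab).1,
    fun u hu v hv a b ha hb hab => (key u hu v hv a b ha hb hab).2⟩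

/-- The differentials of a sequence in the sublevel have a weak `L¹` limit, whose energy integral is
still at most `C`. By stability of weak pairs this limit is the differential of the `L²` limit. -/
theorem isClosed_energy_le (c : ChartCover n M) (C : ℝ) :
    IsClosed {u : Lp ℝ 2 m | u ∈ sobolevH L m ∧ (energy L m u).toReal ≤ C} := by
  have hfib := c.fibreLagrangian hL hH hA
  refine isClosed_of_closure_subset fun u hu => ?_
  obtain ⟨u', hu', hlim⟩ := mem_closure_iff_seq_limit.1 hu
  choose θ' hθ' hθi' _ using fun k => exists_isWeakPair_of_mem_sobolevH hm hL hH c (hu' k).1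
  have hle : ∀ k, ∫ x, conj (c.lag L) (c.leg L) x (θ' k x) ∂m ≤ C := fun k => by
    rw [← toReal_energy hm hL hH hA (hθ' k) (hθi' k)]
    exact (hu' k).2
  obtain ⟨θ, hθ, hweak, hθi, hθC⟩ := hfib.exists_weak_limit (hyperfilter ℕ) (fun k => (hθ' k).1)
    hθi' hle
  have hpair : IsWeakPair c m u θ := by
    refine IsWeakPair.of_tendsto hθ' hθ (fun φ hφ => ?_) hweak
    have h1 := (hlim.mono_left Nat.hyperfilter_le_atTop).inner (𝕜 := ℝ)
      (tendsto_const_nhds (x := (memLp_of_continuous (m := m) hφ).toLp φ))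
    simpa only [inner_toLp_right] using h1
  exact ⟨mem_sobolevH_of_isWeakPair hm hL hH hpair hθi, by
    rwa [toReal_energy hm hL hH hA hpair hθi]⟩

theorem isImplicitStep_iff (c : ChartCover n M) {δ : ℝ} (hδ : 0 < δ) :
    IsImplicitStep L m δ u v ↔
      IsStep (sobolevH L m) (fun u => (energy L m u).toReal) δ u v := by
  have key : ∀ w ∈ sobolevH L m, energy L m w + ENNReal.ofReal (‖w - u‖ ^ 2 / (2 * δ)) =
      ENNReal.ofReal ((energy L m w).toReal + ‖w - u‖ ^ 2 / (2 * δ)) := by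
    intro w hw
    rw [ENNReal.ofReal_add ENNReal.toReal_nonneg (by positivity), ENNReal.ofReal_toReal
      ((energy_ne_top_iff hm hL hH hA c).2 hw)]
  refine and_congr_right fun hv => forall₂_congr fun w hw => ?_
  rw [key v hv, key w hw, ENNReal.ofReal_le_ofReal_iff]
  exact add_nonneg ENNReal.toReal_nonneg (by positivity)

theorem isWeakPair_add_smul (hu : IsWeakPair c m u θ) (hv : IsWeakPair c m v η) (s : ℝ) :
    IsWeakPair c m (u + s • v : Lp ℝ 2 m) fun x => θ x + s • η x := by
  refine (hu.add (hv.const_smul s) (integrable_coeFn u)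
    ((integrable_coeFn v).const_mul s)).congr_left ?_
  filter_upwards [Lp.coeFn_add u (s • v), Lp.coeFn_smul s v] with x h1 h2
  rw [h1, Pi.add_apply, h2]
  rfl

/-- By linear growth of the Legendre transform, a bounded change of `du` changes `H(du)` by at most
a multiple of `1 + |du|`, which is integrable. -/
theorem add_smul_mem_sobolevH (hu : u ∈ sobolevH L m) (hv : IsWeakPair c m v η)
    (hη : ∃ B : ℝ, ∀ x, ‖η x‖ ≤ B) (s : ℝ) : u + s • v ∈ sobolevH L m := by
  obtain ⟨θ, hθ, hθi, -⟩ := exists_isWeakPair_of_mem_sobolevH hm hL hH c hu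
  obtain ⟨B, hB⟩ := hη
  refine mem_sobolevH_of_isWeakPair hm hL hH (isWeakPair_add_smul hm hL hH hA hθ hv s) ?_
  refine (c.fibreLagrangian hL hH hA).integrable_conj_add hθ.1 hθi (hv.1.1.const_smul s)
    (B := |s| * B) fun x => ?_
  rw [norm_smul, Real.norm_eq_abs]
  exact mul_le_mul_of_nonneg_left (hB x) (abs_nonneg s)

theorem tendsto_slope_energy (hu : u ∈ sobolevH L m) (hv : IsWeakPair c m v η)
    (hη : ∃ B : ℝ, ∀ x, ‖η x‖ ≤ B) :
    Tendsto (fun s : ℝ => ((energy L m (u + s • v)).toReal - (energy L m u).toReal) / s)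
      (𝓝[>] 0)
      (𝓝 (∫ x, inner ℝ (η x) (c.leg L x (c.hat x (weakDiff n (u : M → ℝ) x))) ∂m)) := by
  obtain ⟨θ, hθ, hθi, hθe⟩ := exists_isWeakPair_of_mem_sobolevH hm hL hH c hu
  obtain ⟨B, hB⟩ := hη
  have h1 := (c.fibreLagrangian hL hH hA).tendsto_slope_integral_conj hθ.1 hθi hv.1.1 hB
  simp only [← hθe]
  refine h1.congr fun s => ?_
  have hpair := isWeakPair_add_smul hm hL hH hA hθ hv s
  have hint : Integrable (fun x => conj (c.lag L) (c.leg L) x (θ x + s • η x)) m := by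
    refine (c.fibreLagrangian hL hH hA).integrable_conj_add hθ.1 hθi (hv.1.1.const_smul s)
      (B := |s| * B) fun x => ?_
    rw [norm_smul, Real.norm_eq_abs]
    exact mul_le_mul_of_nonneg_left (hB x) (abs_nonneg s)
  rw [toReal_energy hm hL hH hA hpair hint, toReal_energy hm hL hH hA hθ hθi]

/-- A subgradient of the energy represents its derivative in bounded directions. -/
theorem inner_subgradient {ξ : Lp ℝ 2 m}
    (hξ : IsSubgradient (sobolevH L m) (fun u => (energy L m u).toReal) u ξ)
    (hv : IsWeakPair c m v η) (hη : ∃ B : ℝ, ∀ x, ‖η x‖ ≤ B) :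
    inner ℝ ξ v =
      ∫ x, inner ℝ (η x) (c.leg L x (c.hat x (weakDiff n (u : M → ℝ) x))) ∂m := by
  -- The subgradient inequality along `u + s v`, divided by `s`, gives one inequality. The right
  -- side is linear in `η`, so the same bound for `-v` is the reverse inequality.
  have key : ∀ (v : Lp ℝ 2 m) (η : M → Vec n), IsWeakPair c m v η → (∃ B : ℝ, ∀ x, ‖η x‖ ≤ B) →
      inner ℝ ξ v ≤
        ∫ x, inner ℝ (η x) (c.leg L x (c.hat x (weakDiff n (u : M → ℝ) x))) ∂m := by
    intro v η hv hη
    refine ge_of_tendsto (tendsto_slope_energy hm hL hH hA hξ.1 hv hη) ?_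
    filter_upwards [self_mem_nhdsWithin] with s hs
    have h1 := hξ.2 _ (add_smul_mem_sobolevH hm hL hH hA hξ.1 hv hη s)
    rw [add_sub_cancel_left, real_inner_smul_right] at h1
    rw [le_div_iff₀ hs]
    linarith
  refine le_antisymm (key v η hv hη) ?_
  have hpair : IsWeakPair c m (-v : Lp ℝ 2 m) fun x => (-1 : ℝ) • η x := by
    refine (hv.const_smul (-1)).congr_left ?_
    filter_upwards [Lp.coeFn_neg v] with x hx
    rw [hx, Pi.neg_apply, neg_one_mul]
  have h2 := key (-v) _ hpair (by
    obtain ⟨B, hB⟩ := hη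
    exact ⟨B, fun x => by rw [neg_one_smul, norm_neg]; exact hB x⟩)
  simp only [neg_one_smul, inner_neg_left, inner_neg_right, integral_neg] at h2
  linarith

/-- Testing the subgradient with `(1 - s) u` bounds the decrease of the energy by `s ⟨ξ, u⟩`, which
is the finite rate needed in `integrable_comp_argmax`. -/
theorem mem_sobolevL_of_isSubgradient (c : ChartCover n M) {ξ : Lp ℝ 2 m}
    (hξ : IsSubgradient (sobolevH L m) (fun u => (energy L m u).toReal) u ξ) :
    u ∈ sobolevL L m := by
  obtain ⟨θ, hθ, hθi, hθe⟩ := exists_isWeakPair_of_mem_sobolevH hm hL hH c hξ.1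
  refine ⟨hξ.1.1, ?_⟩
  have h1 := (c.fibreLagrangian hL hH hA).integrable_comp_argmax hθ.1 hθi (K := inner ℝ ξ u)
    fun s hs hs1 hint => by
      have hpair : IsWeakPair c m ((1 - s) • u : Lp ℝ 2 m) fun x => (1 - s) • θ x := by
        refine (hθ.const_smul (1 - s)).congr_left ?_
        filter_upwards [Lp.coeFn_smul (1 - s) u] with x hx
        rw [hx]
        rfl
      have h2 := hξ.2 _ (mem_sobolevH_of_isWeakPair hm hL hH hpair hint)
      simp only at h2
      rw [toReal_energy hm hL hH hA hpair hint, toReal_energy hm hL hH hA hθ hθi, sub_smul,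
        one_smul, sub_sub_cancel_left, inner_neg_right, real_inner_smul_right] at h2
      linarith
  refine h1.congr (Eventually.of_forall fun x => ?_)
  simp only
  rw [ChartCover.lag, hθe, c.T_leg]
  rfl

end Energy

end HamHeat

namespace GradientFlow

/-! Slopes and gradient vectors of convex functions on a Hilbert space. -/

variable {H : Type*} [NormedAddCommGroup H] [InnerProductSpace ℝ H] {E : H → ℝ≥0∞} {D : Set H}

/-- The difference quotients that define the rate of descent of `E` at `u` in the direction `v`. -/
noncomputable def descentQuotient (E : H → ℝ≥0∞) (u v : H) (s : ℝ) : EReal :=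
  ((E u : EReal) - (E (u + s • v) : EReal)) / ((s * ‖v‖ : ℝ) : EReal)

theorem coe_sub_div_eq {a b : ℝ≥0∞} (ha : a ≠ ⊤) (hb : b ≠ ⊤) (r : ℝ) :
    ((a : EReal) - (b : EReal)) / (r : EReal) = (((a.toReal - b.toReal) / r : ℝ) : EReal) := by
  rw [← EReal.coe_ennreal_toReal ha, ← EReal.coe_ennreal_toReal hb, EReal.coe_div, EReal.coe_sub]

variable (hD : ∀ v, E v ≠ ⊤ ↔ v ∈ D) {u ξ : H}
  (hξ : IsSubgradient D (fun v => (E v).toReal) u ξ)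

include hD hξ

theorem descentQuotient_eq {v : H} {s : ℝ} (hv : u + s • v ∈ D) : descentQuotient E u v s =
    (((E u).toReal - (E (u + s • v)).toReal) / (s * ‖v‖) : ℝ) :=
  coe_sub_div_eq ((hD u).2 hξ.1) ((hD _).2 hv) _

theorem descentQuotient_eq_bot {v : H} (hv : v ≠ 0) {s : ℝ} (hs : 0 < s) (hvD : u + s • v ∉ D) :
    descentQuotient E u v s = ⊥ := by
  have h1 : E (u + s • v) = ⊤ := by
    by_contra h
    exact hvD ((hD _).1 h)
  rw [descentQuotient, h1, EReal.coe_ennreal_top, EReal.sub_top]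
  exact EReal.bot_div_of_pos_ne_top
    (EReal.coe_pos.2 (mul_pos hs (norm_pos_iff.2 hv))) (EReal.coe_ne_top _)

theorem descentQuotient_le {v : H} (hv : v ≠ 0) {s : ℝ} (hs : 0 < s) :
    descentQuotient E u v s ≤ ((-inner ℝ ξ v / ‖v‖ : ℝ) : EReal) := by
  by_cases hvD : u + s • v ∈ D
  · rw [descentQuotient_eq hD hξ hvD, EReal.coe_le_coe_iff]
    have h1 := hξ.2 _ hvD
    have hv' := norm_pos_iff.2 hv
    rw [add_sub_cancel_left, real_inner_smul_right] at h1
    rw [div_le_div_iff₀ (mul_pos hs hv') hv']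
    have h2 : ((E u).toReal - (E (u + s • v)).toReal) ≤ - (s * inner ℝ ξ v) := by linarith
    calc _ ≤ - (s * inner ℝ ξ v) * ‖v‖ := mul_le_mul_of_nonneg_right h2 hv'.le
      _ = _ := by ring
  · rw [descentQuotient_eq_bot hD hξ hv hs hvD]
    exact bot_le

/-- Difference quotients of a convex function are monotone; outside the domain they are `⊥`,
consistently with this. Hence a rate of descent, possibly `⊥`, exists in every nonzero direction. -/
theorem antitoneOn_descentQuotient (hF : ConvexOn ℝ D fun v => (E v).toReal) {v : H}
    (hv : v ≠ 0) : AntitoneOn (descentQuotient E u v) (Ioi 0) := by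
  intro s (hs : 0 < s) t (ht : 0 < t) hst
  by_cases hvD : u + t • v ∈ D
  · have h0 : 0 ≤ 1 - s / t := by
      rw [sub_nonneg, div_le_one ht]
      exact hst
    have h1 : 0 ≤ s / t := by positivity
    have heq : (1 - s / t) • u + (s / t) • (u + t • v) = u + s • v := by
      rw [smul_add, smul_smul, div_mul_cancel₀ _ ht.ne', sub_smul, one_smul]
      abel
    have hvD' : u + s • v ∈ D := by
      rw [← heq]
      exact hF.1 hξ.1 hvD h0 h1 (by ring)
    have hle := hF.2 hξ.1 hvD h0 h1 (by ring)
    simp only [heq, smul_eq_mul] at hle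
    rw [descentQuotient_eq hD hξ hvD, descentQuotient_eq hD hξ hvD', EReal.coe_le_coe_iff]
    have hv' := norm_pos_iff.2 hv
    rw [div_le_div_iff₀ (mul_pos ht hv') (mul_pos hs hv')]
    have h2 : t * (E (u + s • v)).toReal ≤ (t - s) * (E u).toReal + s * (E (u + t • v)).toReal := by
      calc t * (E (u + s • v)).toReal
          ≤ t * ((1 - s / t) * (E u).toReal + s / t * (E (u + t • v)).toReal) :=
            mul_le_mul_of_nonneg_left hle ht.le
        _ = _ := by field_simp
    have h3 : ((E u).toReal - (E (u + t • v)).toReal) * s ≤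
        ((E u).toReal - (E (u + s • v)).toReal) * t := by linarith
    calc _ = ((E u).toReal - (E (u + t • v)).toReal) * s * ‖v‖ := by ring
      _ ≤ ((E u).toReal - (E (u + s • v)).toReal) * t * ‖v‖ :=
        mul_le_mul_of_nonneg_right h3 hv'.le
      _ = _ := by ring
  · rw [descentQuotient_eq_bot hD hξ hv ht hvD]
    exact bot_le

theorem exists_tendsto_descentQuotient (hF : ConvexOn ℝ D fun v => (E v).toReal) {v : H}
    (hv : v ≠ 0) : ∃ r, Tendsto (descentQuotient E u v) (𝓝[>] 0) (𝓝 r) :=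
  ⟨_, (antitoneOn_descentQuotient hD hξ hF hv).tendsto_nhdsGT (OrderTop.bddAbove _)⟩

variable {S : Set H} (hS : Dense S) (hSD : ∀ Φ ∈ S, ∀ s : ℝ, u + s • Φ ∈ D)
  (hSt : ∀ Φ ∈ S, Tendsto (fun s : ℝ => ((E (u + s • Φ)).toReal - (E u).toReal) / s) (𝓝[>] 0)
    (𝓝 (inner ℝ ξ Φ)))

include hS hSD hSt

theorem tendsto_descentQuotient {Φ : H} (hΦ : Φ ∈ S) :
    Tendsto (descentQuotient E u Φ) (𝓝[>] 0) (𝓝 ((-inner ℝ ξ Φ / ‖Φ‖ : ℝ) : EReal)) := by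
  have h1 : Tendsto (fun s : ℝ => -(((E (u + s • Φ)).toReal - (E u).toReal) / s) / ‖Φ‖) (𝓝[>] 0)
      (𝓝 (-inner ℝ ξ Φ / ‖Φ‖)) := ((hSt Φ hΦ).neg).div_const _
  refine ((continuous_coe_real_ereal.tendsto _).comp h1).congr fun s => ?_
  rw [descentQuotient_eq hD hξ (hSD Φ hΦ s), Function.comp_apply, div_mul_eq_div_div, ← neg_div,
    neg_sub]

theorem limsup_inner_div_norm {w : H} (hw : w ≠ 0) :
    limsup (fun v => ((-inner ℝ ξ v / ‖v‖ : ℝ) : EReal)) (𝓝[S] w) =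
      ((-inner ℝ ξ w / ‖w‖ : ℝ) : EReal) := by
  have : (𝓝[S] w).NeBot := mem_closure_iff_nhdsWithin_neBot.1 (hS w)
  refine Tendsto.limsup_eq ?_
  have hc : ContinuousAt (fun v : H => -inner ℝ ξ v / ‖v‖) w :=
    (ContinuousAt.div (by fun_prop) (by fun_prop) (norm_ne_zero_iff.2 hw))
  exact ((continuous_coe_real_ereal.tendsto _).comp hc.tendsto).mono_left nhdsWithin_le_nhds

theorem neg_inner_neg_div_norm (hξ0 : ξ ≠ 0) : -inner ℝ ξ (-ξ) / ‖-ξ‖ = ‖ξ‖ := by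
  have := norm_ne_zero_iff.2 hξ0
  rw [inner_neg_right, neg_neg, norm_neg, real_inner_self_eq_norm_sq]
  field_simp

/-- The subgradient inequality and Cauchy–Schwarz bound the slope by `‖ξ‖`. The optimal direction
`-ξ` may leave the domain, so for the reverse bound it is approached by directions in the dense set
`S`, where the rate of descent is `-⟨ξ, Φ⟩ / ‖Φ‖`. -/
theorem max_limsup_eq_norm :
    max (limsup (fun v : H => ((E u : EReal) - (E v : EReal)) / ((‖v - u‖ : ℝ) : EReal))
      (𝓝[D \ {u}] u)) 0 = ((‖ξ‖ : ℝ) : EReal) := by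
  refine le_antisymm (max_le (limsup_le_of_le (by isBoundedDefault) ?_)
    (EReal.coe_nonneg.2 (norm_nonneg _))) ?_
  · filter_upwards [self_mem_nhdsWithin] with v hv
    rw [coe_sub_div_eq ((hD u).2 hξ.1) ((hD v).2 hv.1), EReal.coe_le_coe_iff]
    have hv' : 0 < ‖v - u‖ := norm_pos_iff.2 (sub_ne_zero.2 hv.2)
    rw [div_le_iff₀ hv']
    have h1 := hξ.2 v hv.1
    have h2 := neg_le_of_abs_le (abs_real_inner_le_norm ξ (v - u))
    simp only at h1
    linarith
  rcases eq_or_ne ξ 0 with h0 | h0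
  · rw [h0, norm_zero]
    exact le_max_right _ _
  refine le_trans ?_ (le_max_left _ _)
  rw [← neg_inner_neg_div_norm hD hξ hS hSD hSt h0,
    ← limsup_inner_div_norm hD hξ hS hSD hSt (neg_ne_zero.2 h0)]
  refine limsup_le_of_le (by isBoundedDefault) ?_
  filter_upwards [self_mem_nhdsWithin,
    nhdsWithin_le_nhds (isOpen_ne.mem_nhds (neg_ne_zero.2 h0))] with Φ hΦ hΦ0
  have h1 := tendsto_descentQuotient hD hξ hS hSD hSt hΦ
  have h2 : Tendsto (fun s : ℝ => u + s • Φ) (𝓝[>] 0) (𝓝[D \ {u}] u) := by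
    refine tendsto_nhdsWithin_iff.2 ⟨?_, ?_⟩
    · have : Tendsto (fun s : ℝ => u + s • Φ) (𝓝 0) (𝓝 (u + (0 : ℝ) • Φ)) :=
        Continuous.tendsto (by fun_prop) 0
      rw [zero_smul, add_zero] at this
      exact this.mono_left nhdsWithin_le_nhds
    · filter_upwards [self_mem_nhdsWithin] with s hs
      refine ⟨hSD Φ hΦ s, fun h => ?_⟩
      have h3 : s • Φ = 0 := by simpa using h
      exact (smul_eq_zero.1 h3).elim (ne_of_gt hs) hΦ0
  rw [← h1.limsup_eq]
  refine le_trans (le_of_eq ?_) (limsup_le_limsup_of_le h2 (by isBoundedDefault)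
    (by isBoundedDefault))
  refine limsup_congr ?_
  filter_upwards [self_mem_nhdsWithin] with s hs
  simp only [descentQuotient, add_sub_cancel_left]
  rw [norm_smul, Real.norm_of_nonneg (le_of_lt hs)]

theorem isGradient_iff (hF : ConvexOn ℝ D fun v => (E v).toReal) (w : H) :
    ((((‖ξ‖ : ℝ) : EReal) = 0 ∧ w = 0) ∨
      (0 < ((‖ξ‖ : ℝ) : EReal) ∧ ((‖ξ‖ : ℝ) : EReal) < ⊤ ∧
        ((‖w‖ : ℝ) : EReal) = ((‖ξ‖ : ℝ) : EReal) ∧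
        ∃ r : H → EReal, (∀ v, v ≠ 0 → Tendsto (descentQuotient E u v) (𝓝[>] 0) (𝓝 (r v))) ∧
          limsup r (𝓝 w) = ((‖ξ‖ : ℝ) : EReal))) ↔ w = -ξ := by
  -- Every rate of descent is at most `-⟨ξ, v⟩ / ‖v‖`, which is continuous in `v ≠ 0`.
  have hup : ∀ r : H → EReal,
      (∀ v, v ≠ 0 → Tendsto (descentQuotient E u v) (𝓝[>] 0) (𝓝 (r v))) → ∀ w, w ≠ 0 →
      limsup r (𝓝 w) ≤ ((-inner ℝ ξ w / ‖w‖ : ℝ) : EReal) := by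
    intro r hr w hw
    have hc : ContinuousAt (fun v : H => -inner ℝ ξ v / ‖v‖) w :=
      (ContinuousAt.div (by fun_prop) (by fun_prop) (norm_ne_zero_iff.2 hw))
    rw [← ((continuous_coe_real_ereal.tendsto _).comp hc.tendsto).limsup_eq]
    refine limsup_le_limsup ?_ (by isBoundedDefault) (by isBoundedDefault)
    filter_upwards [isOpen_ne.mem_nhds hw] with v hv
    refine le_of_tendsto (hr v hv) ?_
    filter_upwards [self_mem_nhdsWithin] with s hs
    exact descentQuotient_le hD hξ hv hs
  constructor
  · rintro (⟨h0, rfl⟩ | ⟨h0, -, hw, r, hr, hlim⟩)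
    · rw [norm_eq_zero.1 (EReal.coe_eq_zero.1 h0), neg_zero]
    · have hw' : ‖w‖ = ‖ξ‖ := EReal.coe_eq_coe_iff.1 hw
      have hpos : 0 < ‖w‖ := by
        rw [hw']
        exact EReal.coe_pos.1 h0
      have h1 := hup r hr w (norm_pos_iff.1 hpos)
      rw [hlim, EReal.coe_le_coe_iff, le_div_iff₀ hpos, hw'] at h1
      -- Here `‖w‖ = ‖ξ‖` and `-⟨ξ, w⟩ ≥ ‖ξ‖²`: the case of equality in Cauchy–Schwarz, which forces
      -- `w = -ξ`.
      have h2 : ‖w + ξ‖ ^ 2 ≤ 0 := by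
        rw [norm_add_sq_real, hw', real_inner_comm]
        nlinarith
      have h3 : ‖w + ξ‖ = 0 := by
        have := norm_nonneg (w + ξ)
        nlinarith
      exact eq_neg_of_add_eq_zero_left (norm_eq_zero.1 h3)
  · rintro rfl
    rcases eq_or_ne ξ 0 with h0 | h0
    · left
      simp [h0]
    · right
      refine ⟨EReal.coe_pos.2 (norm_pos_iff.2 h0), EReal.coe_lt_top _, by rw [norm_neg], ?_⟩
      choose! r hr using fun v => exists_tendsto_descentQuotient hD hξ hF (v := v)
      refine ⟨r, hr, le_antisymm ?_ ?_⟩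
      · rw [← neg_inner_neg_div_norm hD hξ hS hSD hSt h0]
        exact hup r hr _ (neg_ne_zero.2 h0)
      · rw [← neg_inner_neg_div_norm hD hξ hS hSD hSt h0,
          ← limsup_inner_div_norm hD hξ hS hSD hSt (neg_ne_zero.2 h0)]
        refine le_trans (le_of_eq (limsup_congr ?_)) (limsup_le_limsup_of_le nhdsWithin_le_nhds
          (by isBoundedDefault) (by isBoundedDefault))
        filter_upwards [self_mem_nhdsWithin,
          nhdsWithin_le_nhds (isOpen_ne.mem_nhds (neg_ne_zero.2 h0))] with Φ hΦ hΦ0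
        exact tendsto_nhds_unique (tendsto_descentQuotient hD hξ hS hSD hSt hΦ) (hr Φ hΦ0)

end GradientFlow

/-! ### Smooth directions are dense; subgradient, Laplacian, slope and gradient vector. -/

namespace HamHeat

open FibreLagrangian GradientFlow

section SmoothL2

variable {n : ℕ} {M : Type*} [TopologicalSpace M] [ChartedSpace (Vec n) M] [MeasurableSpace M]
  [T2Space M] [CompactSpace M] [BorelSpace M] [IsManifold (𝓡 n) ∞ M]
  {m : Measure M} [IsFiniteMeasure m]

theorem inner_continuousMap_toLp (u : Lp ℝ 2 m) (Φ : C(M, ℝ)) :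
    inner ℝ u (ContinuousMap.toLp 2 m ℝ Φ) = ∫ x, u x * Φ x ∂m := by
  rw [L2.inner_def]
  refine integral_congr_ae ?_
  filter_upwards [ContinuousMap.coeFn_toLp (p := 2) m (𝕜 := ℝ) Φ] with x hx
  rw [hx]
  simp [mul_comm]

/-- The smooth functions, as a subspace of `L²`. -/
noncomputable def smoothL2 (n : ℕ) {M : Type*} [TopologicalSpace M] [ChartedSpace (Vec n) M]
    [MeasurableSpace M] [CompactSpace M] [BorelSpace M] (m : Measure M) [IsFiniteMeasure m] :
    Submodule ℝ (Lp ℝ 2 m) where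
  carrier := {v | ∃ Φ : C(M, ℝ), ContMDiff (𝓡 n) 𝓘(ℝ, ℝ) ∞ Φ ∧ ContinuousMap.toLp 2 m ℝ Φ = v}
  zero_mem' := ⟨0, contMDiff_const, map_zero _⟩
  add_mem' := by
    rintro _ _ ⟨Φ, hΦ, rfl⟩ ⟨Ψ, hΨ, rfl⟩
    exact ⟨Φ + Ψ, hΦ.add hΨ, map_add _ _ _⟩
  smul_mem' := by
    rintro r _ ⟨Φ, hΦ, rfl⟩
    exact ⟨r • Φ, (contMDiff_const (c := r)).mul hΦ, map_smul _ _ _⟩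

/-- A function orthogonal to all smooth functions vanishes almost everywhere, so the orthogonal
complement is trivial. -/
theorem dense_smoothL2 : Dense (smoothL2 n m : Set (Lp ℝ 2 m)) := by
  rw [Submodule.dense_iff_topologicalClosure_eq_top, Submodule.topologicalClosure_eq_top_iff,
    Submodule.eq_bot_iff]
  intro u hu
  have h1 : ∀ᵐ x ∂m, u x = 0 := by
    refine ae_eq_zero_of_integral_contMDiff_smul_eq_zero (𝓡 n)
      (integrable_coeFn u).locallyIntegrable fun φ hφ _ => ?_
    have h2 := (Submodule.mem_orthogonal' _ _).1 hu _ ⟨⟨φ, hφ.continuous⟩, hφ, rfl⟩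
    rw [inner_continuousMap_toLp] at h2
    simpa [mul_comm] using h2
  refine Lp.ext ?_
  filter_upwards [h1, Lp.coeFn_zero ℝ 2 m] with x hx hx'
  rw [hx, hx', Pi.zero_apply]

theorem isWeakPair_smooth (c : ChartCover n M) (hm : IsPositiveSmoothMeasure n m) {Φ : C(M, ℝ)}
    (hΦ : ContMDiff (𝓡 n) 𝓘(ℝ, ℝ) ∞ Φ) :
    IsWeakPair c m (ContinuousMap.toLp 2 m ℝ Φ : Lp ℝ 2 m) fun x => c.hat x (diff n Φ x) := by
  have hi : Integrable Φ m := (memLp_of_continuous Φ.continuous).integrable one_le_two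
  exact ((isWeakDifferential_iff c hm hi).1 (isWeakDifferential_diff hΦ)).congr_left
    (ContinuousMap.coeFn_toLp (p := 2) m (𝕜 := ℝ) Φ).symm

variable {L : TangentBundle (𝓡 n) M → ℝ}

theorem inner_hat_leg (c : ChartCover n M) (φ : M → ℝ) (u : M → ℝ) (x : M) :
    inner ℝ (c.hat x (diff n φ x)) (c.leg L x (c.hat x (weakDiff n u x))) =
      diff n φ x (grad L u x) := by
  rw [c.inner_hat, c.T_leg]
  rfl

variable (hm : IsPositiveSmoothMeasure n m) (hL : IsLagrangian L) (hH : HamiltonianFinite L)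
  {g : RiemMetric n M} (hA : ConditionA g L) (c : ChartCover n M) {u ξ : Lp ℝ 2 m}

include hm hL hH hA c

theorem integrable_diff_grad (hu : u ∈ sobolevH L m) {φ : M → ℝ}
    (hφ : ContMDiff (𝓡 n) 𝓘(ℝ, ℝ) ∞ φ) :
    Integrable (fun x => diff n φ x (grad L (u : M → ℝ) x)) m := by
  obtain ⟨B, hB⟩ := exists_bound_hat_diff c hφ
  have h1 := (c.fibreLagrangian hL hH hA).integrable_argmax_inner
    (isWeakPair_weakDiff (c := c) hm hu.1).1 (measurable_hat_diff c hφ).aestronglyMeasurable hB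
  simpa only [inner_hat_leg] using h1

variable (hξ : IsSubgradient (sobolevH L m) (fun u => (energy L m u).toReal) u ξ)

include hξ

theorem inner_subgradient_smooth {Φ : C(M, ℝ)} (hΦ : ContMDiff (𝓡 n) 𝓘(ℝ, ℝ) ∞ Φ) :
    inner ℝ ξ (ContinuousMap.toLp 2 m ℝ Φ) =
      ∫ x, diff n Φ x (grad L (u : M → ℝ) x) ∂m := by
  rw [inner_subgradient hm hL hH hA hξ (isWeakPair_smooth c hm hΦ) (exists_bound_hat_diff c hΦ)]
  simp only [inner_hat_leg]

/-- The pairing of a subgradient with a smooth `Φ` is `∫ dΦ(∇u)`, which does not involve the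
subgradient; density then gives uniqueness. -/
theorem isSubgradient_energy_iff (ζ : Lp ℝ 2 m) :
    IsSubgradient (sobolevH L m) (fun u => (energy L m u).toReal) u ζ ↔ ζ = ξ := by
  refine ⟨fun hζ => ?_, fun h => h ▸ hξ⟩
  refine dense_smoothL2.eq_of_inner_left (𝕜 := ℝ) (S := (smoothL2 n m : Set (Lp ℝ 2 m))) ?_
  rintro _ ⟨Φ, hΦ, rfl⟩
  rw [inner_subgradient_smooth hm hL hH hA c hζ hΦ, inner_subgradient_smooth hm hL hH hA c hξ hΦ]

theorem hasLaplacianDensity_iff (f : Lp ℝ 2 m) : HasLaplacianDensity L m u f ↔ f = -ξ := by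
  constructor
  · intro h
    refine dense_smoothL2.eq_of_inner_left (𝕜 := ℝ) (S := (smoothL2 n m : Set (Lp ℝ 2 m))) ?_
    rintro _ ⟨Φ, hΦ, rfl⟩
    rw [inner_neg_left, inner_subgradient_smooth hm hL hH hA c hξ hΦ, inner_continuousMap_toLp,
      ← (h Φ hΦ).2.2]
    simp only [mul_comm]
  · rintro rfl φ hφ
    refine ⟨integrable_diff_grad hm hL hH hA c hξ.1 hφ, ?_, ?_⟩
    · obtain ⟨C, hC⟩ := isCompact_univ.exists_bound_of_continuousOn hφ.continuous.continuousOn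
      exact (integrable_coeFn _).bdd_mul hφ.continuous.measurable.aestronglyMeasurable
        (Eventually.of_forall fun x => hC x (mem_univ x))
    · have h1 := inner_subgradient_smooth hm hL hH hA c hξ (Φ := ⟨φ, hφ.continuous⟩) hφ
      rw [ContinuousMap.coe_mk] at h1
      rw [← h1, ← inner_neg_left, inner_continuousMap_toLp]
      simp only [mul_comm, ContinuousMap.coe_mk]

theorem add_smul_mem_of_smooth : ∀ Φ ∈ (smoothL2 n m : Set (Lp ℝ 2 m)), ∀ s : ℝ,
    u + s • Φ ∈ sobolevH L m := by
  rintro _ ⟨Φ, hΦ, rfl⟩ s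
  exact add_smul_mem_sobolevH hm hL hH hA hξ.1 (isWeakPair_smooth c hm hΦ)
    (exists_bound_hat_diff c hΦ) s

theorem tendsto_slope_of_smooth : ∀ Φ ∈ (smoothL2 n m : Set (Lp ℝ 2 m)),
    Tendsto (fun s : ℝ => ((energy L m (u + s • Φ)).toReal - (energy L m u).toReal) / s) (𝓝[>] 0)
      (𝓝 (inner ℝ ξ Φ)) := by
  rintro _ ⟨Φ, hΦ, rfl⟩
  rw [inner_subgradient hm hL hH hA hξ (isWeakPair_smooth c hm hΦ) (exists_bound_hat_diff c hΦ)]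
  exact tendsto_slope_energy hm hL hH hA hξ.1 (isWeakPair_smooth c hm hΦ)
    (exists_bound_hat_diff c hΦ)

theorem slope_eq_norm : slope L m u = ((‖ξ‖ : ℝ) : EReal) :=
  max_limsup_eq_norm (fun _ => energy_ne_top_iff hm hL hH hA c) hξ dense_smoothL2
    (add_smul_mem_of_smooth hm hL hH hA c hξ) (tendsto_slope_of_smooth hm hL hH hA c hξ)

theorem isGradientVector_iff (w : Lp ℝ 2 m) : IsGradientVector L m u w ↔ w = -ξ := by
  have h1 := isGradient_iff (fun _ => energy_ne_top_iff hm hL hH hA c) hξ dense_smoothL2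
    (add_smul_mem_of_smooth hm hL hH hA c hξ) (tendsto_slope_of_smooth hm hL hH hA c hξ)
    (convexOn_energy hm hL hH hA c) w
  rw [← h1, IsGradientVector, slope_eq_norm hm hL hH hA c hξ]
  exact and_iff_right hξ.1

end SmoothL2

/-! ### Space-time test functions as curves of functions on `M`. -/

section SpaceTime

variable {n : ℕ} {M : Type*} [TopologicalSpace M] [ChartedSpace (Vec n) M]
  [IsManifold (𝓡 n) ∞ M] {φ : ℝ × M → ℝ}

theorem contMDiff_slice (hφ : ContMDiff (𝓘(ℝ, ℝ).prod (𝓡 n)) 𝓘(ℝ, ℝ) ∞ φ) (t : ℝ) :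
    ContMDiff (𝓡 n) 𝓘(ℝ, ℝ) ∞ fun x => φ (t, x) :=
  hφ.comp (contMDiff_const.prodMk contMDiff_id)

theorem contDiff_time (hφ : ContMDiff (𝓘(ℝ, ℝ).prod (𝓡 n)) 𝓘(ℝ, ℝ) ∞ φ) (x : M) :
    ContDiff ℝ ∞ fun t => φ (t, x) :=
  (hφ.comp (contMDiff_id.prodMk contMDiff_const)).contDiff

theorem continuous_deriv_time (hφ : ContMDiff (𝓘(ℝ, ℝ).prod (𝓡 n)) 𝓘(ℝ, ℝ) ∞ φ) :
    Continuous fun p : ℝ × M => deriv (fun s => φ (s, p.2)) p.1 := by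
  rw [continuous_iff_continuousAt]
  rintro ⟨t₀, x₀⟩
  set e := chartAt (Vec n) x₀ with he
  have hU : IsOpen ((univ : Set ℝ) ×ˢ e.target) := isOpen_univ.prod e.open_target
  have hmap : ContMDiffOn 𝓘(ℝ, ℝ × Vec n) (𝓘(ℝ, ℝ).prod (𝓡 n)) ∞
      (fun p : ℝ × Vec n => (p.1, e.symm p.2)) (univ ×ˢ e.target) :=
    (contDiff_fst.contMDiff.contMDiffOn).prodMk
      ((contMDiffOn_atlas_symm (chart_mem_atlas _ _)).comp
        (contDiff_snd.contMDiff.contMDiffOn) fun p hp => hp.2)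
  have hf : ContDiffOn ℝ ∞ (fun p : ℝ × Vec n => φ (p.1, e.symm p.2)) (univ ×ˢ e.target) :=
    (hφ.comp_contMDiffOn hmap).contDiffOn
  have hd : ContinuousOn (fun p : ℝ × M => fderiv ℝ (fun p : ℝ × Vec n => φ (p.1, e.symm p.2))
      (p.1, e p.2) (1, 0)) (univ ×ˢ e.source) := by
    refine (((hf.continuousOn_fderiv_of_isOpen hU (by simp)).clm_apply
      continuousOn_const).comp (f := fun p : ℝ × M => (p.1, e p.2)) ?_ fun p hp =>
        ⟨mem_univ _, e.map_source hp.2⟩)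
    exact continuousOn_fst.prodMk (e.continuousOn.comp continuousOn_snd fun p hp => hp.2)
  have hV : (univ : Set ℝ) ×ˢ e.source ∈ 𝓝 (t₀, x₀) :=
    (isOpen_univ.prod e.open_source).mem_nhds ⟨mem_univ _, mem_chart_source _ _⟩
  refine (hd.continuousAt hV).congr ?_
  filter_upwards [hV] with p hp
  have h1 : HasFDerivAt (fun p : ℝ × Vec n => φ (p.1, e.symm p.2))
      (fderiv ℝ (fun p : ℝ × Vec n => φ (p.1, e.symm p.2)) (p.1, e p.2)) (p.1, e p.2) :=
    ((hf.differentiableOn (by simp)).differentiableAt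
      (hU.mem_nhds ⟨mem_univ _, e.map_source hp.2⟩)).hasFDerivAt
  have h2 : HasDerivAt (fun s : ℝ => (s, e p.2)) ((1 : ℝ), (0 : Vec n)) p.1 :=
    (hasDerivAt_id _).prodMk (hasDerivAt_const _ _)
  have h3 := h1.comp_hasDerivAt p.1 h2
  rw [← h3.deriv]
  simp only [Function.comp_def, e.left_inv hp.2]

variable [CompactSpace M]

theorem exists_hasDerivAt_slice (hφ : ContMDiff (𝓘(ℝ, ℝ).prod (𝓡 n)) 𝓘(ℝ, ℝ) ∞ φ) :
    ∃ Φ Φ' : ℝ → C(M, ℝ), (∀ t x, Φ t x = φ (t, x)) ∧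
      (∀ t x, Φ' t x = deriv (fun s => φ (s, x)) t) ∧ Continuous Φ' ∧
      ∀ t, HasDerivAt Φ (Φ' t) t := by
  set Φ : ℝ → C(M, ℝ) := fun t => ⟨fun x => φ (t, x), (contMDiff_slice hφ t).continuous⟩ with hΦ
  have hc := continuous_deriv_time hφ
  set Φ' : C(ℝ, C(M, ℝ)) := ContinuousMap.curry ⟨_, hc⟩ with hΦ'
  refine ⟨Φ, Φ', fun t x => rfl, fun t x => rfl, Φ'.continuous, fun t => ?_⟩
  -- Written as the integral of its continuous derivative in `C(M, ℝ)`, the curve is differentiable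
  -- for the uniform norm, and hence in `L²`.
  have heq : Φ = fun t => Φ 0 + ∫ s in (0 : ℝ)..t, Φ' s := by
    funext t
    ext x
    have h1 : (∫ s in (0 : ℝ)..t, Φ' s) x = ∫ s in (0 : ℝ)..t, Φ' s x :=
      ((ContinuousMap.evalCLM ℝ x).intervalIntegral_comp_comm
        (Φ'.continuous.intervalIntegrable 0 t)).symm
    have h2 : ∫ s in (0 : ℝ)..t, Φ' s x = φ (t, x) - φ (0, x) :=
      intervalIntegral.integral_eq_sub_of_hasDerivAt
        (fun s _ => ((contDiff_time hφ x).differentiable (by simp) s).hasDerivAt)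
        (((continuous_eval_const x).comp Φ'.continuous).intervalIntegrable 0 t)
    rw [ContinuousMap.add_apply, h1, h2]
    simp [hΦ]
  rw [heq]
  exact ((Φ'.continuous.integral_hasStrictDerivAt 0 t).hasDerivAt).const_add _

end SpaceTime

end HamHeat

/-! ### Integration by parts in time. -/

namespace GradientFlow

theorem integrableOn_Ioi_of_continuousOn {f : ℝ → ℝ} {a b : ℝ} (ha : 0 < a)
    (hf : ∀ t, 0 < t → ContinuousAt f t) (h0 : ∀ t ∉ Icc a b, f t = 0) :
    IntegrableOn f (Ioi 0) := by
  have h1 : IntegrableOn f (Icc a b) := ContinuousOn.integrableOn_Icc fun t ht =>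
    (hf t (ha.trans_le ht.1)).continuousWithinAt
  exact h1.of_forall_sdiff_eq_zero measurableSet_Ioi fun t ht => h0 t ht.2

variable {H : Type*} [NormedAddCommGroup H] [InnerProductSpace ℝ H] {u ξ Φ Φ' : ℝ → H} {B : ℝ → ℝ}
  {a b : ℝ}

/-- Integration by parts in time along a curve that is weakly differentiable in time. -/
theorem integral_inner_eq_of_hasDerivAt (hu : ∀ t, 0 < t → ContinuousAt u t)
    (hd : ∀ t, 0 < t → ∀ ψ, HasDerivAt (fun s => inner ℝ (u s) ψ) (-inner ℝ (ξ t) ψ) t)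
    (hB : ∀ t, 0 < t → ∀ᶠ s in 𝓝 t, ‖ξ s‖ ≤ B t)
    (hξ : ∀ t, 0 < t → ∀ ψ, Tendsto (fun s => inner ℝ (ξ s) ψ) (𝓝 t) (𝓝 (inner ℝ (ξ t) ψ)))
    (hΦ : ∀ t, HasDerivAt Φ (Φ' t) t) (hΦ' : Continuous Φ') (ha : 0 < a)
    (h0 : ∀ t ∉ Icc a b, Φ t = 0) (h0' : ∀ t ∉ Icc a b, Φ' t = 0) :
    IntegrableOn (fun t => inner ℝ (u t) (Φ' t)) (Ioi 0) ∧
    IntegrableOn (fun t => inner ℝ (ξ t) (Φ t)) (Ioi 0) ∧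
    ∫ t in Ioi (0 : ℝ), inner ℝ (u t) (Φ' t) = ∫ t in Ioi (0 : ℝ), inner ℝ (ξ t) (Φ t) := by
  have h1 : IntegrableOn (fun t => inner ℝ (u t) (Φ' t)) (Ioi 0) :=
    integrableOn_Ioi_of_continuousOn ha (fun t ht => (hu t ht).inner hΦ'.continuousAt)
      fun t ht => by rw [h0' t ht, inner_zero_right]
  -- `ξ` is weakly continuous and locally bounded and `Φ` is strongly continuous, so their pairing
  -- is continuous.
  have h2 : IntegrableOn (fun t => inner ℝ (ξ t) (Φ t)) (Ioi 0) :=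
    integrableOn_Ioi_of_continuousOn ha
      (fun t ht => tendsto_inner_of_weak_of_strong (hB t ht) (hξ t ht) (hΦ t).continuousAt)
      fun t ht => by rw [h0 t ht, inner_zero_right]
  -- `u` is differentiable only weakly, so the product is split as `⟨u s, Φ s - Φ t⟩ + ⟨u s - u t, Φ
  -- t⟩`: strong continuity of `u` serves the first term and the weak derivative, tested with the
  -- fixed `Φ t`, the second.
  have h3 : ∀ t ∈ Ioi (0 : ℝ), HasDerivAt (fun s => inner ℝ (u s) (Φ s))
      (inner ℝ (u t) (Φ' t) - inner ℝ (ξ t) (Φ t)) t := by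
    intro t ht
    have h4 := (hasDerivAt_iff_tendsto_slope.1 (hΦ t))
    have h5 := (((hu t ht).tendsto.mono_left nhdsWithin_le_nhds).inner (𝕜 := ℝ) h4).add
      (hasDerivAt_iff_tendsto_slope.1 (hd t ht (Φ t)))
    rw [hasDerivAt_iff_tendsto_slope, sub_eq_add_neg]
    refine h5.congr fun s => ?_
    simp only [slope_def_field, slope_def_module, real_inner_smul_right, inner_sub_right]
    ring
  have hnear : ∀ t, t < a → inner ℝ (u t) (Φ t) = 0 := fun t ht => by
    rw [h0 t fun h => absurd h.1 (not_le.2 ht), inner_zero_right]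
  have h6 := integral_Ioi_of_hasDerivAt_of_tendsto (a := 0) (m := 0) (f := fun s =>
    inner ℝ (u s) (Φ s)) (f' := fun t => inner ℝ (u t) (Φ' t) - inner ℝ (ξ t) (Φ t)) (by
      have : (fun s => inner ℝ (u s) (Φ s)) =ᶠ[𝓝 0] fun _ => 0 := by
        filter_upwards [gt_mem_nhds ha] with s hs using hnear s hs
      exact (continuousAt_const.congr this.symm).continuousWithinAt) h3 (h1.sub h2) (by
      refine tendsto_const_nhds.congr' ?_
      filter_upwards [eventually_gt_atTop b] with s hs
      rw [h0 s fun h => absurd h.2 (not_le.2 hs), inner_zero_right])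
  rw [integral_sub h1 h2, hnear 0 ha, sub_zero, sub_eq_zero] at h6
  exact ⟨h1, h2, h6⟩

end GradientFlow

/-! ### The weak heat equation and gradient curves. -/

namespace HamHeat

open FibreLagrangian GradientFlow

section Heat

variable {n : ℕ} {M : Type*} [TopologicalSpace M] [ChartedSpace (Vec n) M]

theorem exists_time_bounds [CompactSpace M] {φ : ℝ × M → ℝ} (hc : HasCompactSupport φ)
    (hs : tsupport φ ⊆ Ioi (0 : ℝ) ×ˢ (univ : Set M)) :
    ∃ a b : ℝ, 0 < a ∧ ∀ t ∉ Icc a b, ∀ x, (t, x) ∉ tsupport φ := by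
  have hK : IsCompact (Prod.fst '' tsupport φ) := hc.isCompact.image continuous_fst
  rcases (Prod.fst '' tsupport φ).eq_empty_or_nonempty with he | hne
  · exact ⟨1, 1, one_pos, fun t _ x hx => (he ▸ mem_image_of_mem Prod.fst hx : t ∈ (∅ : Set ℝ))⟩
  obtain ⟨a, ha⟩ := hK.exists_isLeast hne
  obtain ⟨b, hb⟩ := hK.exists_isGreatest hne
  refine ⟨a, b, ?_, fun t ht x hx => ht ⟨ha.2 (mem_image_of_mem _ hx), hb.2 (mem_image_of_mem _ hx)⟩⟩
  obtain ⟨p, hp, rfl⟩ := ha.1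
  exact (hs hp).1

theorem deriv_time_eq_zero {φ : ℝ × M → ℝ} {t : ℝ} {x : M} (h : (t, x) ∉ tsupport φ) :
    deriv (fun s => φ (s, x)) t = 0 := by
  have h1 : ∀ᶠ s in 𝓝 t, φ (s, x) = 0 := by
    have : ContinuousAt (fun s : ℝ => (s, x)) t := by fun_prop
    filter_upwards [this ((isClosed_tsupport φ).isOpen_compl.mem_nhds h)] with s hs
    exact image_eq_zero_of_notMem_tsupport hs
  rw [EventuallyEq.deriv_eq (f := fun _ => (0 : ℝ)) h1, deriv_const]

variable [MeasurableSpace M]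
  [T2Space M] [CompactSpace M] [BorelSpace M] [IsManifold (𝓡 n) ∞ M]
  {m : Measure M} [IsFiniteMeasure m]
  {L : TangentBundle (𝓡 n) M → ℝ}
  (hm : IsPositiveSmoothMeasure n m) (hL : IsLagrangian L) (hH : HamiltonianFinite L)
  {g : RiemMetric n M} (hA : ConditionA g L) (c : ChartCover n M) {u ξ : ℝ → Lp ℝ 2 m} {B : ℝ → ℝ}

include hm hL hH hA c

theorem isWeakHeatSolution_of_hasDerivAt (hu : ∀ t, 0 < t → ContinuousAt u t)
    (hs : ∀ t, 0 < t →
      IsSubgradient (sobolevH L m) (fun u => (energy L m u).toReal) (u t) (ξ t))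
    (hd : ∀ t, 0 < t → ∀ ψ, HasDerivAt (fun s => inner ℝ (u s) ψ) (-inner ℝ (ξ t) ψ) t)
    (hB : ∀ t, 0 < t → ∀ᶠ s in 𝓝 t, ‖ξ s‖ ≤ B t)
    (hξ : ∀ t, 0 < t → ∀ ψ, Tendsto (fun s => inner ℝ (ξ s) ψ) (𝓝 t) (𝓝 (inner ℝ (ξ t) ψ))) :
    IsWeakHeatSolution L m u := by
  intro φ hφ hc hsupp
  obtain ⟨Φ, Φ', hΦe, hΦe', hΦc, hΦd⟩ := exists_hasDerivAt_slice hφ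
  obtain ⟨a, b, ha, hab⟩ := exists_time_bounds hc hsupp
  have hΦs : ∀ t, (Φ t : M → ℝ) = fun x => φ (t, x) := fun t => funext (hΦe t)
  have hsm : ∀ t, ContMDiff (𝓡 n) 𝓘(ℝ, ℝ) ∞ (Φ t) := fun t => by
    rw [hΦs]
    exact contMDiff_slice hφ t
  have h0 : ∀ t ∉ Icc a b, Φ t = 0 := fun t ht => by
    ext x
    rw [hΦe]
    exact image_eq_zero_of_notMem_tsupport (hab t ht x)
  have h0' : ∀ t ∉ Icc a b, Φ' t = 0 := fun t ht => by
    ext x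
    rw [hΦe']
    exact deriv_time_eq_zero (hab t ht x)
  have key := integral_inner_eq_of_hasDerivAt hu hd hB hξ
    (fun t => (ContinuousMap.toLp 2 m ℝ).hasFDerivAt.comp_hasDerivAt t (hΦd t))
    ((ContinuousMap.toLp 2 m ℝ).continuous.comp hΦc) ha
    (fun t ht => by rw [Function.comp_apply, h0 t ht, map_zero])
    (fun t ht => by rw [Function.comp_apply, h0' t ht, map_zero])
  have hleft : ∀ t, inner ℝ (u t) (ContinuousMap.toLp 2 m ℝ (Φ' t)) =
      ∫ x, deriv (fun s => φ (s, x)) t * u t x ∂m := fun t => by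
    rw [inner_continuousMap_toLp]
    simp only [hΦe', mul_comm]
  have hright : ∀ t ∈ Ioi (0 : ℝ), inner ℝ (ξ t) (ContinuousMap.toLp 2 m ℝ (Φ t)) =
      ∫ x, diff n (fun y => φ (t, y)) x (grad L (u t : M → ℝ) x) ∂m := fun t ht => by
    rw [inner_subgradient_smooth hm hL hH hA c (hs t ht) (hsm t), hΦs]
  simp only [Function.comp_apply, hleft] at key
  refine ⟨fun t ht => ⟨?_, integrable_diff_grad hm hL hH hA c (hs t ht).1 (contMDiff_slice hφ t)⟩,
    key.1, key.2.1.congr_fun hright measurableSet_Ioi, ?_⟩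
  · obtain ⟨C, hC⟩ := isCompact_univ.exists_bound_of_continuousOn (Φ' t).continuous.continuousOn
    have := (integrable_coeFn (u t)).bdd_mul (Φ' t).continuous.measurable.aestronglyMeasurable
      (Eventually.of_forall fun x => hC x (mem_univ x))
    simpa only [hΦe'] using this
  · rw [key.2.2]
    exact setIntegral_congr_fun measurableSet_Ioi hright

end Heat

section Curve

variable {n : ℕ} {M : Type*} [TopologicalSpace M] [ChartedSpace (Vec n) M] [MeasurableSpace M]
  [T2Space M] [CompactSpace M] [BorelSpace M] [IsManifold (𝓡 n) ∞ M]
  {m : Measure M} [IsFiniteMeasure m]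
  {L : TangentBundle (𝓡 n) M → ℝ}
  (hm : IsPositiveSmoothMeasure n m) (hL : IsLagrangian L) (hH : HamiltonianFinite L)
  {g : RiemMetric n M} (hA : ConditionA g L) (c : ChartCover n M) {u₀ : Lp ℝ 2 m}
  (hu₀ : u₀ ∈ sobolevH L m)

include hm hL hH hA c hu₀

/-- Minimizers are unique, so any scheme admitted in the definition is the one built from
`resolvent`; every gradient curve is therefore its limit. -/
theorem tendsto_euler_of_isGradientCurve {u : ℝ → Lp ℝ 2 m} (hu : IsGradientCurve L m u₀ u)
    {t : ℝ} (ht : 0 < t) :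
    Tendsto (fun k : ℕ => euler (sobolevH L m) (fun u => (energy L m u).toReal) u₀ (t / k) k)
      atTop (𝓝 (u t)) := by
  obtain ⟨σ, hσ, hlim⟩ := hu.scheme t ht
  refine hlim.congr' ?_
  filter_upwards [eventually_ge_atTop 1] with k hk
  have hk' : (0 : ℝ) < k := by exact_mod_cast hk
  have hδ : 0 < t / k := div_pos ht hk'
  exact euler_eq_of_isStep (convexOn_energy hm hL hH hA c) (fun _ _ => ENNReal.toReal_nonneg)
    (isClosed_energy_le hm hL hH hA c) hu₀ hδ (hσ k hk).1
    (fun j hj => (isImplicitStep_iff hm hL hH hA c hδ).1 ((hσ k hk).2 j hj)) le_rfl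

theorem exists_isGradientCurve : ∃ u : ℝ → Lp ℝ 2 m, IsGradientCurve L m u₀ u := by
  have hF := convexOn_energy hm hL hH hA c
  have hF0 : ∀ u ∈ sobolevH L m, 0 ≤ (energy L m u).toReal := fun _ _ => ENNReal.toReal_nonneg
  have hcl := isClosed_energy_le hm hL hH hA c
  choose! z hz using fun t (ht : (0 : ℝ) < t) => exists_flow hF hF0 hcl hu₀ ht
  have hz' : ∀ t, 0 < t → Tendsto (fun k : ℕ =>
      euler (sobolevH L m) (fun u => (energy L m u).toReal) u₀ (t / k) k) atTop
      (𝓝 (Function.update z 0 u₀ t)) := fun t ht => by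
    rw [Function.update_of_ne ht.ne']
    exact hz t ht
  -- The scheme determines the curve only at positive times; the value at time `0` is set to `u₀`.
  refine ⟨Function.update z 0 u₀, Function.update_self _ _ _,
    flow_tendsto_start hF hF0 hcl hu₀ hz', fun t ht =>
    ⟨fun k j => euler (sobolevH L m) (fun u => (energy L m u).toReal) u₀ (t / k) j,
      fun k hk => ⟨rfl, fun j _ => ?_⟩, hz' t ht⟩⟩
  have hk' : (0 : ℝ) < k := by exact_mod_cast hk
  exact (isImplicitStep_iff hm hL hH hA c (div_pos ht hk')).2
    (isStep_euler hF hF0 hcl hu₀ (div_pos ht hk') j)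

end Curve

end HamHeat

theorem mainTheorem4 {n : ℕ} (hn : 2 ≤ n)
    {M : Type*} [TopologicalSpace M] [T2Space M] [CompactSpace M] [ConnectedSpace M]
    [ChartedSpace (HamHeat.Vec n) M] [IsManifold (𝓡 n) ∞ M]
    [MeasurableSpace M] [BorelSpace M]
    (m : Measure M) (hm : HamHeat.IsPositiveSmoothMeasure n m)
    (g : HamHeat.RiemMetric n M)
    (L : TangentBundle (𝓡 n) M → ℝ) (hL : HamHeat.IsLagrangian L)
    (hH : HamHeat.HamiltonianFinite L) (hA : HamHeat.ConditionA g L)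
    (u₀ : Lp ℝ 2 m) (hu₀ : u₀ ∈ HamHeat.sobolevH L m) :
    (∃ u : ℝ → Lp ℝ 2 m, HamHeat.IsGradientCurve L m u₀ u) ∧
    ∀ u : ℝ → Lp ℝ 2 m, HamHeat.IsGradientCurve L m u₀ u →
      (∀ t : ℝ, 0 ≤ t → u t ∈ HamHeat.sobolevH L m) ∧
      HamHeat.IsWeakHeatSolution L m u ∧
      ∀ t : ℝ, 0 < t →
        HamHeat.slope L m (u t) < ⊤ ∧
        u t ∈ HamHeat.sobolevL L m ∧
        ∃ w : Lp ℝ 2 m,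
          (∀ w' : Lp ℝ 2 m, HamHeat.IsGradientVector L m (u t) w' ↔ w' = w) ∧
          (∀ f : Lp ℝ 2 m, HamHeat.HasLaplacianDensity L m (u t) f ↔ f = w) ∧
          ((‖w‖ : ℝ) : EReal) = HamHeat.slope L m (u t) := by
  obtain ⟨c⟩ : Nonempty (HamHeat.ChartCover n M) := HamHeat.nonempty_chartCover
  have : IsFiniteMeasure m := HamHeat.isFiniteMeasure_of_isPositiveSmoothMeasure c hm
  refine ⟨HamHeat.exists_isGradientCurve hm hL hH hA c hu₀, fun u hu => ?_⟩
  have hF := HamHeat.convexOn_energy hm hL hH hA c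
  have hF0 : ∀ u ∈ HamHeat.sobolevH L m, 0 ≤ (HamHeat.energy L m u).toReal :=
    fun _ _ => ENNReal.toReal_nonneg
  have hcl := HamHeat.isClosed_energy_le hm hL hH hA c
  have hlim := fun t (ht : 0 < t) =>
    HamHeat.tendsto_euler_of_isGradientCurve hm hL hH hA c hu₀ hu ht
  choose! ξ hξ _ using fun t (ht : 0 < t) =>
    GradientFlow.flow_exists_subgradient hF hF0 hcl hu₀ hlim ht
  -- Uniqueness of the subgradient is the assumption under which the flow is weakly differentiable
  -- at every time.
  have huniq := fun t (ht : 0 < t) => HamHeat.isSubgradient_energy_iff hm hL hH hA c (hξ t ht)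
  -- The single vector `-ξ t` is at once the gradient vector and the density of the Laplacian.
  refine ⟨fun t ht => ?_, ?_, fun t ht => ⟨?_, ?_, -ξ t, ?_, ?_, ?_⟩⟩
  · rcases ht.eq_or_lt with rfl | ht
    · rwa [hu.initial]
    · exact (hξ t ht).1
  · exact HamHeat.isWeakHeatSolution_of_hasDerivAt hm hL hH hA c
      (fun t ht => GradientFlow.flow_continuousAt hF hF0 hcl hu₀ hlim ht) hξ
      (fun t ht => GradientFlow.flow_hasDerivAt hF hF0 hcl hu₀ hlim huniq ht)
      (fun t ht => GradientFlow.flow_norm_subgradient_bound hF hF0 hcl hu₀ hlim huniq ht)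
      (fun t ht => GradientFlow.flow_tendsto_inner_subgradient hF hF0 hcl hu₀ hlim huniq ht)
  · rw [HamHeat.slope_eq_norm hm hL hH hA c (hξ t ht)]
    exact EReal.coe_lt_top _
  · exact HamHeat.mem_sobolevL_of_isSubgradient hm hL hH hA c (hξ t ht)
  · exact HamHeat.isGradientVector_iff hm hL hH hA c (hξ t ht)
  · exact HamHeat.hasLaplacianDensity_iff hm hL hH hA c (hξ t ht)
  · rw [HamHeat.slope_eq_norm hm hL hH hA c (hξ t ht), norm_neg]
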